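/- Let $\Bbbk$ be a field of characteristic zero and let $\mathsf{FB}$ be the category of finite sets and bijections. A $\Bbbk\mathsf{FB}$-module (resp. $\Bbbk(\mathsf{FB}\times\mathsf{FB})$-module) is a functor from $\mathsf{FB}$ (resp. $\mathsf{FB}\times\mathsf{FB}$) to $\Bbbk$-vector spaces. Let $\odot$ and $\circledcirc$ be the Day convolution products, $$(M\odot N)(X)=\bigoplus_{X=S_1\amalg S_2}M(S_1)\otimes N(S_2),\qquad (M\circledcirc N)(X,Y)=\bigoplus_{X=S_1\amalg S_2,\;Y=T_1\amalg T_2}M(S_1,T_1)\otimes N(S_2,T_2),$$ with their symmetric and exterior powers $S^*$, $\Lambda^*$. Let $\Bbbk_{\mathbf 2}$ (resp. $\Bbbk_{(\mathbf 1,\mathbf 1)}$) be the module supported on sets with two elements (resp. on pairs of sets with one element each), with value $\Bbbk$ and trivial action. A *cyclic operad without unit* is a $\Bbbk\mathsf{FB}$-module $\mathscr C$ with $\mathscr C(\emptyset)=0$ and a morphism $\mu:\mathscr C\odot\mathscr C\to\mathscr C\odot\Bbbk_{\mathbf 2}$ that is * diagonal: the component $\mathscr C(U)\otimes\mathscr C(V)\to\mathscr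 C((U\amalg V)\setminus\{x,y\})$ is zero if $\{x,y\}\subset U$ or $\{x,y\}\subset V$; * symmetric: it factors through $S^2\mathscr C$; * associative: the composite $S^3\mathscr C\to S^2\mathscr C\odot\Bbbk_{\mathbf 2}\to\mathscr C\odot\Bbbk_{\mathbf 2}\odot\Bbbk_{\mathbf 2}\to\mathscr C\odot\Lambda^2\Bbbk_{\mathbf 2}$ induced by $\mu$ is zero, where $S^3\mathscr C\to S^2\mathscr C\odot\Bbbk_{\mathbf 2}$ is the composite $S^3\mathscr C\to\mathscr C\odot S^2\mathscr C\to\mathscr C\odot\mathscr C\odot\Bbbk_{\mathbf 2}\to S^2\mathscr C\odot\Bbbk_{\mathbf 2}$ of the coproduct, $\mu$ and the product. A *unit* is a morphism $\eta:\Bbbk_{\mathbf 2}\to\mathscr C$ such that $\mu\circ(\mathrm{Id}\odot\eta)$ is the relabelling map $\rho:\mathscr C\odot\Bbbk_{\mathbf 2}\to\mathscr C\odot\Bbbk_{\mathbf 2}$ and $\mu\circ(\eta\odot\mathrm{Id})$ is $\rho$ composed with the symmetry. Here the component $\mathscr C(X\setminus\{u,v\})\to\mathscr C(X\setminus\{x,y\})$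 of $\rho$ is zero unless $\{u,v\}\cap\{x,y\}$ has exactly one element, in which case, if $u=y$ and $v\neq x$, it is induced by the bijection that sends $x$ to $v$ and fixes all the other elements. *Dioperads* $\mathscr D$ with or without unit are defined in the same way, with $\mathsf{FB}\times\mathsf{FB}$, $\circledcirc$ and $\Bbbk_{(\mathbf 1,\mathbf 1)}$ instead of $\mathsf{FB}$, $\odot$ and $\Bbbk_{\mathbf 2}$: $\mathscr D(\emptyset,\emptyset)=0$; the component of $\mu:\mathscr D\circledcirc\mathscr D\to\mathscr D\circledcirc\Bbbk_{(\mathbf 1,\mathbf 1)}$ on $\mathscr D(U,V)\otimes\mathscr D(X,Y)$ indexed by $(s,t)\in(U\amalg X)\times(V\amalg Y)$ is zero if $(s,t)\in U\times V$ or $(s,t)\in X\times Y$; and the component of $\rho$ from the summand indexed by $(a,b)$ to the one indexed by $(s,t)$ is zero unless exactly one of $a=s$, $b=t$ holds, in which case it is induced by the bijection that sends $t$ to $b$ (resp. $s$ to $a$) and fixes all the other elements. Morphisms are the morphisms of modules that are compatible with $\mu$ (and with $\eta$). Write $\mathsf{CyclOpd}$, $\mathsf{DiOpd}$ for the categories with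 unit and $\mathsf{CyclOpd}^{\mathrm{nu}}$, $\mathsf{DiOpd}^{\mathrm{nu}}$ for those without unit. **Theorem.** 1. The functor $\amalg^*$ from $\Bbbk\mathsf{FB}$-modules to $\Bbbk(\mathsf{FB}\times\mathsf{FB})$-modules, $(\amalg^*\mathscr C)(X,Y)=\mathscr C(X\amalg Y)$, induces functors $\mathsf{CyclOpd}\to\mathsf{DiOpd}$ and $\mathsf{CyclOpd}^{\mathrm{nu}}\to\mathsf{DiOpd}^{\mathrm{nu}}$ that are compatible with forgetting the unit. The structure maps are obtained by applying $\amalg^*$ to $\mu$ and $\eta$ and using the symmetric monoidal structure of $\amalg^*$ together with the projection $\amalg^*\Bbbk_{\mathbf 2}\to\Bbbk_{(\mathbf 1,\mathbf 1)}$ and the inclusion $\Bbbk_{(\mathbf 1,\mathbf 1)}\to\amalg^*\Bbbk_{\mathbf 2}$ that are the identity of $\Bbbk$ on $(\mathbf 1,\mathbf 1)$. 2. The functor $\amalg_*$ from $\Bbbk(\mathsf{FB}\times\mathsf{FB})$-modules to $\Bbbk\mathsf{FB}$-modules, $(\amalg_*\mathscr D)(X)=\bigoplus_{X=X_1\amalg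 X_2}\mathscr D(X_1,X_2)$ (sum over ordered decompositions), induces functors $\mathsf{DiOpd}\to\mathsf{CyclOpd}$ and $\mathsf{DiOpd}^{\mathrm{nu}}\to\mathsf{CyclOpd}^{\mathrm{nu}}$ that are compatible with forgetting the unit. The structure maps are obtained by applying $\amalg_*$ to $\mu$ and $\eta$ and using the symmetric monoidal structure of $\amalg_*$ together with the projection $\amalg_*\Bbbk_{(\mathbf 1,\mathbf 1)}\to\Bbbk_{\mathbf 2}$ that adds the scalars of the two summands and the inclusion $\Bbbk_{\mathbf 2}\to\amalg_*\Bbbk_{(\mathbf 1,\mathbf 1)}$ that sends $1$ to the sum of the generators of the two summands. -/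

import Mathlib

open CategoryTheory CategoryTheory.Limits TensorProduct

universe u

namespace CycDi

/-! ### Families of finite sets -/

/-- An object of `FB^c`: a family of finite sets indexed by `c`. -/
structure FinFam (c : Type) where
  carrier : c → Type
  [fin : ∀ i, Finite (carrier i)]

attribute [instance] FinFam.fin

/-- Morphisms of `FB^c` are families of bijections. -/
instance FinFam.category (c : Type) : Category (FinFam c) where
  Hom X Y := ∀ i, X.carrier i ≃ Y.carrier i
  id X := fun i => Equiv.refl (X.carrier i)
  comp f g := fun i => (f i).trans (g i)

/-- The two colours of the labels of a dioperad. -/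
inductive Side : Type
  | input : Side
  | output : Side

instance Side.finite : Finite Side :=
  Finite.of_injective (fun s : Side => (match s with | .input => true | .output => false : Bool))
    (by intro a b h; cases a <;> cases b <;> simp_all)

/-- The category `FB` of finite sets and bijections. -/
abbrev FB : Type 1 := FinFam Unit

/-- The category `FB × FB` of pairs (set of inputs, set of outputs) of finite sets. -/
abbrev FB2 : Type 1 := FinFam Side

section Families

variable {c : Type}

/-- A subset of a family is a family of subsets. -/
abbrev Sub (X : FinFam c) : Type := ∀ i, Set (X.carrier i)

/-- A subset of a family, viewed as a family. -/
abbrev part {X : FinFam c} (S : Sub X) : FinFam c where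
  carrier i := S i

/-- The inverse of a morphism of `FB^c`. -/
def inv {X Y : FinFam c} (f : X ⟶ Y) : Y ⟶ X := fun i => (f i).symm

/-- The restriction of a bijection `f` to subsets `S`, `T` with `S = f ⁻¹ T`. -/
def restr {X Y : FinFam c} (f : X ⟶ Y) (S : Sub X) (T : Sub Y)
    (h : ∀ i x, x ∈ S i ↔ f i x ∈ T i) : part S ⟶ part T :=
  fun i => (f i).subtypeEquiv (h i)

/-- `T ∩ S` as a subset of `S`. -/
abbrev inner {X : FinFam c} (S T : Sub X) : Sub (part S) := fun i => {x | x.1 ∈ T i}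

/-- A subset `T` of a subset `S` of `X`, seen inside `S` or inside `X`. -/
def flatten {X : FinFam c} (S T : Sub X) (h : ∀ i x, x ∈ T i → x ∈ S i) :
    part (inner S T) ⟶ part T :=
  fun _ =>
    { toFun := fun x => ⟨x.1.1, x.2⟩
      invFun := fun y => ⟨⟨y.1, h _ _ y.2⟩, y.2⟩
      left_inv := fun _ => rfl
      right_inv := fun _ => rfl }

/-- Ordered decompositions `X = fst ⨿ snd` into two subsets. -/
@[ext]
structure Dec (X : FinFam c) where
  fst : Sub X
  snd : Sub X
  compl : ∀ i x, x ∈ snd i ↔ x ∉ fst i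

namespace Dec

/-- Exchanging the two pieces. -/
abbrev swap {X : FinFam c} (d : Dec X) : Dec X where
  fst := d.snd
  snd := d.fst
  compl i x := by have := d.compl i x; tauto

/-- The preimage of a decomposition under a bijection. -/
abbrev pull {X Y : FinFam c} (f : X ⟶ Y) (d : Dec Y) : Dec X where
  fst i := {x | f i x ∈ d.fst i}
  snd i := {x | f i x ∈ d.snd i}
  compl i x := d.compl i (f i x)

/-- The decomposition of a subset `S` of `X` induced by a decomposition of `X`. -/
abbrev inside {X : FinFam c} (d : Dec X) (S : Sub X) : Dec (part S) where
  fst := inner S d.fst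
  snd := inner S d.snd
  compl i x := d.compl i x.1

end Dec

/-- Ordered decompositions `X = s₁ ⨿ s₂ ⨿ s₃` into three subsets. -/
@[ext]
structure Dec3 (X : FinFam c) where
  s₁ : Sub X
  s₂ : Sub X
  s₃ : Sub X
  exact_one : ∀ i x, (x ∈ s₁ i ∧ x ∉ s₂ i ∧ x ∉ s₃ i) ∨ (x ∉ s₁ i ∧ x ∈ s₂ i ∧ x ∉ s₃ i) ∨
    (x ∉ s₁ i ∧ x ∉ s₂ i ∧ x ∈ s₃ i)

namespace Dec3

/-- The preimage of a decomposition under a bijection. -/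
abbrev pull {X Y : FinFam c} (f : X ⟶ Y) (t : Dec3 Y) : Dec3 X where
  s₁ i := {x | f i x ∈ t.s₁ i}
  s₂ i := {x | f i x ∈ t.s₂ i}
  s₃ i := {x | f i x ∈ t.s₃ i}
  exact_one i x := t.exact_one i (f i x)

/-- `X = (s₁ ∪ s₂) ⨿ s₃`. -/
def left {X : FinFam c} (t : Dec3 X) : Dec X where
  fst i := t.s₁ i ∪ t.s₂ i
  snd := t.s₃
  compl i x := by have := t.exact_one i x; simp only [Set.mem_union]; tauto

/-- `s₁ ∪ s₂ = s₁ ⨿ s₂`. -/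
def leftIn {X : FinFam c} (t : Dec3 X) : Dec (part t.left.fst) where
  fst := inner t.left.fst t.s₁
  snd := inner t.left.fst t.s₂
  compl i x := by
    have h := t.exact_one i x.1
    have h' : x.1 ∈ t.s₁ i ∨ x.1 ∈ t.s₂ i := x.2
    change x.1 ∈ t.s₂ i ↔ ¬ x.1 ∈ t.s₁ i
    tauto

/-- `X = s₁ ⨿ (s₂ ∪ s₃)`. -/
def right {X : FinFam c} (t : Dec3 X) : Dec X where
  fst := t.s₁
  snd i := t.s₂ i ∪ t.s₃ i
  compl i x := by have := t.exact_one i x; simp only [Set.mem_union]; tauto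

/-- `s₂ ∪ s₃ = s₂ ⨿ s₃`. -/
def rightIn {X : FinFam c} (t : Dec3 X) : Dec (part t.right.snd) where
  fst := inner t.right.snd t.s₂
  snd := inner t.right.snd t.s₃
  compl i x := by
    have h := t.exact_one i x.1
    have h' : x.1 ∈ t.s₂ i ∨ x.1 ∈ t.s₃ i := x.2
    change x.1 ∈ t.s₃ i ↔ ¬ x.1 ∈ t.s₂ i
    tauto

end Dec3

instance Dec.finite [Finite c] (X : FinFam c) : Finite (Dec X) :=
  Finite.of_injective (fun d : Dec X => (d.fst, d.snd)) (by
    intro d e h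
    simp only [Prod.mk.injEq] at h
    exact Dec.ext h.1 h.2)

instance Dec3.finite [Finite c] (X : FinFam c) : Finite (Dec3 X) :=
  Finite.of_injective (fun d : Dec3 X => (d.s₁, d.s₂, d.s₃)) (by
    intro d e h
    simp only [Prod.mk.injEq] at h
    exact Dec3.ext h.1 h.2.1 h.2.2)

noncomputable instance Dec.fintype [Finite c] (X : FinFam c) : Fintype (Dec X) :=
  Fintype.ofFinite _

noncomputable instance Dec3.fintype [Finite c] (X : FinFam c) : Fintype (Dec3 X) :=
  Fintype.ofFinite _

noncomputable instance Dec.decEq (X : FinFam c) : DecidableEq (Dec X) := Classical.decEq _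

end Families

/-! ### Modules and Day convolution -/

section Modules

variable {c : Type} {k : Type u} [Field k]

/-- The category of `k FB^c`-modules: functors from `FB^c` to `k`-vector spaces. -/
abbrev FMod (c : Type) (k : Type u) [Field k] : Type (max 1 (u + 1)) :=
  FinFam c ⥤ ModuleCat.{u} k

/-- Day convolution `(M ⊙ N)(X) = ⨁_{X = S₁ ⨿ S₂} M(S₁) ⊗ N(S₂)`. The direct sum over the finite
set of ordered decompositions is realised as a product. -/
noncomputable def day (M N : FMod c k) : FMod c k where
  obj X := ModuleCat.of k (∀ d : Dec X, M.obj (part d.fst) ⊗[k] N.obj (part d.snd))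
  map {X Y} f := ModuleCat.ofHom (LinearMap.pi fun d : Dec Y =>
    (TensorProduct.map (M.map (restr f (d.pull f).fst d.fst fun _ _ => Iff.rfl)).hom
      (N.map (restr f (d.pull f).snd d.snd fun _ _ => Iff.rfl)).hom) ∘ₗ
        LinearMap.proj (d.pull f))
  map_id X := by
    ext φ d
    change TensorProduct.map (M.map (𝟙 (part d.fst))).hom (N.map (𝟙 (part d.snd))).hom (φ d) = φ d
    simp
  map_comp {X Y Z} f g := by
    ext φ d
    change TensorProduct.map
      (M.map (restr f (d.pull (f ≫ g)).fst (d.pull g).fst (fun _ _ => Iff.rfl) ≫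
        restr g (d.pull g).fst d.fst fun _ _ => Iff.rfl)).hom
      (N.map (restr f (d.pull (f ≫ g)).snd (d.pull g).snd (fun _ _ => Iff.rfl) ≫
        restr g (d.pull g).snd d.snd fun _ _ => Iff.rfl)).hom (φ (d.pull (f ≫ g))) = _
    rw [M.map_comp, N.map_comp, ModuleCat.hom_comp, ModuleCat.hom_comp, TensorProduct.map_comp]
    rfl

variable {X : FinFam c}

/-- The projection of `(M ⊙ N)(X)` to the summand indexed by `d`. -/
noncomputable def dayProj (M N : FMod c k) (d : Dec X) :
    (day M N).obj X →ₗ[k] M.obj (part d.fst) ⊗[k] N.obj (part d.snd) :=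
  LinearMap.proj (φ := fun d : Dec X => M.obj (part d.fst) ⊗[k] N.obj (part d.snd)) d

/-- The inclusion in `(M ⊙ N)(X)` of the summand indexed by `d`. -/
noncomputable def dayIncl (M N : FMod c k) (d : Dec X) :
    M.obj (part d.fst) ⊗[k] N.obj (part d.snd) →ₗ[k] (day M N).obj X :=
  LinearMap.single k (fun d : Dec X => M.obj (part d.fst) ⊗[k] N.obj (part d.snd)) d

/-- The linear map to `(M ⊙ N)(X)` with given components. -/
noncomputable def dayLift (M N : FMod c k) {V : Type u} [AddCommGroup V] [Module k V]
    (a : ∀ d : Dec X, V →ₗ[k] M.obj (part d.fst) ⊗[k] N.obj (part d.snd)) :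
    V →ₗ[k] (day M N).obj X :=
  LinearMap.pi a

theorem dayProj_comp_dayLift (M N : FMod c k) {V : Type u} [AddCommGroup V] [Module k V]
    (a : ∀ d : Dec X, V →ₗ[k] M.obj (part d.fst) ⊗[k] N.obj (part d.snd)) (d : Dec X) :
    dayProj M N d ∘ₗ dayLift M N a = a d := rfl

theorem dayProj_comp_map (M N : FMod c k) {X Y : FinFam c} (f : X ⟶ Y) (d : Dec Y) :
    dayProj M N d ∘ₗ ((day M N).map f).hom =
      TensorProduct.map (M.map (restr f (d.pull f).fst d.fst fun _ _ => Iff.rfl)).hom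
        (N.map (restr f (d.pull f).snd d.snd fun _ _ => Iff.rfl)).hom ∘ₗ
          dayProj M N (d.pull f) := rfl

theorem day_hom_ext {M N : FMod c k} {V : Type u} [AddCommGroup V] [Module k V]
    {a b : V →ₗ[k] (day M N).obj X} (h : ∀ d, dayProj M N d ∘ₗ a = dayProj M N d ∘ₗ b) : a = b :=
  LinearMap.ext fun v => funext fun d => LinearMap.congr_fun (h d) v

/-- Functoriality of Day convolution. -/
noncomputable def dayMap {M M' N N' : FMod c k} (a : M ⟶ M') (b : N ⟶ N') :
    day M N ⟶ day M' N' where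
  app X := ModuleCat.ofHom (dayLift M' N' fun d : Dec X =>
    TensorProduct.map (a.app (part d.fst)).hom (b.app (part d.snd)).hom ∘ₗ dayProj M N d)
  naturality {X Y} f := by
    refine ModuleCat.hom_ext (day_hom_ext fun d => ?_)
    change (TensorProduct.map (a.app (part d.fst)).hom (b.app (part d.snd)).hom ∘ₗ
      TensorProduct.map (M.map (restr f (d.pull f).fst d.fst _)).hom
        (N.map (restr f (d.pull f).snd d.snd _)).hom) ∘ₗ dayProj M N (d.pull f) =
      (TensorProduct.map (M'.map (restr f (d.pull f).fst d.fst _)).hom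
        (N'.map (restr f (d.pull f).snd d.snd _)).hom ∘ₗ
       TensorProduct.map (a.app (part (d.pull f).fst)).hom
        (b.app (part (d.pull f).snd)).hom) ∘ₗ dayProj M N (d.pull f)
    simp only [← TensorProduct.map_comp, ← ModuleCat.hom_comp, NatTrans.naturality]

/-- The symmetry `M ⊙ N ≅ N ⊙ M`. -/
noncomputable def braid (M N : FMod c k) : day M N ⟶ day N M where
  app X := ModuleCat.ofHom (dayLift N M fun d : Dec X =>
    (TensorProduct.comm k (M.obj (part d.snd)) (N.obj (part d.fst))).toLinearMap ∘ₗ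
      dayProj M N d.swap)
  naturality {X Y} f := by
    refine ModuleCat.hom_ext (day_hom_ext fun d => ?_)
    exact congrArg (· ∘ₗ dayProj M N (d.pull f).swap) (TensorProduct.map_comp_comm_eq
      (N.map (restr f (d.pull f).fst d.fst fun _ _ => Iff.rfl)).hom
      (M.map (restr f (d.pull f).snd d.snd fun _ _ => Iff.rfl)).hom).symm

variable (M N P : FMod c k)

/-- The inclusion of the summand of `((M ⊙ N) ⊙ P)(X)` indexed by `X = s₁ ⨿ s₂ ⨿ s₃`. -/
noncomputable def inclLeft (t : Dec3 X) :
    M.obj (part t.s₁) ⊗[k] (N.obj (part t.s₂) ⊗[k] P.obj (part t.s₃)) →ₗ[k]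
      (day (day M N) P).obj X :=
  dayIncl (day M N) P t.left ∘ₗ
    TensorProduct.map
      (dayIncl M N t.leftIn ∘ₗ
        TensorProduct.map
          (M.map (inv (flatten t.left.fst t.s₁ fun _ _ => Or.inl))).hom
          (N.map (inv (flatten t.left.fst t.s₂ fun _ _ => Or.inr))).hom)
      LinearMap.id ∘ₗ
    (TensorProduct.assoc k _ _ _).symm.toLinearMap

/-- The projection to the summand of `((M ⊙ N) ⊙ P)(X)` indexed by `X = s₁ ⨿ s₂ ⨿ s₃`. -/
noncomputable def projLeft (t : Dec3 X) :
    (day (day M N) P).obj X →ₗ[k]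
      M.obj (part t.s₁) ⊗[k] (N.obj (part t.s₂) ⊗[k] P.obj (part t.s₃)) :=
  (TensorProduct.assoc k _ _ _).toLinearMap ∘ₗ
    TensorProduct.map
      (TensorProduct.map
          (M.map (flatten t.left.fst t.s₁ fun _ _ => Or.inl)).hom
          (N.map (flatten t.left.fst t.s₂ fun _ _ => Or.inr)).hom ∘ₗ
        dayProj M N t.leftIn)
      LinearMap.id ∘ₗ
    dayProj (day M N) P t.left

/-- The inclusion of the summand of `(M ⊙ (N ⊙ P))(X)` indexed by `X = s₁ ⨿ s₂ ⨿ s₃`. -/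
noncomputable def inclRight (t : Dec3 X) :
    M.obj (part t.s₁) ⊗[k] (N.obj (part t.s₂) ⊗[k] P.obj (part t.s₃)) →ₗ[k]
      (day M (day N P)).obj X :=
  dayIncl M (day N P) t.right ∘ₗ
    TensorProduct.map LinearMap.id
      (dayIncl N P t.rightIn ∘ₗ
        TensorProduct.map
          (N.map (inv (flatten t.right.snd t.s₂ fun _ _ => Or.inl))).hom
          (P.map (inv (flatten t.right.snd t.s₃ fun _ _ => Or.inr))).hom)

/-- The projection to the summand of `(M ⊙ (N ⊙ P))(X)` indexed by `X = s₁ ⨿ s₂ ⨿ s₃`. -/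
noncomputable def projRight (t : Dec3 X) :
    (day M (day N P)).obj X →ₗ[k]
      M.obj (part t.s₁) ⊗[k] (N.obj (part t.s₂) ⊗[k] P.obj (part t.s₃)) :=
  TensorProduct.map LinearMap.id
      (TensorProduct.map
          (N.map (flatten t.right.snd t.s₂ fun _ _ => Or.inl)).hom
          (P.map (flatten t.right.snd t.s₃ fun _ _ => Or.inr)).hom ∘ₗ
        dayProj N P t.rightIn) ∘ₗ
    dayProj M (day N P) t.right

/-- The associativity isomorphism `((M ⊙ N) ⊙ P)(X) → (M ⊙ (N ⊙ P))(X)`: it matches the summands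
indexed by the same decomposition of `X` into three subsets. -/
noncomputable def assocHom [Finite c] (X : FinFam c) :
    (day (day M N) P).obj X →ₗ[k] (day M (day N P)).obj X :=
  ∑ t : Dec3 X, inclRight M N P t ∘ₗ projLeft M N P t

/-- The associativity isomorphism `(M ⊙ (N ⊙ P))(X) → ((M ⊙ N) ⊙ P)(X)`: it matches the summands
indexed by the same decomposition of `X` into three subsets. -/
noncomputable def assocInv [Finite c] (X : FinFam c) :
    (day M (day N P)).obj X →ₗ[k] (day (day M N) P).obj X :=
  ∑ t : Dec3 X, inclLeft M N P t ∘ₗ projRight M N P t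

/-- The cyclic permutation of the factors of `M ⊙ (M ⊙ M)`. -/
noncomputable def rotate [Finite c] (X : FinFam c) :
    (day M (day M M)).obj X →ₗ[k] (day M (day M M)).obj X :=
  ((braid (day M M) M).app X).hom ∘ₗ assocInv M M M X

/-- The second symmetric power for Day convolution: the coinvariants of the symmetry. -/
noncomputable abbrev symSq : FMod c k := cokernel (𝟙 (day M M) - braid M M)

/-- The second exterior power for Day convolution: the coinvariants of minus the symmetry. -/
noncomputable abbrev extSq : FMod c k := cokernel (𝟙 (day M M) + braid M M)

/-- The projection `M ⊙ M → S²M`. -/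
noncomputable abbrev toSymSq : day M M ⟶ symSq M := cokernel.π (𝟙 (day M M) - braid M M)

/-- The projection `M ⊙ M → Λ²M`. -/
noncomputable abbrev toExtSq : day M M ⟶ extSq M := cokernel.π (𝟙 (day M M) + braid M M)

/-- `HasCard n X`: the `i`-th member of `X` has `n i` elements, for all `i`. -/
def HasCard (n : c → ℕ) (X : FinFam c) : Prop := ∀ i, Nat.card (X.carrier i) = n i

theorem HasCard.of_hom {n : c → ℕ} {X Y : FinFam c} (f : X ⟶ Y) (h : HasCard n Y) :
    HasCard n X := fun i => (Nat.card_congr (f i)).trans (h i)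

variable (k)

/-- The module supported on the families `X` with `|X i| = n i`, with value `k` and trivial action
of the bijections. (A function on the propositions `HasCard n X` is a scalar if the proposition
holds, and there is only one such function otherwise.) -/
def unitMod (n : c → ℕ) : FMod c k where
  obj X := ModuleCat.of k (PLift (HasCard n X) → k)
  map f := ModuleCat.ofHom (LinearMap.funLeft k k fun h => ⟨h.down.of_hom f⟩)
  map_id _ := rfl
  map_comp _ _ := rfl

/-- The canonical generator of `unitMod k n` (which is zero outside of the support). -/
def gen (n : c → ℕ) (X : FinFam c) : (unitMod k n).obj X :=
  (fun _ => 1 : PLift (HasCard n X) → k)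

end Modules

/-! ### Cyclic operads and dioperads -/

section Operads

variable {c : Type} {k : Type u} [Field k] {n : c → ℕ}

theorem dayMap_id_id (M N : FMod c k) : dayMap (𝟙 M) (𝟙 N) = 𝟙 (day M N) := by
  ext X φ
  funext d
  change TensorProduct.map LinearMap.id LinearMap.id (φ d) = φ d
  simp

theorem dayMap_comp_comp {M M' M'' N N' N'' : FMod c k} (a : M ⟶ M') (a' : M' ⟶ M'')
    (b : N ⟶ N') (b' : N' ⟶ N'') :
    dayMap (a ≫ a') (b ≫ b') = dayMap a b ≫ dayMap a' b' := by
  ext X φ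
  funext d
  change TensorProduct.map ((a'.app _).hom ∘ₗ (a.app _).hom) ((b'.app _).hom ∘ₗ (b.app _).hom) (φ d)
    = (TensorProduct.map (a'.app _).hom (b'.app _).hom ∘ₗ
      TensorProduct.map (a.app _).hom (b.app _).hom) (φ d)
  rw [TensorProduct.map_comp]

/-- The component of `M ⊙ N → M' ⊙ N'` from the summand indexed by `d` to that indexed by `e`. -/
noncomputable def component {M N M' N' : FMod c k} (φ : day M N ⟶ day M' N') {X : FinFam c}
    (d e : Dec X) :
    M.obj (part d.fst) ⊗[k] N.obj (part d.snd) →ₗ[k]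
      M'.obj (part e.fst) ⊗[k] N'.obj (part e.snd) :=
  dayProj M' N' e ∘ₗ (φ.app X).hom ∘ₗ dayIncl M N d

/-- `μ : M ⊙ M → M ⊙ unitMod` is diagonal: its component from `X = U ⨿ V` to `X = A ⨿ B` is zero
if the labels in `B` either all belong to `U` or all belong to `V`. -/
def IsDiagonal {M : FMod c k} (μ : day M M ⟶ day M (unitMod k n)) : Prop :=
  ∀ (X : FinFam c) (d e : Dec X),
    (∀ i, e.snd i ⊆ d.fst i) ∨ (∀ i, e.snd i ⊆ d.snd i) → component μ d e = 0

/-- `μ : M ⊙ M → M ⊙ unitMod` is symmetric: it factorizes through `S²M`. -/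
def IsSymmetric {M : FMod c k} (μ : day M M ⟶ day M (unitMod k n)) : Prop :=
  ∃ ν : symSq M ⟶ day M (unitMod k n), toSymSq M ≫ ν = μ

/-- For `K = unitMod k n`, the composite
`M ⊙ (M ⊙ M) → M ⊙ (M ⊙ K) ≅ (M ⊙ M) ⊙ K → (M ⊙ K) ⊙ K ≅ M ⊙ (K ⊙ K) → M ⊙ Λ²K`
of two applications of `μ` and of the projection `K ⊙ K → Λ²K`, evaluated on `X`. -/
noncomputable def twice [Finite c] {M : FMod c k} (μ : day M M ⟶ day M (unitMod k n))
    (X : FinFam c) :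
    (day M (day M M)).obj X →ₗ[k] (day M (extSq (unitMod k n))).obj X :=
  ((dayMap (𝟙 M) (toExtSq (unitMod k n))).app X).hom ∘ₗ
    assocHom M (unitMod k n) (unitMod k n) X ∘ₗ
    ((dayMap μ (𝟙 (unitMod k n))).app X).hom ∘ₗ
    assocInv M M (unitMod k n) X ∘ₗ
    ((dayMap (𝟙 M) μ).app X).hom

/-- Associativity of a symmetric `μ`: the composite `S³M → S²M ⊙ K → M ⊙ K ⊙ K → M ⊙ Λ²K` is zero.
Here `S³M → S²M ⊙ K` is the composite `S³M → M ⊙ S²M → M ⊙ M ⊙ K → S²M ⊙ K` of the coproduct, `μ`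
and the product. The composite is tested on the quotient `M ⊙ (M ⊙ M) → S³M`, on which the coproduct
`x y z ↦ x ⊗ y z + z ⊗ x y + y ⊗ z x` is the sum of the three cyclic permutations. -/
def IsAssociative [Finite c] {M : FMod c k} (μ : day M M ⟶ day M (unitMod k n)) : Prop :=
  ∀ X : FinFam c,
    twice μ X ∘ₗ (LinearMap.id + rotate M X + rotate M X ∘ₗ rotate M X) = 0

/-- The number of elements that belong both to `d.snd` and to `e.snd`. -/
noncomputable def overlap {X : FinFam c} (d e : Dec X) : ℕ :=
  Nat.card (Σ i, ↥(d.snd i ∩ e.snd i))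

/-- `φ : M ⊙ K → M ⊙ K`, for `K = unitMod k n`, is the relabelling map: if the supports `B` and `B'`
of `K` in `X = A ⨿ B` and `X = A' ⨿ B'` have precisely one element in common, then the component of
`φ` from `M(A)` to `M(A')` is induced by the bijection `g : A → A'` that fixes `A ∩ A'`; all the
other components are zero. -/
def IsRelabelling {M : FMod c k} (φ : day M (unitMod k n) ⟶ day M (unitMod k n)) : Prop :=
  ∀ (X : FinFam c) (d e : Dec X),
    (overlap d e = 1 → HasCard n (part d.snd) → HasCard n (part e.snd) →
      ∀ g : part d.fst ⟶ part e.fst,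
        (∀ i (x : (part d.fst).carrier i), x.1 ∈ e.fst i → (g i x).1 = x.1) →
        ∀ m : M.obj (part d.fst),
          component φ d e (m ⊗ₜ gen k n _) = (M.map g).hom m ⊗ₜ gen k n _) ∧
    (overlap d e ≠ 1 → component φ d e = 0)

variable (k) (n)

/-- A module `M` with a map `M ⊙ M → M ⊙ unitMod`, without axioms. -/
structure Grafting where
  mod : FMod c k
  mu : day mod mod ⟶ day mod (unitMod k n)

/-- A module `M` with maps `M ⊙ M → M ⊙ unitMod` and `unitMod → M`, without axioms. -/
structure UnitalGrafting extends Grafting k n where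
  eta : unitMod k n ⟶ mod

/-- The common definition of cyclic operads without unit (`c` has one element and `unitMod` is
supported on sets with two elements) and of dioperads without unit (`c` has two elements and
`unitMod` is supported on pairs of sets with one element each). -/
structure OperadNU [Finite c] extends Grafting k n where
  zero : ∀ X : FinFam c, (∀ i, IsEmpty (X.carrier i)) → Subsingleton (mod.obj X)
  diagonal : IsDiagonal mu
  symmetric : IsSymmetric mu
  associative : IsAssociative mu

/-- The common definition of cyclic operads with unit and of dioperads with unit: inserting the unit
relabels. -/
structure OperadU [Finite c] extends OperadNU k n where
  eta : unitMod k n ⟶ mod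
  right_unit : IsRelabelling (dayMap (𝟙 mod) eta ≫ mu)
  left_unit : IsRelabelling (braid mod (unitMod k n) ≫ dayMap eta (𝟙 mod) ≫ mu)

variable {k} {n} [Finite c]

/-- Forgetting the axioms. -/
def OperadU.toUnitalGrafting (C : OperadU k n) : UnitalGrafting k n where
  toGrafting := C.toGrafting
  eta := C.eta

/-- Morphisms are morphisms of modules that are compatible with the structure maps. -/
@[ext]
structure OperadNU.Hom (C D : OperadNU k n) where
  hom : C.mod ⟶ D.mod
  mu_comp : C.mu ≫ dayMap hom (𝟙 _) = dayMap hom hom ≫ D.mu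

/-- Morphisms are morphisms of modules that are compatible with the structure maps. -/
@[ext]
structure OperadU.Hom (C D : OperadU k n) extends OperadNU.Hom C.toOperadNU D.toOperadNU where
  eta_comp : C.eta ≫ hom = D.eta

instance OperadNU.category : Category (OperadNU (c := c) k n) where
  Hom := OperadNU.Hom
  id C := ⟨𝟙 _, by simp [dayMap_id_id]⟩
  comp {A B C} f g := ⟨f.hom ≫ g.hom, by
    rw [dayMap_comp_comp, Category.assoc, ← g.mu_comp, ← Category.assoc, ← f.mu_comp,
      Category.assoc, ← dayMap_comp_comp, Category.comp_id]⟩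
  id_comp f := OperadNU.Hom.ext (Category.id_comp _)
  comp_id f := OperadNU.Hom.ext (Category.comp_id _)
  assoc f g h := OperadNU.Hom.ext (Category.assoc _ _ _)

instance OperadU.category : Category (OperadU (c := c) k n) where
  Hom := OperadU.Hom
  id C := ⟨𝟙 C.toOperadNU, Category.comp_id _⟩
  comp {A B C} f g :=
    { toHom := (f.toHom ≫ g.toHom : A.toOperadNU ⟶ C.toOperadNU)
      eta_comp := by
        change A.eta ≫ f.hom ≫ g.hom = C.eta
        rw [← Category.assoc, f.eta_comp, g.eta_comp] }
  id_comp f := OperadU.Hom.ext (Category.id_comp f.hom)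
  comp_id f := OperadU.Hom.ext (Category.comp_id f.hom)
  assoc f g h := OperadU.Hom.ext (Category.assoc f.hom g.hom h.hom)

/-- The underlying module of an operad without unit. -/
def OperadNU.forget : OperadNU (c := c) k n ⥤ FMod c k where
  obj C := C.mod
  map f := OperadNU.Hom.hom f

/-- Forgetting the unit. -/
def OperadU.forgetUnit : OperadU (c := c) k n ⥤ OperadNU (c := c) k n where
  obj C := C.toOperadNU
  map f := OperadU.Hom.toHom f

end Operads

/-- Two elements for the only set of a family indexed by a point. -/
abbrev two : Unit → ℕ := fun _ => 2

/-- One input and one output. -/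
abbrev oneOne : Side → ℕ := fun _ => 1

/-- Cyclic operads with unit. -/
abbrev CyclOpd (k : Type u) [Field k] := OperadU k two

/-- Cyclic operads without unit. -/
abbrev CyclOpdNU (k : Type u) [Field k] := OperadNU k two

/-- Dioperads with unit. -/
abbrev DiOpd (k : Type u) [Field k] := OperadU k oneOne

/-- Dioperads without unit. -/
abbrev DiOpdNU (k : Type u) [Field k] := OperadNU k oneOne

/-! ### Restriction along the disjoint union -/

section Restriction

variable {k : Type u} [Field k]

/-- The disjoint union functor `FB × FB ⥤ FB`. -/
def amalg : FB2 ⥤ FB where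
  obj X := { carrier := fun _ => Σ s, X.carrier s }
  map f := fun _ => Equiv.sigmaCongrRight f
  map_id _ := by
    funext _
    exact Equiv.ext fun ⟨_, _⟩ => rfl
  map_comp _ _ := by
    funext _
    exact Equiv.ext fun ⟨_, _⟩ => rfl

/-- Restriction along the disjoint union: `(amalgStar C)(X, Y) = C(X ⨿ Y)`. -/
def amalgStar : FMod Unit k ⥤ FMod Side k := (Functor.whiskeringLeft _ _ (ModuleCat k)).obj amalg

theorem amalgStar_obj_obj (C : FMod Unit k) (X : FB2) :
    (amalgStar.obj C).obj X = C.obj (amalg.obj X) := rfl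

/-- The decomposition of `X ⨿ Y` induced by a pair of decompositions. -/
abbrev Dec.sum {X : FB2} (d : Dec X) : Dec (amalg.obj X) where
  fst _ := {p | p.2 ∈ d.fst p.1}
  snd _ := {p | p.2 ∈ d.snd p.1}
  compl _ p := d.compl p.1 p.2

/-- The pair of decompositions induced by a decomposition of `X ⨿ Y`. -/
abbrev Dec.split {X : FB2} (d : Dec (amalg.obj X)) : Dec X where
  fst s := {x | (⟨s, x⟩ : Σ s, X.carrier s) ∈ d.fst ()}
  snd s := {x | (⟨s, x⟩ : Σ s, X.carrier s) ∈ d.snd ()}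
  compl s x := d.compl () ⟨s, x⟩

/-- For subsets `S` of `(X, Y)` and `T` of `X ⨿ Y` that correspond to each other, the bijection from
the disjoint union of the members of `S` to `T`. -/
def sumPart {X : FB2} (S : Sub X) (T : Sub (amalg.obj X))
    (h : ∀ s x, x ∈ S s ↔ (⟨s, x⟩ : Σ s, X.carrier s) ∈ T ()) :
    amalg.obj (part S) ⟶ part T :=
  fun _ =>
    { toFun := fun p => ⟨⟨p.1, p.2.1⟩, (h _ _).1 p.2.2⟩
      invFun := fun p => ⟨p.1.1, ⟨p.1.2, (h _ _).2 p.2⟩⟩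
      left_inv := fun _ => rfl
      right_inv := fun _ => rfl }

/-- The monoidal structure map `amalgStar M ⊚ amalgStar N → amalgStar (M ⊙ N)`. -/
noncomputable def starLax (M N : FMod Unit k) :
    day (amalgStar.obj M) (amalgStar.obj N) ⟶ amalgStar.obj (day M N) where
  app X := ModuleCat.ofHom (dayLift M N fun d : Dec (amalg.obj X) =>
    TensorProduct.map (M.map (sumPart d.split.fst d.fst fun _ _ => Iff.rfl)).hom
      (N.map (sumPart d.split.snd d.snd fun _ _ => Iff.rfl)).hom ∘ₗ
    dayProj (amalgStar.obj M) (amalgStar.obj N) d.split)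
  naturality {X Y} f := by
    refine ModuleCat.hom_ext (day_hom_ext fun d => ?_)
    let d' := d.pull (amalg.map f)
    change (TensorProduct.map (M.map (sumPart d.split.fst d.fst _)).hom
        (N.map (sumPart d.split.snd d.snd _)).hom ∘ₗ
      TensorProduct.map (M.map (amalg.map (restr f (d.split.pull f).fst d.split.fst _))).hom
        (N.map (amalg.map (restr f (d.split.pull f).snd d.split.snd _))).hom) ∘ₗ
          dayProj (amalgStar.obj M) (amalgStar.obj N) (d.split.pull f) =
      (TensorProduct.map (M.map (restr (amalg.map f) d'.fst d.fst _)).hom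
          (N.map (restr (amalg.map f) d'.snd d.snd _)).hom ∘ₗ
        TensorProduct.map (M.map (sumPart d'.split.fst d'.fst _)).hom
          (N.map (sumPart d'.split.snd d'.snd _)).hom) ∘ₗ
          dayProj (amalgStar.obj M) (amalgStar.obj N) d'.split
    simp only [← TensorProduct.map_comp, ← ModuleCat.hom_comp, ← Functor.map_comp]
    rfl

/-- The inverse `amalgStar (M ⊙ N) → amalgStar M ⊚ amalgStar N` of the monoidal structure map. -/
noncomputable def starOplax (M N : FMod Unit k) :
    amalgStar.obj (day M N) ⟶ day (amalgStar.obj M) (amalgStar.obj N) where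
  app X := ModuleCat.ofHom (dayLift (amalgStar.obj M) (amalgStar.obj N) fun d : Dec X =>
    TensorProduct.map (M.map (inv (sumPart d.fst d.sum.fst fun _ _ => Iff.rfl))).hom
      (N.map (inv (sumPart d.snd d.sum.snd fun _ _ => Iff.rfl))).hom ∘ₗ dayProj M N d.sum)
  naturality {X Y} f := by
    refine ModuleCat.hom_ext (day_hom_ext fun d => ?_)
    let d' := d.pull f
    change (TensorProduct.map (M.map (inv (sumPart d.fst d.sum.fst _))).hom
        (N.map (inv (sumPart d.snd d.sum.snd _))).hom ∘ₗ
      TensorProduct.map (M.map (restr (amalg.map f) (d.sum.pull (amalg.map f)).fst d.sum.fst _)).hom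
        (N.map (restr (amalg.map f) (d.sum.pull (amalg.map f)).snd d.sum.snd _)).hom) ∘ₗ
          dayProj M N (d.sum.pull (amalg.map f)) =
      (TensorProduct.map (M.map (amalg.map (restr f d'.fst d.fst _))).hom
          (N.map (amalg.map (restr f d'.snd d.snd _))).hom ∘ₗ
        TensorProduct.map (M.map (inv (sumPart d'.fst d'.sum.fst _))).hom
          (N.map (inv (sumPart d'.snd d'.sum.snd _))).hom) ∘ₗ dayProj M N d'.sum
    simp only [← TensorProduct.map_comp, ← ModuleCat.hom_comp, ← Functor.map_comp]
    rfl

theorem hasCard_two_amalg {X : FB2} (h : HasCard oneOne X) : HasCard two (amalg.obj X) := by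
  intro _
  let e : (Σ s, X.carrier s) ≃ X.carrier .input ⊕ X.carrier .output :=
    { toFun := fun p => match p with
        | ⟨.input, x⟩ => .inl x
        | ⟨.output, x⟩ => .inr x
      invFun := Sum.elim (fun x => ⟨.input, x⟩) fun x => ⟨.output, x⟩
      left_inv := by rintro ⟨⟨⟩, x⟩ <;> rfl
      right_inv := by rintro (x | x) <;> rfl }
  change Nat.card (Σ s, X.carrier s) = 2
  rw [Nat.card_congr e, Nat.card_sum, h .input, h .output]
  exact one_add_one_eq_two

variable (k)

/-- The projection `amalgStar k_2 → k_(1,1)`: the identity of `k` on the support of `k_(1,1)`. -/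
def starProj : amalgStar.obj (unitMod k two) ⟶ unitMod k oneOne where
  app _ := ModuleCat.ofHom (LinearMap.funLeft k k fun h => ⟨hasCard_two_amalg h.down⟩)
  naturality _ _ _ := rfl

/-- Evaluation of an element of `k_(1,1)` on the support. -/
def evalAt {X : FB2} (h : HasCard oneOne X) : (unitMod k oneOne).obj X →ₗ[k] k :=
  LinearMap.proj (φ := fun _ : PLift (HasCard oneOne X) => k) ⟨h⟩

open Classical in
/-- The scalar of an element of `k_(1,1)`: evaluation on the support, and zero elsewhere. -/
noncomputable def scalar (X : FB2) : (unitMod k oneOne).obj X →ₗ[k] k :=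
  if h : HasCard oneOne X then evalAt k h else 0

theorem scalar_comp_map {X Y : FB2} (f : X ⟶ Y) :
    scalar k Y ∘ₗ ((unitMod k oneOne).map f).hom = scalar k X := by
  by_cases h : HasCard oneOne X
  · rw [scalar, scalar, dif_pos h, dif_pos (h.of_hom (inv f))]
    rfl
  · rw [scalar, scalar, dif_neg h, dif_neg fun h' => h (h'.of_hom f), LinearMap.zero_comp]

/-- The inclusion `k_(1,1) → amalgStar k_2`: the identity of `k` on the support of `k_(1,1)`. -/
noncomputable def starIncl : unitMod k oneOne ⟶ amalgStar.obj (unitMod k two) where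
  app X := ModuleCat.ofHom (LinearMap.pi fun _ => scalar k X)
  naturality X Y f := by
    refine ModuleCat.hom_ext (LinearMap.ext fun φ => funext fun _ => ?_)
    exact LinearMap.congr_fun (scalar_comp_map k f) φ

variable {k}

/-- The structure maps of `amalgStar C`: apply `amalgStar` to those of `C`, and use
`amalgStar k_2 → k_(1,1)`. -/
noncomputable def starGrafting (C : Grafting k two) : Grafting k oneOne where
  mod := amalgStar.obj C.mod
  mu := starLax C.mod C.mod ≫ amalgStar.map C.mu ≫ starOplax C.mod (unitMod k two) ≫
    dayMap (𝟙 _) (starProj k)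

/-- The structure maps of `amalgStar C`, including the unit, for which `k_(1,1) → amalgStar k_2` is
used. -/
noncomputable def starUnitalGrafting (C : UnitalGrafting k two) : UnitalGrafting k oneOne where
  toGrafting := starGrafting C.toGrafting
  eta := starIncl k ≫ amalgStar.map C.eta

end Restriction

/-! ### Induction along the disjoint union -/

section Induction

variable {k : Type u} [Field k]

/-- For an ordered decomposition `X = X₁ ⨿ X₂`, the set `X₁` of inputs and the set `X₂` of outputs,
as subsets of `X`. -/
abbrev Dec.side {X : FB} (e : Dec X) (s : Side) : Set (X.carrier ()) :=
  {x | match s with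
    | .input => x ∈ e.fst ()
    | .output => x ∈ e.snd ()}

/-- The object `(X₁, X₂)` of `FB × FB` for an ordered decomposition `X = X₁ ⨿ X₂`. -/
abbrev pair {X : FB} (e : Dec X) : FB2 where
  carrier s := e.side s

/-- The restriction of `f : X ⟶ Y` to a morphism of pairs. -/
def pairRestr {X Y : FB} (f : X ⟶ Y) (e : Dec Y) : pair (e.pull f) ⟶ pair e :=
  fun s => (f ()).subtypeEquiv fun _ => Iff.rfl

/-- `(amalgPush D)(X) = ⨁_{X = X₁ ⨿ X₂} D(X₁, X₂)`, on objects. The direct sum over the finite set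
of ordered decompositions is realised as a product. -/
noncomputable def pushObj (D : FMod Side k) : FMod Unit k where
  obj X := ModuleCat.of k (∀ e : Dec X, D.obj (pair e))
  map {X Y} f := ModuleCat.ofHom (LinearMap.pi fun e : Dec Y =>
    (D.map (pairRestr f e)).hom ∘ₗ LinearMap.proj (e.pull f))
  map_id X := by
    refine ModuleCat.hom_ext (LinearMap.ext fun φ => funext fun e => ?_)
    change (D.map (𝟙 (pair e))).hom (φ e) = φ e
    simp
  map_comp {X Y Z} f g := by
    refine ModuleCat.hom_ext (LinearMap.ext fun φ => funext fun e => ?_)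
    change (D.map (pairRestr f (e.pull g) ≫ pairRestr g e)).hom (φ (e.pull (f ≫ g))) = _
    rw [D.map_comp]
    rfl

/-- The projection of `(pushObj D)(X)` to the summand indexed by `e`. -/
noncomputable def sideProj (D : FMod Side k) {X : FB} (e : Dec X) :
    (pushObj D).obj X →ₗ[k] D.obj (pair e) :=
  LinearMap.proj (φ := fun e : Dec X => D.obj (pair e)) e

/-- The inclusion in `(pushObj D)(X)` of the summand indexed by `e`. -/
noncomputable def sideIncl (D : FMod Side k) {X : FB} (e : Dec X) :
    D.obj (pair e) →ₗ[k] (pushObj D).obj X :=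
  LinearMap.single k (fun e : Dec X => D.obj (pair e)) e

/-- The linear map to `(pushObj D)(X)` with given components. -/
noncomputable def sideLift (D : FMod Side k) {X : FB} {V : Type u} [AddCommGroup V] [Module k V]
    (a : ∀ e : Dec X, V →ₗ[k] D.obj (pair e)) : V →ₗ[k] (pushObj D).obj X :=
  LinearMap.pi a

theorem side_hom_ext {D : FMod Side k} {X : FB} {V : Type u} [AddCommGroup V] [Module k V]
    {a b : V →ₗ[k] (pushObj D).obj X} (h : ∀ e, sideProj D e ∘ₗ a = sideProj D e ∘ₗ b) : a = b :=
  LinearMap.ext fun v => funext fun d => LinearMap.congr_fun (h d) v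

theorem sideProj_comp_map (D : FMod Side k) {X Y : FB} (f : X ⟶ Y) (e : Dec Y) :
    sideProj D e ∘ₗ ((pushObj D).map f).hom =
      (D.map (pairRestr f e)).hom ∘ₗ sideProj D (e.pull f) := rfl

/-- `(amalgPush D)(X) = ⨁_{X = X₁ ⨿ X₂} D(X₁, X₂)`. -/
noncomputable def amalgPush : FMod Side k ⥤ FMod Unit k where
  obj D := pushObj D
  map {D D'} a :=
    { app := fun X => ModuleCat.ofHom (sideLift D' fun e : Dec X =>
        (a.app (pair e)).hom ∘ₗ sideProj D e)
      naturality := fun {X Y} f => by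
        refine ModuleCat.hom_ext (side_hom_ext fun e => ?_)
        exact congrArg (· ∘ₗ sideProj D (e.pull f))
          (congrArg ModuleCat.Hom.hom (a.naturality (pairRestr f e))) }
  map_id _ := rfl
  map_comp _ _ := rfl

theorem amalgPush_obj_obj (D : FMod Side k) (X : FB) :
    (amalgPush.obj D).obj X = ModuleCat.of k (∀ e : Dec X, D.obj (pair e)) := rfl

theorem sum_comp_linear {ι : Type} [Fintype ι] {U V W : Type u} [AddCommGroup U] [Module k U]
    [AddCommGroup V] [Module k V] [AddCommGroup W] [Module k W] (a : ι → V →ₗ[k] W)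
    (b : U →ₗ[k] V) : (∑ i, a i) ∘ₗ b = ∑ i, a i ∘ₗ b := by
  ext x
  simp

theorem comp_sum_linear {ι : Type} [Fintype ι] {U V W : Type u} [AddCommGroup U] [Module k U]
    [AddCommGroup V] [Module k V] [AddCommGroup W] [Module k W] (a : ι → U →ₗ[k] V)
    (b : V →ₗ[k] W) : b ∘ₗ (∑ i, a i) = ∑ i, b ∘ₗ a i := by
  ext x
  simp

/-- Ordered decompositions can be transported along a bijection. -/
def Dec.pullEquiv {X Y : FB} (f : X ⟶ Y) : Dec Y ≃ Dec X where
  toFun := Dec.pull f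
  invFun := Dec.pull (inv f)
  left_inv e := by
    refine Dec.ext ?_ ?_ <;> funext _ <;> ext x
    · exact iff_of_eq (congrArg (· ∈ e.fst ()) ((f ()).apply_symm_apply x))
    · exact iff_of_eq (congrArg (· ∈ e.snd ()) ((f ()).apply_symm_apply x))
  right_inv e := by
    refine Dec.ext ?_ ?_ <;> funext _ <;> ext x
    · exact iff_of_eq (congrArg (· ∈ e.fst ()) ((f ()).symm_apply_apply x))
    · exact iff_of_eq (congrArg (· ∈ e.snd ()) ((f ()).symm_apply_apply x))

theorem map_comp_sideIncl (D : FMod Side k) {X Y : FB} (f : X ⟶ Y) (e : Dec Y) :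
    ((pushObj D).map f).hom ∘ₗ sideIncl D (e.pull f) =
      sideIncl D e ∘ₗ (D.map (pairRestr f e)).hom := by
  refine LinearMap.ext fun v => funext fun e₀ => ?_
  change (D.map (pairRestr f e₀)).hom
    (Pi.single (M := fun e : Dec X => D.obj (pair e)) (e.pull f) v (e₀.pull f)) =
    Pi.single (M := fun e : Dec Y => D.obj (pair e)) e ((D.map (pairRestr f e)).hom v) e₀
  by_cases h : e₀ = e
  · subst h
    rw [Pi.single_eq_same, Pi.single_eq_same]
  · have h' : e₀.pull f ≠ e.pull f := fun h' => h ((Dec.pullEquiv f).injective h')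
    rw [Pi.single_eq_of_ne h, Pi.single_eq_of_ne h', map_zero]

/-- The decomposition of the pair `(X₁, X₂)` induced by a decomposition of `X`. -/
abbrev Dec.cross {X : FB} (d e : Dec X) : Dec (pair e) where
  fst _ := {x | x.1 ∈ d.fst ()}
  snd _ := {x | x.1 ∈ d.snd ()}
  compl _ x := d.compl () x.1

theorem Dec.side_unique {X : FB} (e : Dec X) {x : X.carrier ()} {s s' : Side} (h : x ∈ e.side s)
    (h' : x ∈ e.side s') : s = s' := by
  have := e.compl () x
  cases s <;> cases s' <;> simp only [Dec.side, Set.mem_ofPred_eq] at h h' <;> tauto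

theorem Dec.exists_side {X : FB} (e : Dec X) (x : X.carrier ()) : ∃ s, x ∈ e.side s := by
  by_cases h : x ∈ e.fst ()
  · exact ⟨.input, h⟩
  · exact ⟨.output, (e.compl () x).2 h⟩

/-- The decomposition of `X` that restricts to a given decomposition of `(X₁, X₂)`. -/
abbrev Dec.join {X : FB} (e : Dec X) (d : Dec (pair e)) : Dec X where
  fst _ := {x | ∃ s, ∃ h : x ∈ e.side s, (⟨x, h⟩ : e.side s) ∈ d.fst s}
  snd _ := {x | ∃ s, ∃ h : x ∈ e.side s, (⟨x, h⟩ : e.side s) ∈ d.snd s}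
  compl _ x := by
    constructor
    · rintro ⟨s, h, hs⟩ ⟨s', h', hs'⟩
      obtain rfl := e.side_unique h h'
      exact (d.compl s _).1 hs hs'
    · intro hx
      obtain ⟨s, h⟩ := e.exists_side x
      exact ⟨s, h, (d.compl s _).2 fun hs => hx ⟨s, h, hs⟩⟩

theorem Dec.mem_join_fst {X : FB} (e : Dec X) (d : Dec (pair e)) (s : Side) (x : e.side s) :
    x ∈ d.fst s ↔ x.1 ∈ (e.join d).fst () := by
  constructor
  · exact fun h => ⟨s, x.2, h⟩
  · rintro ⟨s', h, hs⟩
    obtain rfl := e.side_unique x.2 h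
    exact hs

theorem Dec.mem_join_snd {X : FB} (e : Dec X) (d : Dec (pair e)) (s : Side) (x : e.side s) :
    x ∈ d.snd s ↔ x.1 ∈ (e.join d).snd () := by
  exact (d.compl s x).trans
    ((not_congr (e.mem_join_fst d s x)).trans ((e.join d).compl () x.1).symm)

theorem Dec.mem_inside_side {X : FB} (e : Dec X) (S : Sub X) (s : Side)
    (x : (part S).carrier ()) : x ∈ (e.inside S).side s ↔ x.1 ∈ e.side s :=
  Iff.rfl

/-- For a decomposition `X = X₁ ⨿ X₂` and a subset `S` of `X`, the bijection between the pair
`(S ∩ X₁, S ∩ X₂)` of subsets of `S` and the same pair, seen as a subset `T` of `(X₁, X₂)`. -/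
def crossPart {X : FB} (e : Dec X) (S : Sub X) (T : Sub (pair e))
    (h : ∀ s (x : e.side s), x ∈ T s ↔ x.1 ∈ S ()) : pair (e.inside S) ⟶ part T :=
  fun s =>
    { toFun := fun y => ⟨⟨y.1.1, (e.mem_inside_side S s y.1).1 y.2⟩, (h s _).2 y.1.2⟩
      invFun := fun x => ⟨⟨x.1.1, (h s x.1).1 x.2⟩, (e.mem_inside_side S s _).2 x.1.2⟩
      left_inv := fun _ => rfl
      right_inv := fun _ => rfl }

theorem hom_square {c : Type} (F : FMod c k) {A B B' C : FinFam c} (a : A ⟶ B) (b : B ⟶ C)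
    (a' : A ⟶ B') (b' : B' ⟶ C) (h : a ≫ b = a' ≫ b') :
    (F.map b).hom ∘ₗ (F.map a).hom = (F.map b').hom ∘ₗ (F.map a').hom := by
  rw [← ModuleCat.hom_comp, ← ModuleCat.hom_comp, ← F.map_comp, ← F.map_comp, h]

/-- The monoidal structure map `amalgPush F ⊙ amalgPush G → amalgPush (F ⊚ G)`. -/
noncomputable def pushLax (F G : FMod Side k) :
    day (amalgPush.obj F) (amalgPush.obj G) ⟶ amalgPush.obj (day F G) where
  app X := ModuleCat.ofHom (sideLift (day F G) fun e : Dec X =>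
    dayLift F G fun d : Dec (pair e) =>
      TensorProduct.map
        ((F.map (crossPart e (e.join d).fst d.fst (e.mem_join_fst d))).hom ∘ₗ
          sideProj F (e.inside (e.join d).fst))
        ((G.map (crossPart e (e.join d).snd d.snd (e.mem_join_snd d))).hom ∘ₗ
          sideProj G (e.inside (e.join d).snd)) ∘ₗ
      dayProj (amalgPush.obj F) (amalgPush.obj G) (e.join d))
  naturality {X Y} f := by
    refine ModuleCat.hom_ext (side_hom_ext fun e => day_hom_ext fun d => ?_)
    let e' := e.pull f
    let d' := d.pull (pairRestr f e)
    let r := restr f (e'.join d').fst (e.join d).fst fun _ _ => Iff.rfl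
    let r' := restr f (e'.join d').snd (e.join d).snd fun _ _ => Iff.rfl
    have h₁ : (F.map (crossPart e (e.join d).fst d.fst (e.mem_join_fst d))).hom ∘ₗ
        (F.map (pairRestr r (e.inside (e.join d).fst))).hom =
      (F.map (restr (pairRestr f e) d'.fst d.fst fun _ _ => Iff.rfl)).hom ∘ₗ
        (F.map (crossPart e' (e'.join d').fst d'.fst (e'.mem_join_fst d'))).hom :=
      hom_square F _ _ _ _ rfl
    have h₂ : (G.map (crossPart e (e.join d).snd d.snd (e.mem_join_snd d))).hom ∘ₗ
        (G.map (pairRestr r' (e.inside (e.join d).snd))).hom =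
      (G.map (restr (pairRestr f e) d'.snd d.snd fun _ _ => Iff.rfl)).hom ∘ₗ
        (G.map (crossPart e' (e'.join d').snd d'.snd (e'.mem_join_snd d'))).hom :=
      hom_square G _ _ _ _ rfl
    change (TensorProduct.map
        ((F.map (crossPart e (e.join d).fst d.fst (e.mem_join_fst d))).hom ∘ₗ
          sideProj F (e.inside (e.join d).fst))
        ((G.map (crossPart e (e.join d).snd d.snd (e.mem_join_snd d))).hom ∘ₗ
          sideProj G (e.inside (e.join d).snd)) ∘ₗ
        TensorProduct.map ((pushObj F).map r).hom ((pushObj G).map r').hom) ∘ₗ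
          dayProj (amalgPush.obj F) (amalgPush.obj G) (e'.join d') =
      (TensorProduct.map
        (F.map (restr (pairRestr f e) d'.fst d.fst fun _ _ => Iff.rfl)).hom
        (G.map (restr (pairRestr f e) d'.snd d.snd fun _ _ => Iff.rfl)).hom ∘ₗ
        TensorProduct.map
          ((F.map (crossPart e' (e'.join d').fst d'.fst (e'.mem_join_fst d'))).hom ∘ₗ
            sideProj F (e'.inside (e'.join d').fst))
          ((G.map (crossPart e' (e'.join d').snd d'.snd (e'.mem_join_snd d'))).hom ∘ₗ
            sideProj G (e'.inside (e'.join d').snd))) ∘ₗ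
          dayProj (amalgPush.obj F) (amalgPush.obj G) (e'.join d')
    rw [← TensorProduct.map_comp, ← TensorProduct.map_comp, LinearMap.comp_assoc,
      LinearMap.comp_assoc, sideProj_comp_map, sideProj_comp_map, ← LinearMap.comp_assoc,
      ← LinearMap.comp_assoc, h₁, h₂]
    rfl

/-- The inverse `amalgPush (F ⊚ G) → amalgPush F ⊙ amalgPush G` of the monoidal structure map. -/
noncomputable def pushOplax (F G : FMod Side k) :
    amalgPush.obj (day F G) ⟶ day (amalgPush.obj F) (amalgPush.obj G) where
  app X := ModuleCat.ofHom (dayLift (amalgPush.obj F) (amalgPush.obj G) fun d : Dec X =>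
    ∑ e : Dec X,
      TensorProduct.map
        (sideIncl F (e.inside d.fst) ∘ₗ
          (F.map (inv (crossPart e d.fst (d.cross e).fst fun _ _ => Iff.rfl))).hom)
        (sideIncl G (e.inside d.snd) ∘ₗ
          (G.map (inv (crossPart e d.snd (d.cross e).snd fun _ _ => Iff.rfl))).hom) ∘ₗ
      dayProj F G (d.cross e) ∘ₗ sideProj (day F G) e)
  naturality {X Y} f := by
    refine ModuleCat.hom_ext (day_hom_ext fun d => ?_)
    let d' := d.pull f
    let r := restr f d'.fst d.fst fun _ _ => Iff.rfl
    let r' := restr f d'.snd d.snd fun _ _ => Iff.rfl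
    let T := fun (Z : FB) (d e : Dec Z) => TensorProduct.map
        (sideIncl F (e.inside d.fst) ∘ₗ
          (F.map (inv (crossPart e d.fst (d.cross e).fst fun _ _ => Iff.rfl))).hom)
        (sideIncl G (e.inside d.snd) ∘ₗ
          (G.map (inv (crossPart e d.snd (d.cross e).snd fun _ _ => Iff.rfl))).hom) ∘ₗ
      dayProj F G (d.cross e) ∘ₗ sideProj (day F G) e
    change (∑ e : Dec Y, T Y d e) ∘ₗ ((pushObj (day F G)).map f).hom =
      TensorProduct.map ((pushObj F).map r).hom ((pushObj G).map r').hom ∘ₗ ∑ e : Dec X, T X d' e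
    rw [sum_comp_linear, comp_sum_linear, ← (Dec.pullEquiv f).sum_comp]
    refine Finset.sum_congr rfl fun e _ => ?_
    let e' := e.pull f
    have h₁ : (F.map (inv (crossPart e d.fst (d.cross e).fst fun _ _ => Iff.rfl))).hom ∘ₗ
        (F.map (restr (pairRestr f e) (d'.cross e').fst (d.cross e).fst fun _ _ => Iff.rfl)).hom =
      (F.map (pairRestr r (e.inside d.fst))).hom ∘ₗ
        (F.map (inv (crossPart e' d'.fst (d'.cross e').fst fun _ _ => Iff.rfl))).hom :=
      hom_square F _ _ _ _ rfl
    have h₂ : (G.map (inv (crossPart e d.snd (d.cross e).snd fun _ _ => Iff.rfl))).hom ∘ₗ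
        (G.map (restr (pairRestr f e) (d'.cross e').snd (d.cross e).snd fun _ _ => Iff.rfl)).hom =
      (G.map (pairRestr r' (e.inside d.snd))).hom ∘ₗ
        (G.map (inv (crossPart e' d'.snd (d'.cross e').snd fun _ _ => Iff.rfl))).hom :=
      hom_square G _ _ _ _ rfl
    change (TensorProduct.map
        (sideIncl F (e.inside d.fst) ∘ₗ
          (F.map (inv (crossPart e d.fst (d.cross e).fst fun _ _ => Iff.rfl))).hom)
        (sideIncl G (e.inside d.snd) ∘ₗ
          (G.map (inv (crossPart e d.snd (d.cross e).snd fun _ _ => Iff.rfl))).hom) ∘ₗ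
        TensorProduct.map
          (F.map (restr (pairRestr f e) (d'.cross e').fst (d.cross e).fst fun _ _ => Iff.rfl)).hom
          (G.map (restr (pairRestr f e) (d'.cross e').snd (d.cross e).snd
            fun _ _ => Iff.rfl)).hom) ∘ₗ
          dayProj F G (d'.cross e') ∘ₗ sideProj (day F G) e' =
      (TensorProduct.map ((pushObj F).map r).hom ((pushObj G).map r').hom ∘ₗ
        TensorProduct.map
          (sideIncl F ((e.inside d.fst).pull r) ∘ₗ
            (F.map (inv (crossPart e' d'.fst (d'.cross e').fst fun _ _ => Iff.rfl))).hom)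
          (sideIncl G ((e.inside d.snd).pull r') ∘ₗ
            (G.map (inv (crossPart e' d'.snd (d'.cross e').snd fun _ _ => Iff.rfl))).hom)) ∘ₗ
          dayProj F G (d'.cross e') ∘ₗ sideProj (day F G) e'
    rw [← TensorProduct.map_comp, ← TensorProduct.map_comp]
    exact congrArg₂ (fun u v => TensorProduct.map u v ∘ₗ dayProj F G (d'.cross e') ∘ₗ
        sideProj (day F G) e')
      ((congrArg (sideIncl F (e.inside d.fst) ∘ₗ ·) h₁).trans
        (congrArg (· ∘ₗ _) (map_comp_sideIncl F r (e.inside d.fst)).symm))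
      ((congrArg (sideIncl G (e.inside d.snd) ∘ₗ ·) h₂).trans
        (congrArg (· ∘ₗ _) (map_comp_sideIncl G r' (e.inside d.snd)).symm))

theorem hasCard_two {X : FB} (e : Dec X) (h : HasCard oneOne (pair e)) : HasCard two X := by
  intro _
  have h₁ : (e.fst ()).ncard = 1 := h .input
  have h₂ : (e.snd ()).ncard = 1 := h .output
  have h₃ : e.snd () = (e.fst ())ᶜ := Set.ext fun x => e.compl () x
  have := Set.ncard_add_ncard_compl (e.fst ())
  rw [← h₃, h₁, h₂] at this
  exact this.symm

variable (k)

/-- The projection `amalgPush k_(1,1) → k_2`: on the support of `k_2`, the sum over the two ordered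
decompositions into two sets with one element. -/
noncomputable def pushProj : amalgPush.obj (unitMod k oneOne) ⟶ unitMod k two where
  app X := ModuleCat.ofHom (LinearMap.pi fun _ =>
    ∑ e : Dec X, scalar k (pair e) ∘ₗ sideProj (unitMod k oneOne) e)
  naturality X Y f := by
    have key : (∑ e : Dec Y, scalar k (pair e) ∘ₗ sideProj (unitMod k oneOne) e) ∘ₗ
        ((pushObj (unitMod k oneOne)).map f).hom =
      ∑ e : Dec X, scalar k (pair e) ∘ₗ sideProj (unitMod k oneOne) e := by
      rw [sum_comp_linear, ← (Dec.pullEquiv f).sum_comp]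
      refine Finset.sum_congr rfl fun e _ => ?_
      rw [LinearMap.comp_assoc, sideProj_comp_map, ← LinearMap.comp_assoc, scalar_comp_map]
      rfl
    exact ModuleCat.hom_ext (LinearMap.ext fun φ => funext fun _ => LinearMap.congr_fun key φ)

/-- The inclusion `k_2 → amalgPush k_(1,1)`: on the support of `k_2`, the diagonal inclusion, that
is, `1` is sent to the sum of the generators of the two summands. -/
noncomputable def pushIncl : unitMod k two ⟶ amalgPush.obj (unitMod k oneOne) where
  app X := ModuleCat.ofHom (sideLift (unitMod k oneOne) fun e : Dec X =>
    LinearMap.funLeft k k fun h => ⟨hasCard_two e h.down⟩)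
  naturality _ _ _ := rfl

variable {k}

/-- The structure maps of `amalgPush D`: apply `amalgPush` to those of `D`, and use
`amalgPush k_(1,1) → k_2`. -/
noncomputable def pushGrafting (D : Grafting k oneOne) : Grafting k two where
  mod := amalgPush.obj D.mod
  mu := pushLax D.mod D.mod ≫ amalgPush.map D.mu ≫ pushOplax D.mod (unitMod k oneOne) ≫
    dayMap (𝟙 _) (pushProj k)

/-- The structure maps of `amalgPush D`, including the unit, for which `k_2 → amalgPush k_(1,1)` is
used. -/
noncomputable def pushUnitalGrafting (D : UnitalGrafting k oneOne) : UnitalGrafting k two where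
  toGrafting := pushGrafting D.toGrafting
  eta := pushIncl k ≫ amalgPush.map D.eta

end Induction
end CycDi

/-! The functors `amalgStar` and `amalgPush` are both additive and strong symmetric monoidal for Day
convolution. For `amalgStar`, a decomposition of a disjoint union is a pair of decompositions; for
`amalgPush`, splitting a set and then colouring each piece by inputs and outputs is the same as
colouring the set and then splitting each colour class.

For any strong symmetric monoidal functor Φ, any μ : M ⊙ M → M ⊙ K and any π : Φ(K) → K', the
transported operation `Strong.mu` inherits symmetry from μ, and two applications of it are the image
under Φ of two applications of μ followed by π ⊙ π, because the structure maps in between cancel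
(`Strong.twiceNat_mu`). Associativity is stated with Λ²K, which is a cokernel. As 2 is invertible,
vanishing after K ⊙ K → Λ²K is equivalent to vanishing after 1 - τ, where τ is the symmetry
(`comp_toExtSq_eq_zero_iff`). That condition is equational, so additive symmetric monoidal functors
preserve it (`Strong.associative_mu`), and nothing has to be known about Φ and cokernels.

The diagonal and unit axioms concern individual components. For `amalgStar`, the component from `d`
to `e` is a component of the original map between the disjoint unions `d.sum` and `e.sum`, whose
overlap is the same. For `amalgPush`, it is a sum over all colourings of X. Let the supports of the
unit before and after relabelling be {y, v} and {x, y}. A colouring contributes only if y differs in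
colour from both v and x. Then x and v have the same colour, so the relabelling x ↦ v respects
colours, and these colourings of X correspond bijectively to the colourings of X \ {y, v}
(`existsUnique_inside`). The sum of the contributions is therefore the relabelling map on the whole
of `amalgPush`. The left unit axiom follows from the right one by symmetry.

Elements of Day convolutions are detected by `split`, the projection along an arbitrary bijection A
⨿ B → X. In this form coherence diagrams become identities between bijections, which are checked on
elements, and no transport between equal subsets is needed. -/

namespace CycDi

/-! ### Disjoint unions of families and the decompositions that they induce -/

section Sums

variable {c : Type}

/-- The disjoint union of two families. -/
abbrev add (A B : FinFam c) : FinFam c where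
  carrier i := A.carrier i ⊕ B.carrier i

/-- The disjoint union of two morphisms. -/
def addMap {A A' B B' : FinFam c} (a : A ⟶ A') (b : B ⟶ B') : add A B ⟶ add A' B' :=
  fun i => Equiv.sumCongr (a i) (b i)

/-- Exchanging the two summands. -/
def addSwap (A B : FinFam c) : add A B ⟶ add B A :=
  fun _ => Equiv.sumComm _ _

/-- Reassociating three summands. -/
def addAssoc (A B C : FinFam c) : add (add A B) C ⟶ add A (add B C) :=
  fun _ => Equiv.sumAssoc _ _ _

theorem hom_ext {X Y : FinFam c} {f g : X ⟶ Y} (h : ∀ i x, f i x = g i x) : f = g :=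
  funext fun i => Equiv.ext (h i)

theorem comp_apply {X Y Z : FinFam c} (f : X ⟶ Y) (g : Y ⟶ Z) (i : c) (x : X.carrier i) :
    (f ≫ g) i x = g i (f i x) := rfl

@[simp]
theorem comp_inv {X Y : FinFam c} (f : X ⟶ Y) : f ≫ inv f = 𝟙 X :=
  hom_ext fun i x => (f i).symm_apply_apply x

@[simp]
theorem inv_comp {X Y : FinFam c} (f : X ⟶ Y) : inv f ≫ f = 𝟙 Y :=
  hom_ext fun i x => (f i).apply_symm_apply x

@[simp]
theorem comp_inv_assoc {X Y Z : FinFam c} (f : X ⟶ Y) (g : X ⟶ Z) : f ≫ inv f ≫ g = g := by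
  rw [← Category.assoc, comp_inv, Category.id_comp]

@[simp]
theorem inv_inv {X Y : FinFam c} (f : X ⟶ Y) : inv (inv f) = f := rfl

theorem inv_id (X : FinFam c) : inv (𝟙 X) = 𝟙 X := rfl

theorem map_inv_map {k : Type u} [Field k] (M : FMod c k) {X Y : FinFam c} (f : X ⟶ Y) :
    (M.map f).hom ∘ₗ (M.map (inv f)).hom = LinearMap.id := by
  rw [← ModuleCat.hom_comp, ← M.map_comp, inv_comp, M.map_id]; rfl

theorem map_map_inv {k : Type u} [Field k] (M : FMod c k) {X Y : FinFam c} (f : X ⟶ Y) :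
    (M.map (inv f)).hom ∘ₗ (M.map f).hom = LinearMap.id := by
  rw [← ModuleCat.hom_comp, ← M.map_comp, comp_inv, M.map_id]; rfl

/-- A bijection `A ⨿ B → X` determines a decomposition of `X`. -/
abbrev Dec.ofSum {A B X : FinFam c} (f : add A B ⟶ X) : Dec X where
  fst i := {x | ((f i).symm x).isLeft = true}
  snd i := {x | ((f i).symm x).isLeft = false}
  compl i x := by simp

/-- The bijection from the first piece of `Dec.ofSum f` to `A`. -/
def leftIso {A B X : FinFam c} (f : add A B ⟶ X) : part (Dec.ofSum f).fst ⟶ A :=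
  fun i => ((f i).symm.subtypeEquiv (q := fun y => y.isLeft = true) fun _ => Iff.rfl).trans
    { toFun := fun y => y.1.getLeft y.2
      invFun := fun a => ⟨.inl a, rfl⟩
      left_inv := fun _ => Subtype.ext (Sum.inl_getLeft _ _)
      right_inv := fun _ => rfl }

/-- The bijection from the second piece of `Dec.ofSum f` to `B`. -/
def rightIso {A B X : FinFam c} (f : add A B ⟶ X) : part (Dec.ofSum f).snd ⟶ B :=
  fun i => ((f i).symm.subtypeEquiv (q := fun y => y.isLeft = false) fun _ => Iff.rfl).trans
    { toFun := fun y => y.1.getRight (Sum.isLeft_eq_false.1 y.2)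
      invFun := fun a => ⟨.inr a, rfl⟩
      left_inv := fun _ => Subtype.ext (Sum.inr_getRight _ _)
      right_inv := fun _ => rfl }

theorem apply_leftIso {A B X : FinFam c} (f : add A B ⟶ X) (i : c)
    (x : (part (Dec.ofSum f).fst).carrier i) : f i (.inl (leftIso f i x)) = x.1 :=
  ((congrArg (f i) (Sum.inl_getLeft ((f i).symm x.1) x.2))).trans ((f i).apply_symm_apply _)

theorem apply_rightIso {A B X : FinFam c} (f : add A B ⟶ X) (i : c)
    (x : (part (Dec.ofSum f).snd).carrier i) : f i (.inr (rightIso f i x)) = x.1 :=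
  ((congrArg (f i) (Sum.inr_getRight ((f i).symm x.1) (Sum.isLeft_eq_false.1 x.2)))).trans
    ((f i).apply_symm_apply _)

open Classical in
/-- The bijection `d.fst ⨿ d.snd → X` given by a decomposition `d` of `X`. -/
noncomputable def Dec.glue {X : FinFam c} (d : Dec X) : add (part d.fst) (part d.snd) ⟶ X :=
  fun i =>
    { toFun := Sum.elim Subtype.val Subtype.val
      invFun := fun x => if h : x ∈ d.fst i then .inl ⟨x, h⟩ else .inr ⟨x, (d.compl i x).2 h⟩
      left_inv := by
        rintro (x | x)
        · exact dif_pos x.2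
        · exact dif_neg ((d.compl i x.1).1 x.2)
      right_inv := fun x => by
        by_cases h : x ∈ d.fst i
        · simp [h]
        · simp [h] }

/-- The hypotheses say that each piece of `d` lies in the image of the corresponding summand. Since
the pieces are complementary on both sides, the two inclusions are equalities. -/
theorem Dec.eq_ofSum {A B X : FinFam c} (f : add A B ⟶ X) (d : Dec X)
    (a : part d.fst ⟶ A) (b : part d.snd ⟶ B) (ha : ∀ i x, f i (.inl (a i x)) = x.1)
    (hb : ∀ i x, f i (.inr (b i x)) = x.1) : d = Dec.ofSum f := by
  have h₁ : ∀ i x, x ∈ d.fst i → x ∈ (Dec.ofSum f).fst i := fun i x h => by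
    change ((f i).symm x).isLeft = true
    rw [(Equiv.symm_apply_eq (f i)).2 (ha i ⟨x, h⟩).symm]; rfl
  have h₂ : ∀ i x, x ∈ d.snd i → x ∈ (Dec.ofSum f).snd i := fun i x h => by
    change ((f i).symm x).isLeft = false
    rw [(Equiv.symm_apply_eq (f i)).2 (hb i ⟨x, h⟩).symm]; rfl
  refine Dec.ext ?_ ?_ <;> funext i <;> ext x
  · refine ⟨h₁ i x, fun h => ?_⟩
    by_contra h'
    exact ((Dec.ofSum f).compl i x).1 (h₂ i x ((d.compl i x).2 h')) h
  · refine ⟨h₂ i x, fun h => ?_⟩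
    by_contra h'
    exact ((Dec.ofSum f).compl i x).1 h (h₁ i x (by_contra fun h'' => h' ((d.compl i x).2 h'')))

end Sums

/-! ### Projections of Day convolutions along bijections -/

section Splits

variable {c : Type} {k : Type u} [Field k]

/-- The projection `(M ⊙ N)(X) → M(A) ⊗ N(B)` given by a bijection `A ⨿ B → X`. -/
noncomputable def split (M N : FMod c k) {A B X : FinFam c} (f : add A B ⟶ X) :
    (day M N).obj X →ₗ[k] M.obj A ⊗[k] N.obj B :=
  TensorProduct.map (M.map (leftIso f)).hom (N.map (rightIso f)).hom ∘ₗ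
    dayProj M N (Dec.ofSum f)

/-- Both the decomposition and the bijections `a`, `b` are determined by `f`, because `f` is
injective. This is the tool for recognising a `split`: only the images of elements in `X` have to be
compared. -/
theorem map_comp_dayProj (M N : FMod c k) {A B X : FinFam c} (f : add A B ⟶ X) (d : Dec X)
    (a : part d.fst ⟶ A) (b : part d.snd ⟶ B) (ha : ∀ i x, f i (.inl (a i x)) = x.1)
    (hb : ∀ i x, f i (.inr (b i x)) = x.1) :
    TensorProduct.map (M.map a).hom (N.map b).hom ∘ₗ dayProj M N d = split M N f := by
  obtain rfl := Dec.eq_ofSum f d a b ha hb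
  have h₁ : a = leftIso f := hom_ext fun i x =>
    Sum.inl_injective ((f i).injective ((ha i x).trans (apply_leftIso f i x).symm))
  have h₂ : b = rightIso f := hom_ext fun i x =>
    Sum.inr_injective ((f i).injective ((hb i x).trans (apply_rightIso f i x).symm))
  rw [h₁, h₂, split]

theorem dayProj_eq_split (M N : FMod c k) {X : FinFam c} (d : Dec X) :
    dayProj M N d = split M N d.glue := by
  rw [← map_comp_dayProj M N d.glue d (𝟙 _) (𝟙 _) (fun _ _ => rfl) (fun _ _ => rfl), M.map_id,
    N.map_id]
  exact (congrArg (· ∘ₗ dayProj M N d) (TensorProduct.map_id (R := k)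
    (M := M.obj (part d.fst)) (N := N.obj (part d.snd)))).symm

/-- Together with `map_comp_split`, this turns functoriality in `X` and in the two pieces into
composition of bijections. -/
theorem split_comp_map (M N : FMod c k) {A B X Y : FinFam c} (f : add A B ⟶ Y) (h : X ⟶ Y) :
    split M N f ∘ₗ ((day M N).map h).hom = split M N (f ≫ inv h) := by
  rw [split, LinearMap.comp_assoc, dayProj_comp_map, ← LinearMap.comp_assoc,
    ← TensorProduct.map_comp, ← ModuleCat.hom_comp, ← ModuleCat.hom_comp, ← M.map_comp,
    ← N.map_comp]
  refine map_comp_dayProj M N (f ≫ inv h) _ _ _ (fun i x => ?_) (fun i x => ?_)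
  · rw [comp_apply]
    exact (congrArg (inv h i) (apply_leftIso f i _)).trans ((h i).symm_apply_apply _)
  · rw [comp_apply]
    exact (congrArg (inv h i) (apply_rightIso f i _)).trans ((h i).symm_apply_apply _)

theorem map_comp_split (M N : FMod c k) {A A' B B' X : FinFam c} (f : add A B ⟶ X) (a : A ⟶ A')
    (b : B ⟶ B') :
    TensorProduct.map (M.map a).hom (N.map b).hom ∘ₗ split M N f =
      split M N (addMap (inv a) (inv b) ≫ f) := by
  rw [split, ← LinearMap.comp_assoc, ← TensorProduct.map_comp, ← ModuleCat.hom_comp,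
    ← ModuleCat.hom_comp, ← M.map_comp, ← N.map_comp]
  refine map_comp_dayProj M N _ _ _ _ (fun i x => ?_) (fun i x => ?_)
  · refine Eq.trans ?_ (apply_leftIso f i x)
    exact congrArg (fun y => f i (.inl y)) ((a i).symm_apply_apply _)
  · refine Eq.trans ?_ (apply_rightIso f i x)
    exact congrArg (fun y => f i (.inr y)) ((b i).symm_apply_apply _)

theorem split_comp_dayMap {M M' N N' : FMod c k} (a : M ⟶ M') (b : N ⟶ N') {A B X : FinFam c}
    (f : add A B ⟶ X) :
    split M' N' f ∘ₗ ((dayMap a b).app X).hom =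
      TensorProduct.map (a.app A).hom (b.app B).hom ∘ₗ split M N f := by
  change (TensorProduct.map (M'.map (leftIso f)).hom (N'.map (rightIso f)).hom ∘ₗ
    TensorProduct.map (a.app _).hom (b.app _).hom) ∘ₗ dayProj M N (Dec.ofSum f) =
      (TensorProduct.map (a.app A).hom (b.app B).hom ∘ₗ
        TensorProduct.map (M.map (leftIso f)).hom (N.map (rightIso f)).hom) ∘ₗ
          dayProj M N (Dec.ofSum f)
  simp only [← TensorProduct.map_comp, ← ModuleCat.hom_comp, NatTrans.naturality]

theorem split_comp_braid (M N : FMod c k) {A B X : FinFam c} (f : add A B ⟶ X) :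
    split N M f ∘ₗ ((braid M N).app X).hom =
      (TensorProduct.comm k _ _).toLinearMap ∘ₗ split M N (addSwap _ _ ≫ f) := by
  rw [← map_comp_dayProj M N (addSwap _ _ ≫ f) (Dec.ofSum f).swap (rightIso f) (leftIso f)
    (apply_rightIso f) (apply_leftIso f)]
  exact congrArg (· ∘ₗ dayProj M N (Dec.ofSum f).swap)
    (TensorProduct.map_comp_comm_eq (N.map (leftIso f)).hom (M.map (rightIso f)).hom)

/-- The bijections `d.glue` already give all the projections to summands. -/
theorem split_hom_ext {M N : FMod c k} {X : FinFam c} {V : Type u} [AddCommGroup V] [Module k V]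
    {a b : V →ₗ[k] (day M N).obj X}
    (h : ∀ (A B : FinFam c) (f : add A B ⟶ X), split M N f ∘ₗ a = split M N f ∘ₗ b) : a = b :=
  day_hom_ext fun d => by simpa only [dayProj_eq_split] using h _ _ d.glue

theorem dayProj_comp_dayIncl (M N : FMod c k) {X : FinFam c} (d : Dec X) :
    dayProj M N d ∘ₗ dayIncl M N d = LinearMap.id :=
  LinearMap.proj_comp_single_same _ _ _

theorem dayProj_comp_dayIncl_ne (M N : FMod c k) {X : FinFam c} {d e : Dec X} (h : d ≠ e) :
    dayProj M N d ∘ₗ dayIncl M N e = 0 :=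
  LinearMap.proj_comp_single_ne _ _ _ _ h

theorem sum_dayIncl_comp_dayProj [Finite c] (M N : FMod c k) (X : FinFam c) :
    ∑ d : Dec X, dayIncl M N d ∘ₗ dayProj M N d = LinearMap.id := by
  refine day_hom_ext fun d => ?_
  rw [comp_sum_linear]
  refine (Finset.sum_eq_single d (fun e _ h => ?_) (by simp)).trans ?_
  · rw [← LinearMap.comp_assoc, dayProj_comp_dayIncl_ne M N h.symm, LinearMap.zero_comp]
  · rw [← LinearMap.comp_assoc, dayProj_comp_dayIncl, LinearMap.id_comp, LinearMap.comp_id]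

/-- The identity of `(M ⊙ N)(X)` is a finite sum of composites of inclusions and projections, and
such a sum survives tensoring with `W`. This is where the product that realises the direct sum has
to be finite. -/
theorem lTensor_split_ext [Finite c] {M N : FMod c k} {X : FinFam c} {V W : Type u}
    [AddCommGroup V] [Module k V] [AddCommGroup W] [Module k W]
    {a b : V →ₗ[k] W ⊗[k] (day M N).obj X}
    (h : ∀ (A B : FinFam c) (f : add A B ⟶ X),
      TensorProduct.map LinearMap.id (split M N f) ∘ₗ a =
        TensorProduct.map LinearMap.id (split M N f) ∘ₗ b) : a = b := by
  have key : ∀ u : V →ₗ[k] W ⊗[k] (day M N).obj X, u = ∑ d : Dec X,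
      TensorProduct.map LinearMap.id (dayIncl M N d) ∘ₗ
        TensorProduct.map LinearMap.id (dayProj M N d) ∘ₗ u := fun u => by
    simp only [← LinearMap.comp_assoc, ← TensorProduct.map_comp]
    rw [← sum_comp_linear]
    have : ∑ d : Dec X, TensorProduct.map ((LinearMap.id : W →ₗ[k] W) ∘ₗ LinearMap.id)
        (dayIncl M N d ∘ₗ dayProj M N d) = LinearMap.id := by
      have h := congrArg (LinearMap.lTensor W) (sum_dayIncl_comp_dayProj M N X)
      rw [LinearMap.lTensor_id, ← LinearMap.coe_lTensorHom, map_sum] at h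
      exact h
    rw [this, LinearMap.id_comp]
  rw [key a, key b]
  simp only [dayProj_eq_split, h]

theorem rTensor_split_ext [Finite c] {M N : FMod c k} {X : FinFam c} {V W : Type u}
    [AddCommGroup V] [Module k V] [AddCommGroup W] [Module k W]
    {a b : V →ₗ[k] (day M N).obj X ⊗[k] W}
    (h : ∀ (A B : FinFam c) (f : add A B ⟶ X),
      TensorProduct.map (split M N f) LinearMap.id ∘ₗ a =
        TensorProduct.map (split M N f) LinearMap.id ∘ₗ b) : a = b := by
  have key : ∀ u : V →ₗ[k] (day M N).obj X ⊗[k] W, u = ∑ d : Dec X,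
      TensorProduct.map (dayIncl M N d) LinearMap.id ∘ₗ
        TensorProduct.map (dayProj M N d) LinearMap.id ∘ₗ u := fun u => by
    simp only [← LinearMap.comp_assoc, ← TensorProduct.map_comp]
    rw [← sum_comp_linear]
    have : ∑ d : Dec X, TensorProduct.map (dayIncl M N d ∘ₗ dayProj M N d)
        ((LinearMap.id : W →ₗ[k] W) ∘ₗ LinearMap.id) = LinearMap.id := by
      have h := congrArg (LinearMap.rTensor W) (sum_dayIncl_comp_dayProj M N X)
      rw [LinearMap.rTensor_id, ← LinearMap.coe_rTensorHom, map_sum] at h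
      exact h
    rw [this, LinearMap.id_comp]
  rw [key a, key b]
  simp only [dayProj_eq_split, h]

end Splits
-- Triple products and the associativity isomorphism
section Triple

variable {c : Type} {k : Type u} [Field k] (M N P : FMod c k)

/-- The projection `((M ⊙ N) ⊙ P)(X) → M(A) ⊗ (N(B) ⊗ P(C))` given by a bijection
`(A ⨿ B) ⨿ C → X`. -/
noncomputable def splitL {A B C X : FinFam c} (f : add (add A B) C ⟶ X) :
    (day (day M N) P).obj X →ₗ[k] M.obj A ⊗[k] (N.obj B ⊗[k] P.obj C) :=
  (TensorProduct.assoc k _ _ _).toLinearMap ∘ₗ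
    TensorProduct.map (split M N (𝟙 (add A B))) LinearMap.id ∘ₗ split (day M N) P f

/-- The projection `(M ⊙ (N ⊙ P))(X) → M(A) ⊗ (N(B) ⊗ P(C))` given by a bijection
`A ⨿ (B ⨿ C) → X`. -/
noncomputable def splitR {A B C X : FinFam c} (f : add A (add B C) ⟶ X) :
    (day M (day N P)).obj X →ₗ[k] M.obj A ⊗[k] (N.obj B ⊗[k] P.obj C) :=
  TensorProduct.map LinearMap.id (split N P (𝟙 (add B C))) ∘ₗ split M (day N P) f

variable {M N P}

theorem tmap_comp {U V W U' V' W' Z : Type u} [AddCommGroup U] [Module k U] [AddCommGroup V]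
    [Module k V] [AddCommGroup W] [Module k W] [AddCommGroup U'] [Module k U'] [AddCommGroup V']
    [Module k V'] [AddCommGroup W'] [Module k W'] [AddCommGroup Z] [Module k Z]
    (a : V →ₗ[k] W) (b : U →ₗ[k] V) (a' : V' →ₗ[k] W') (b' : U' →ₗ[k] V')
    (r : Z →ₗ[k] U ⊗[k] U') :
    TensorProduct.map a a' ∘ₗ TensorProduct.map b b' ∘ₗ r =
      TensorProduct.map (a ∘ₗ b) (a' ∘ₗ b') ∘ₗ r := by
  rw [← LinearMap.comp_assoc, ← TensorProduct.map_comp]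

theorem assoc_tmap_comp {U V W U' V' W' Z : Type u} [AddCommGroup U] [Module k U] [AddCommGroup V]
    [Module k V] [AddCommGroup W] [Module k W] [AddCommGroup U'] [Module k U'] [AddCommGroup V']
    [Module k V'] [AddCommGroup W'] [Module k W'] [AddCommGroup Z] [Module k Z]
    (a : U →ₗ[k] U') (b : V →ₗ[k] V') (e : W →ₗ[k] W') (r : Z →ₗ[k] (U ⊗[k] V) ⊗[k] W) :
    (TensorProduct.assoc k U' V' W').toLinearMap ∘ₗ
      TensorProduct.map (TensorProduct.map a b) e ∘ₗ r =
    TensorProduct.map a (TensorProduct.map b e) ∘ₗ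
      (TensorProduct.assoc k U V W).toLinearMap ∘ₗ r := by
  rw [← LinearMap.comp_assoc, ← TensorProduct.map_map_comp_assoc_eq, LinearMap.comp_assoc]

theorem addMap_comp_addMap {A A' A'' B B' B'' X : FinFam c} (a : A ⟶ A') (a' : A' ⟶ A'')
    (b : B ⟶ B') (b' : B' ⟶ B'') (f : add A'' B'' ⟶ X) :
    addMap a b ≫ addMap a' b' ≫ f = addMap (a ≫ a') (b ≫ b') ≫ f :=
  hom_ext fun i x => by rcases x with x | x <;> rfl

theorem addMap_comp {A A' A'' B B' B'' : FinFam c} (a : A ⟶ A') (a' : A' ⟶ A'')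
    (b : B ⟶ B') (b' : B' ⟶ B'') : addMap a b ≫ addMap a' b' = addMap (a ≫ a') (b ≫ b') :=
  hom_ext fun i x => by rcases x with x | x <;> rfl

theorem addMap_id (A B : FinFam c) : addMap (𝟙 A) (𝟙 B) = 𝟙 (add A B) :=
  hom_ext fun i x => by rcases x with x | x <;> rfl

theorem map_id_hom (M : FMod c k) (X : FinFam c) :
    (M.map (𝟙 X)).hom = LinearMap.id := by
  rw [M.map_id]; rfl

/-- Naturality of the outer projection in `Y` absorbs `g` into the outer bijection, so that the
inner projection is taken along the identity. -/
theorem split_id_comp_split_snd {A B C Y X : FinFam c} (f : add A Y ⟶ X) (g : add B C ⟶ Y) :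
    TensorProduct.map LinearMap.id (split N P g) ∘ₗ split M (day N P) f =
      splitR M N P (addMap (𝟙 A) g ≫ f) := by
  have h := map_comp_split M (day N P) f (𝟙 A) (inv g)
  rw [map_id_hom, inv_id, inv_inv] at h
  rw [splitR, ← h, tmap_comp, split_comp_map, Category.id_comp, LinearMap.comp_id, inv_inv]

theorem split_id_comp_split_fst {A B C Y X : FinFam c} (f : add Y C ⟶ X) (g : add A B ⟶ Y) :
    (TensorProduct.assoc k _ _ _).toLinearMap ∘ₗ
    TensorProduct.map (split M N g) LinearMap.id ∘ₗ split (day M N) P f =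
      splitL M N P (addMap g (𝟙 C) ≫ f) := by
  have h := map_comp_split (day M N) P f (inv g) (𝟙 C)
  rw [map_id_hom, inv_id, inv_inv] at h
  rw [splitL, ← h, tmap_comp, split_comp_map, Category.id_comp, LinearMap.comp_id, inv_inv]

theorem splitR_comp_map {A B C X Y : FinFam c} (f : add A (add B C) ⟶ Y) (h : X ⟶ Y) :
    splitR M N P f ∘ₗ ((day M (day N P)).map h).hom = splitR M N P (f ≫ inv h) := by
  rw [splitR, LinearMap.comp_assoc, split_comp_map, splitR]

theorem splitL_comp_map {A B C X Y : FinFam c} (f : add (add A B) C ⟶ Y) (h : X ⟶ Y) :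
    splitL M N P f ∘ₗ ((day (day M N) P).map h).hom = splitL M N P (f ≫ inv h) := by
  rw [splitL, LinearMap.comp_assoc, LinearMap.comp_assoc, split_comp_map, splitL]

theorem splitR_comp_dayMap {M' N' P' : FMod c k} (m : M ⟶ M') (n : N ⟶ N') (p : P ⟶ P')
    {A B C X : FinFam c} (f : add A (add B C) ⟶ X) :
    splitR M' N' P' f ∘ₗ ((dayMap m (dayMap n p)).app X).hom =
      TensorProduct.map (m.app A).hom (TensorProduct.map (n.app B).hom (p.app C).hom) ∘ₗ
        splitR M N P f := by
  rw [splitR, splitR, LinearMap.comp_assoc, split_comp_dayMap, tmap_comp, split_comp_dayMap,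
    tmap_comp, LinearMap.comp_id, LinearMap.id_comp]

theorem splitL_comp_dayMap {M' N' P' : FMod c k} (m : M ⟶ M') (n : N ⟶ N') (p : P ⟶ P')
    {A B C X : FinFam c} (f : add (add A B) C ⟶ X) :
    splitL M' N' P' f ∘ₗ ((dayMap (dayMap m n) p).app X).hom =
      TensorProduct.map (m.app A).hom (TensorProduct.map (n.app B).hom (p.app C).hom) ∘ₗ
        splitL M N P f := by
  rw [splitL, splitL, LinearMap.comp_assoc, LinearMap.comp_assoc, split_comp_dayMap, tmap_comp,
    split_comp_dayMap, ← assoc_tmap_comp, tmap_comp, LinearMap.comp_id, LinearMap.id_comp]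

theorem map_comp_splitR {A A' B B' C C' X : FinFam c} (f : add A (add B C) ⟶ X) (a : A ⟶ A')
    (b : B ⟶ B') (e : C ⟶ C') :
    TensorProduct.map (M.map a).hom (TensorProduct.map (N.map b).hom (P.map e).hom) ∘ₗ
      splitR M N P f = splitR M N P (addMap (inv a) (addMap (inv b) (inv e)) ≫ f) := by
  have h := map_comp_split M (day N P) f a (𝟙 _)
  rw [map_id_hom, inv_id] at h
  have h' := split_id_comp_split_snd (M := M) (N := N) (P := P)
    (addMap (inv a) (𝟙 _) ≫ f) (addMap (inv b) (inv e))
  rw [← h, tmap_comp, LinearMap.comp_id, LinearMap.id_comp, addMap_comp_addMap, Category.id_comp,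
    Category.comp_id] at h'
  rw [← h', splitR, tmap_comp, LinearMap.comp_id, map_comp_split, Category.comp_id]

theorem map_comp_splitL {A A' B B' C C' X : FinFam c} (f : add (add A B) C ⟶ X) (a : A ⟶ A')
    (b : B ⟶ B') (e : C ⟶ C') :
    TensorProduct.map (M.map a).hom (TensorProduct.map (N.map b).hom (P.map e).hom) ∘ₗ
      splitL M N P f = splitL M N P (addMap (addMap (inv a) (inv b)) (inv e) ≫ f) := by
  have h := map_comp_split (day M N) P f (𝟙 _) e
  rw [map_id_hom, inv_id] at h
  have h' := split_id_comp_split_fst (M := M) (N := N) (P := P)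
    (addMap (𝟙 _) (inv e) ≫ f) (addMap (inv a) (inv b))
  rw [← h, tmap_comp, LinearMap.comp_id, LinearMap.id_comp, addMap_comp_addMap, Category.id_comp,
    Category.comp_id] at h'
  rw [← h', splitL, ← assoc_tmap_comp, tmap_comp, LinearMap.comp_id, map_comp_split,
    Category.comp_id]

/-- Test first on the outer product, then on the inner one under the tensor product. Every such
iterated projection is a `splitR`. -/
theorem splitR_hom_ext [Finite c] {X : FinFam c} {V : Type u} [AddCommGroup V] [Module k V]
    {a b : V →ₗ[k] (day M (day N P)).obj X}
    (h : ∀ (A B C : FinFam c) (f : add A (add B C) ⟶ X),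
      splitR M N P f ∘ₗ a = splitR M N P f ∘ₗ b) : a = b := by
  refine split_hom_ext fun A Y f => lTensor_split_ext fun B C g => ?_
  rw [← LinearMap.comp_assoc, split_id_comp_split_snd, ← LinearMap.comp_assoc,
    split_id_comp_split_snd, h]

theorem splitL_hom_ext [Finite c] {X : FinFam c} {V : Type u} [AddCommGroup V] [Module k V]
    {a b : V →ₗ[k] (day (day M N) P).obj X}
    (h : ∀ (A B C : FinFam c) (f : add (add A B) C ⟶ X),
      splitL M N P f ∘ₗ a = splitL M N P f ∘ₗ b) : a = b := by
  refine split_hom_ext fun Y C f => rTensor_split_ext fun A B g => ?_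
  have h' := h _ _ _ (addMap g (𝟙 C) ≫ f)
  rw [← split_id_comp_split_fst, LinearMap.comp_assoc, LinearMap.comp_assoc, LinearMap.comp_assoc,
    LinearMap.comp_assoc] at h'
  -- The reassociation of tensor products contained in `splitL` is injective and can be cancelled.
  exact LinearMap.ext fun v =>
    (TensorProduct.assoc k _ _ _).injective (LinearMap.congr_fun h' v)

/-- The bijection `s₁ ⨿ (s₂ ⨿ s₃) → X`. -/
noncomputable def Dec3.glueR {X : FinFam c} (t : Dec3 X) :
    add (part t.s₁) (add (part t.s₂) (part t.s₃)) ⟶ X :=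
  addMap (𝟙 (part t.s₁))
    (addMap (inv (flatten t.right.snd t.s₂ fun _ _ => Or.inl))
      (inv (flatten t.right.snd t.s₃ fun _ _ => Or.inr)) ≫ t.rightIn.glue) ≫ t.right.glue

/-- The bijection `(s₁ ⨿ s₂) ⨿ s₃ → X`. -/
noncomputable def Dec3.glueL {X : FinFam c} (t : Dec3 X) :
    add (add (part t.s₁) (part t.s₂)) (part t.s₃) ⟶ X :=
  addMap
    (addMap (inv (flatten t.left.fst t.s₁ fun _ _ => Or.inl))
      (inv (flatten t.left.fst t.s₂ fun _ _ => Or.inr)) ≫ t.leftIn.glue)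
    (𝟙 (part t.s₃)) ≫ t.left.glue

/-- Both bijections restrict to the inclusions of the three subsets in `X`. Hence matching the
summands with the same index `t` amounts to reassociating disjoint unions. -/
theorem Dec3.addAssoc_comp_glueR {X : FinFam c} (t : Dec3 X) :
    addAssoc _ _ _ ≫ t.glueR = t.glueL :=
  hom_ext fun i x => by rcases x with (x | x) | x <;> rfl

theorem dayProj_snd_eq_splitR {X B C : FinFam c} (d : Dec X) (d' : Dec (part d.snd))
    (b : part d'.fst ⟶ B) (e : part d'.snd ⟶ C) :
    TensorProduct.map LinearMap.id
      (TensorProduct.map (N.map b).hom (P.map e).hom ∘ₗ dayProj N P d') ∘ₗ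
        dayProj M (day N P) d =
    splitR M N P (addMap (𝟙 (part d.fst)) (addMap (inv b) (inv e) ≫ d'.glue) ≫ d.glue) := by
  rw [← split_id_comp_split_snd, ← map_comp_split, ← dayProj_eq_split, ← dayProj_eq_split]

theorem dayProj_fst_eq_splitL {X A B : FinFam c} (d : Dec X) (d' : Dec (part d.fst))
    (a : part d'.fst ⟶ A) (b : part d'.snd ⟶ B) :
    (TensorProduct.assoc k _ _ _).toLinearMap ∘ₗ TensorProduct.map
      (TensorProduct.map (M.map a).hom (N.map b).hom ∘ₗ dayProj M N d') LinearMap.id ∘ₗ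
        dayProj (day M N) P d =
    splitL M N P (addMap (addMap (inv a) (inv b) ≫ d'.glue) (𝟙 (part d.snd)) ≫ d.glue) := by
  rw [← split_id_comp_split_fst, ← map_comp_split, ← dayProj_eq_split, ← dayProj_eq_split]

theorem projRight_eq_splitR {X : FinFam c} (t : Dec3 X) :
    projRight M N P t = splitR M N P t.glueR :=
  dayProj_snd_eq_splitR t.right t.rightIn _ _

theorem projLeft_eq_splitL {X : FinFam c} (t : Dec3 X) :
    projLeft M N P t = splitL M N P t.glueL :=
  dayProj_fst_eq_splitL t.left t.leftIn _ _

/-- The comparison between equal decompositions. -/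
def Dec.castFst {X : FinFam c} {d e : Dec X} (h : d = e) : part d.fst ⟶ part e.fst :=
  restr (𝟙 X) _ _ fun _ _ => by subst h; exact Iff.rfl

/-- The comparison between equal decompositions. -/
def Dec.castSnd {X : FinFam c} {d e : Dec X} (h : d = e) : part d.snd ⟶ part e.snd :=
  restr (𝟙 X) _ _ fun _ _ => by subst h; exact Iff.rfl

/-- The pieces of `d` and `e` are different types; expressing the comparison by bijections keeps
both decompositions visible when a second decomposition of a piece is involved. -/
theorem dayProj_comp_dayIncl_of_eq (M N : FMod c k) {X : FinFam c} {d e : Dec X} (h : d = e) :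
    dayProj M N e ∘ₗ dayIncl M N d =
      TensorProduct.map (M.map (Dec.castFst h)).hom (N.map (Dec.castSnd h)).hom := by
  subst h
  rw [dayProj_comp_dayIncl]
  change _ = TensorProduct.map (M.map (𝟙 (part d.fst))).hom (N.map (𝟙 (part d.snd))).hom
  rw [map_id_hom, map_id_hom, TensorProduct.map_id]

theorem dayProj_comp_dayIncl_comp (M N : FMod c k) {X : FinFam c} (d : Dec X) {V : Type u}
    [AddCommGroup V] [Module k V] (r : V →ₗ[k] M.obj (part d.fst) ⊗[k] N.obj (part d.snd)) :
    dayProj M N d ∘ₗ dayIncl M N d ∘ₗ r = r := by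
  rw [← LinearMap.comp_assoc, dayProj_comp_dayIncl, LinearMap.id_comp]

theorem dayProj_comp_map_comp (M N : FMod c k) {X Y : FinFam c} (f : X ⟶ Y) (d : Dec Y)
    {V : Type u} [AddCommGroup V] [Module k V] (r : V →ₗ[k] (day M N).obj X) :
    dayProj M N d ∘ₗ ((day M N).map f).hom ∘ₗ r =
      TensorProduct.map (M.map (restr f (d.pull f).fst d.fst fun _ _ => Iff.rfl)).hom
        (N.map (restr f (d.pull f).snd d.snd fun _ _ => Iff.rfl)).hom ∘ₗ
          dayProj M N (d.pull f) ∘ₗ r := rfl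

theorem dayProj_dayIncl_snd_self {X B C : FinFam c} (d : Dec X) (d' : Dec (part d.snd))
    (b : part d'.fst ⟶ B) (e : part d'.snd ⟶ C) :
    (TensorProduct.map (LinearMap.id : M.obj (part d.fst) →ₗ[k] _)
      (TensorProduct.map (N.map b).hom (P.map e).hom ∘ₗ dayProj N P d') ∘ₗ
        dayProj M (day N P) d) ∘ₗ
      dayIncl M (day N P) d ∘ₗ TensorProduct.map LinearMap.id
        (dayIncl N P d' ∘ₗ TensorProduct.map (N.map (inv b)).hom (P.map (inv e)).hom) =
      LinearMap.id := by
  rw [LinearMap.comp_assoc, dayProj_comp_dayIncl_comp, ← TensorProduct.map_comp,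
    LinearMap.comp_assoc, dayProj_comp_dayIncl_comp, ← TensorProduct.map_comp, map_inv_map,
    map_inv_map, TensorProduct.map_id, LinearMap.id_comp, TensorProduct.map_id]

/-- Either the outer decompositions differ, and the outer projection kills the inclusion, or they
agree, and after identifying their second pieces the inner projection does so. -/
theorem dayProj_dayIncl_snd_ne {X B C B' C' : FinFam c} {d e : Dec X} (d' : Dec (part d.snd))
    (e' : Dec (part e.snd)) (b : N.obj (part d'.fst) ⊗[k] P.obj (part d'.snd) →ₗ[k]
      N.obj B ⊗[k] P.obj C) (b' : N.obj B' ⊗[k] P.obj C' →ₗ[k]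
      N.obj (part e'.fst) ⊗[k] P.obj (part e'.snd))
    (h : ∀ h : e = d, d'.pull (Dec.castSnd h) ≠ e') :
    (TensorProduct.map (LinearMap.id : M.obj (part d.fst) →ₗ[k] _)
      (b ∘ₗ dayProj N P d') ∘ₗ dayProj M (day N P) d) ∘ₗ
      dayIncl M (day N P) e ∘ₗ TensorProduct.map LinearMap.id (dayIncl N P e' ∘ₗ b') = 0 := by
  rw [LinearMap.comp_assoc, ← LinearMap.comp_assoc _ _ (dayProj M (day N P) d)]
  by_cases hr : e = d
  · rw [dayProj_comp_dayIncl_of_eq _ _ hr, ← TensorProduct.map_comp, ← TensorProduct.map_comp,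
      LinearMap.comp_assoc _ _ b, dayProj_comp_map_comp,
      ← LinearMap.comp_assoc _ _ (dayProj N P _),
      dayProj_comp_dayIncl_ne _ _ (h hr), LinearMap.zero_comp, LinearMap.comp_zero,
      LinearMap.comp_zero, TensorProduct.map_zero_right]
  · rw [dayProj_comp_dayIncl_ne _ _ (Ne.symm hr), LinearMap.zero_comp, LinearMap.comp_zero]

theorem dayProj_dayIncl_fst_self {X A B : FinFam c} (d : Dec X) (d' : Dec (part d.fst))
    (a : part d'.fst ⟶ A) (b : part d'.snd ⟶ B) :
    ((TensorProduct.assoc k (M.obj A) (N.obj B) (P.obj (part d.snd))).toLinearMap ∘ₗ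
      TensorProduct.map (TensorProduct.map (M.map a).hom (N.map b).hom ∘ₗ dayProj M N d')
        LinearMap.id ∘ₗ dayProj (day M N) P d) ∘ₗ
      dayIncl (day M N) P d ∘ₗ TensorProduct.map
        (dayIncl M N d' ∘ₗ TensorProduct.map (M.map (inv a)).hom (N.map (inv b)).hom)
        LinearMap.id ∘ₗ
      (TensorProduct.assoc k (M.obj A) (N.obj B) (P.obj (part d.snd))).symm.toLinearMap =
      LinearMap.id := by
  rw [LinearMap.comp_assoc, LinearMap.comp_assoc, dayProj_comp_dayIncl_comp, tmap_comp,
    LinearMap.comp_assoc, dayProj_comp_dayIncl_comp, ← TensorProduct.map_comp, map_inv_map,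
    map_inv_map, TensorProduct.map_id, LinearMap.id_comp, TensorProduct.map_id, LinearMap.id_comp]
  exact LinearMap.ext fun x => LinearEquiv.apply_symm_apply
    (TensorProduct.assoc k (M.obj A) (N.obj B) (P.obj (part d.snd))) x

theorem dayProj_dayIncl_fst_ne {X A B A' B' : FinFam c} {d e : Dec X} (d' : Dec (part d.fst))
    (e' : Dec (part e.fst)) (b : M.obj (part d'.fst) ⊗[k] N.obj (part d'.snd) →ₗ[k]
      M.obj A ⊗[k] N.obj B) (b' : M.obj A' ⊗[k] N.obj B' →ₗ[k]
      M.obj (part e'.fst) ⊗[k] N.obj (part e'.snd))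
    (h : ∀ h : e = d, d'.pull (Dec.castFst h) ≠ e') :
    ((TensorProduct.assoc k (M.obj A) (N.obj B) (P.obj (part d.snd))).toLinearMap ∘ₗ
      TensorProduct.map (b ∘ₗ dayProj M N d') LinearMap.id ∘ₗ dayProj (day M N) P d) ∘ₗ
      dayIncl (day M N) P e ∘ₗ TensorProduct.map (dayIncl M N e' ∘ₗ b') LinearMap.id ∘ₗ
      (TensorProduct.assoc k (M.obj A') (N.obj B') (P.obj (part e.snd))).symm.toLinearMap = 0 := by
  rw [LinearMap.comp_assoc, LinearMap.comp_assoc,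
    ← LinearMap.comp_assoc _ _ (dayProj (day M N) P d)]
  by_cases hr : e = d
  · rw [dayProj_comp_dayIncl_of_eq _ _ hr, tmap_comp, tmap_comp,
      LinearMap.comp_assoc (dayIncl M N e' ∘ₗ b'), LinearMap.comp_assoc _ _ b,
      dayProj_comp_map_comp, ← LinearMap.comp_assoc _ _ (dayProj M N _),
      dayProj_comp_dayIncl_ne _ _ (h hr), LinearMap.zero_comp, LinearMap.comp_zero,
      LinearMap.comp_zero, TensorProduct.map_zero_left, LinearMap.zero_comp, LinearMap.comp_zero]
  · rw [dayProj_comp_dayIncl_ne _ _ (Ne.symm hr), LinearMap.zero_comp, LinearMap.comp_zero,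
      LinearMap.comp_zero]

theorem projRight_comp_inclRight {X : FinFam c} (t : Dec3 X) :
    projRight M N P t ∘ₗ inclRight M N P t = LinearMap.id :=
  dayProj_dayIncl_snd_self t.right t.rightIn _ _

theorem projLeft_comp_inclLeft {X : FinFam c} (t : Dec3 X) :
    projLeft M N P t ∘ₗ inclLeft M N P t = LinearMap.id :=
  dayProj_dayIncl_fst_self t.left t.leftIn _ _

/-- A decomposition into three subsets is recovered from its outer and inner decompositions.
Elements outside the union of the last two subsets are treated separately, since the inner
decomposition does not see them. -/
theorem projRight_comp_inclRight_ne {X : FinFam c} {t t' : Dec3 X} (h : t ≠ t') :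
    projRight M N P t ∘ₗ inclRight M N P t' = 0 := by
  refine dayProj_dayIncl_snd_ne t.rightIn t'.rightIn _ _ fun hr h' => ?_
  refine h (Dec3.ext (congrArg Dec.fst hr).symm ?_ ?_) <;> funext i <;> ext x
  · by_cases hx : x ∈ t'.right.snd i
    · exact iff_of_eq
        (congrArg (fun d => (⟨x, hx⟩ : (part t'.right.snd).carrier i) ∈ d.fst i) h')
    · have hx' : x ∉ t.right.snd i := hr ▸ hx
      exact iff_of_false (fun h => hx' (Or.inl h)) (fun h => hx (Or.inl h))
  · by_cases hx : x ∈ t'.right.snd i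
    · exact iff_of_eq
        (congrArg (fun d => (⟨x, hx⟩ : (part t'.right.snd).carrier i) ∈ d.snd i) h')
    · have hx' : x ∉ t.right.snd i := hr ▸ hx
      exact iff_of_false (fun h => hx' (Or.inr h)) (fun h => hx (Or.inr h))

theorem projLeft_comp_inclLeft_ne {X : FinFam c} {t t' : Dec3 X} (h : t ≠ t') :
    projLeft M N P t ∘ₗ inclLeft M N P t' = 0 := by
  refine dayProj_dayIncl_fst_ne t.leftIn t'.leftIn _ _ fun hr h' => ?_
  refine h (Dec3.ext ?_ ?_ (congrArg Dec.snd hr).symm) <;> funext i <;> ext x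
  · by_cases hx : x ∈ t'.left.fst i
    · exact iff_of_eq
        (congrArg (fun d => (⟨x, hx⟩ : (part t'.left.fst).carrier i) ∈ d.fst i) h')
    · have hx' : x ∉ t.left.fst i := hr ▸ hx
      exact iff_of_false (fun h => hx' (Or.inl h)) (fun h => hx (Or.inl h))
  · by_cases hx : x ∈ t'.left.fst i
    · exact iff_of_eq
        (congrArg (fun d => (⟨x, hx⟩ : (part t'.left.fst).carrier i) ∈ d.snd i) h')
    · have hx' : x ∉ t.left.fst i := hr ▸ hx
      exact iff_of_false (fun h => hx' (Or.inr h)) (fun h => hx (Or.inr h))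

/-- A bijection `A ⨿ (B ⨿ C) → X` determines a decomposition of `X` into three subsets. -/
theorem Dec3.exists_glueR {A B C X : FinFam c} (f : add A (add B C) ⟶ X) :
    ∃ (t : Dec3 X) (a : part t.s₁ ⟶ A) (b : part t.s₂ ⟶ B) (e : part t.s₃ ⟶ C),
      addMap a (addMap b e) ≫ f = t.glueR := by
  have hf := fun i => (f i).injective
  let t : Dec3 X :=
    { s₁ := fun i => Set.range fun x => f i (.inl x)
      s₂ := fun i => Set.range fun x => f i (.inr (.inl x))
      s₃ := fun i => Set.range fun x => f i (.inr (.inr x))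
      exact_one := fun i x => by
        obtain ⟨y, rfl⟩ := (f i).surjective x
        rcases y with y | y | y <;> simp }
  refine ⟨t,
    inv fun i => Equiv.ofInjective (fun x => f i (.inl x)) ((hf i).comp Sum.inl_injective),
    inv fun i => Equiv.ofInjective (fun x => f i (.inr (.inl x)))
      ((hf i).comp (Sum.inr_injective.comp Sum.inl_injective)),
    inv fun i => Equiv.ofInjective (fun x => f i (.inr (.inr x)))
      ((hf i).comp (Sum.inr_injective.comp Sum.inr_injective)), hom_ext fun i x => ?_⟩
  rcases x with x | x | x
  · exact congrArg Subtype.val (Equiv.apply_symm_apply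
      (Equiv.ofInjective (fun x => f i (.inl x)) ((hf i).comp Sum.inl_injective)) x)
  · exact congrArg Subtype.val (Equiv.apply_symm_apply
      (Equiv.ofInjective (fun x => f i (.inr (.inl x)))
        ((hf i).comp (Sum.inr_injective.comp Sum.inl_injective))) x)
  · exact congrArg Subtype.val (Equiv.apply_symm_apply
      (Equiv.ofInjective (fun x => f i (.inr (.inr x)))
        ((hf i).comp (Sum.inr_injective.comp Sum.inr_injective))) x)

theorem addAssoc_comp_addMap {A B C A' B' C' : FinFam c} (a : A ⟶ A') (b : B ⟶ B')
    (e : C ⟶ C') :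
    addAssoc A B C ≫ addMap a (addMap b e) = addMap (addMap a b) e ≫ addAssoc A' B' C' :=
  hom_ext fun i x => by rcases x with (x | x) | x <;> rfl

variable [Finite c]

/-- By orthogonality of the projections and inclusions, only the term with index `t` of the sum
survives. -/
theorem projRight_comp_assocHom {X : FinFam c} (t : Dec3 X) :
    projRight M N P t ∘ₗ assocHom M N P X = projLeft M N P t := by
  rw [assocHom, comp_sum_linear, Finset.sum_eq_single t]
  · rw [← LinearMap.comp_assoc, projRight_comp_inclRight, LinearMap.id_comp]
  · intro t' _ h
    rw [← LinearMap.comp_assoc, projRight_comp_inclRight_ne h.symm, LinearMap.zero_comp]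
  · simp

theorem projLeft_comp_assocInv {X : FinFam c} (t : Dec3 X) :
    projLeft M N P t ∘ₗ assocInv M N P X = projRight M N P t := by
  rw [assocInv, comp_sum_linear, Finset.sum_eq_single t]
  · rw [← LinearMap.comp_assoc, projLeft_comp_inclLeft, LinearMap.id_comp]
  · intro t' _ h
    rw [← LinearMap.comp_assoc, projLeft_comp_inclLeft_ne h.symm, LinearMap.zero_comp]
  · simp

/-- Every `f` differs from some `t.glueR` by bijections of the three pieces, so the claim reduces to
`projRight_comp_assocHom`. This formula characterises the associativity isomorphism, and its inverse
and naturality properties follow from it. -/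
theorem splitR_comp_assocHom {A B C X : FinFam c} (f : add A (add B C) ⟶ X) :
    splitR M N P f ∘ₗ assocHom M N P X = splitL M N P (addAssoc A B C ≫ f) := by
  obtain ⟨t, a, b, e, h⟩ := Dec3.exists_glueR f
  have h₁ : f = addMap (inv a) (addMap (inv b) (inv e)) ≫ t.glueR := by
    rw [← h, addMap_comp_addMap, inv_comp, addMap_comp, inv_comp, inv_comp, addMap_id,
      addMap_id, Category.id_comp]
  rw [h₁, ← map_comp_splitR, LinearMap.comp_assoc, ← projRight_eq_splitR,
    projRight_comp_assocHom, projLeft_eq_splitL, map_comp_splitL, ← t.addAssoc_comp_glueR,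
    ← Category.assoc, ← Category.assoc, addAssoc_comp_addMap]

theorem splitL_comp_assocInv {A B C X : FinFam c} (f : add A (add B C) ⟶ X) :
    splitL M N P (addAssoc A B C ≫ f) ∘ₗ assocInv M N P X = splitR M N P f := by
  obtain ⟨t, a, b, e, h⟩ := Dec3.exists_glueR f
  have h₁ : f = addMap (inv a) (addMap (inv b) (inv e)) ≫ t.glueR := by
    rw [← h, addMap_comp_addMap, inv_comp, addMap_comp, inv_comp, inv_comp, addMap_id,
      addMap_id, Category.id_comp]
  rw [h₁, ← map_comp_splitR, ← projRight_eq_splitR, ← projLeft_comp_assocInv,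
    projLeft_eq_splitL, ← LinearMap.comp_assoc, map_comp_splitL, ← t.addAssoc_comp_glueR,
    ← Category.assoc, ← Category.assoc, addAssoc_comp_addMap]

theorem splitL_comp_assocInv' {A B C X : FinFam c} (f : add (add A B) C ⟶ X) :
    splitL M N P f ∘ₗ assocInv M N P X = splitR M N P (inv (addAssoc A B C) ≫ f) := by
  rw [← splitL_comp_assocInv, comp_inv_assoc]

variable (M N P)

/-- The associativity isomorphism is natural. -/
noncomputable def assocNat : day (day M N) P ⟶ day M (day N P) where
  app X := ModuleCat.ofHom (assocHom M N P X)
  naturality X Y h := ModuleCat.hom_ext (splitR_hom_ext fun A B C f => by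
    change splitR M N P f ∘ₗ assocHom M N P Y ∘ₗ ((day (day M N) P).map h).hom =
      splitR M N P f ∘ₗ ((day M (day N P)).map h).hom ∘ₗ assocHom M N P X
    rw [← LinearMap.comp_assoc, ← LinearMap.comp_assoc, splitR_comp_assocHom, splitL_comp_map,
      splitR_comp_map, splitR_comp_assocHom, Category.assoc])

/-- The inverse of the associativity isomorphism is natural. -/
noncomputable def assocNatInv : day M (day N P) ⟶ day (day M N) P where
  app X := ModuleCat.ofHom (assocInv M N P X)
  naturality X Y h := ModuleCat.hom_ext (splitL_hom_ext fun A B C f => by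
    change splitL M N P f ∘ₗ assocInv M N P Y ∘ₗ ((day M (day N P)).map h).hom =
      splitL M N P f ∘ₗ ((day (day M N) P).map h).hom ∘ₗ assocInv M N P X
    rw [← LinearMap.comp_assoc, ← LinearMap.comp_assoc, splitL_comp_assocInv', splitL_comp_map,
      splitR_comp_map, splitL_comp_assocInv', Category.assoc])

/-- The associativity isomorphism. -/
noncomputable def assocIso : day (day M N) P ≅ day M (day N P) where
  hom := assocNat M N P
  inv := assocNatInv M N P
  hom_inv_id := NatTrans.ext (funext fun X => ModuleCat.hom_ext (splitL_hom_ext fun A B C f => by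
    change splitL M N P f ∘ₗ assocInv M N P X ∘ₗ assocHom M N P X =
      splitL M N P f ∘ₗ LinearMap.id
    rw [← LinearMap.comp_assoc, splitL_comp_assocInv', splitR_comp_assocHom, comp_inv_assoc]
    rfl))
  inv_hom_id := NatTrans.ext (funext fun X => ModuleCat.hom_ext (splitR_hom_ext fun A B C f => by
    change splitR M N P f ∘ₗ assocHom M N P X ∘ₗ assocInv M N P X =
      splitR M N P f ∘ₗ LinearMap.id
    rw [← LinearMap.comp_assoc, splitR_comp_assocHom, splitL_comp_assocInv]
    rfl))

variable {M N P}

theorem assocNat_naturality {M' N' P' : FMod c k} (m : M ⟶ M') (n : N ⟶ N') (p : P ⟶ P') :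
    dayMap (dayMap m n) p ≫ assocNat M' N' P' = assocNat M N P ≫ dayMap m (dayMap n p) :=
  NatTrans.ext (funext fun X => ModuleCat.hom_ext (splitR_hom_ext fun A B C f => by
    change splitR M' N' P' f ∘ₗ assocHom M' N' P' X ∘ₗ ((dayMap (dayMap m n) p).app X).hom =
      splitR M' N' P' f ∘ₗ ((dayMap m (dayMap n p)).app X).hom ∘ₗ assocHom M N P X
    rw [← LinearMap.comp_assoc, ← LinearMap.comp_assoc, splitR_comp_assocHom, splitL_comp_dayMap,
      splitR_comp_dayMap, LinearMap.comp_assoc, splitR_comp_assocHom]))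

end Triple
-- Symmetry and associativity as equations without quotients
section Additivity

variable {c : Type} {k : Type u} [Field k]

theorem braid_naturality {M M' N N' : FMod c k} (m : M ⟶ M') (n : N ⟶ N') :
    dayMap m n ≫ braid M' N' = braid M N ≫ dayMap n m :=
  NatTrans.ext (funext fun X => ModuleCat.hom_ext (split_hom_ext fun A B f => by
    change split N' M' f ∘ₗ ((braid M' N').app X).hom ∘ₗ ((dayMap m n).app X).hom =
      split N' M' f ∘ₗ ((dayMap n m).app X).hom ∘ₗ ((braid M N).app X).hom
    rw [← LinearMap.comp_assoc, ← LinearMap.comp_assoc, split_comp_braid, split_comp_dayMap,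
      LinearMap.comp_assoc, LinearMap.comp_assoc, split_comp_dayMap, split_comp_braid,
      ← LinearMap.comp_assoc, ← LinearMap.comp_assoc, TensorProduct.map_comp_comm_eq]))

theorem addSwap_comp_addSwap {A B X : FinFam c} (f : add A B ⟶ X) :
    addSwap A B ≫ addSwap B A ≫ f = f :=
  hom_ext fun i x => by rcases x with x | x <;> rfl

theorem braid_comp_braid (M N : FMod c k) : braid M N ≫ braid N M = 𝟙 (day M N) :=
  NatTrans.ext (funext fun X => ModuleCat.hom_ext (split_hom_ext fun A B f => by
    change split M N f ∘ₗ ((braid N M).app X).hom ∘ₗ ((braid M N).app X).hom =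
      split M N f ∘ₗ LinearMap.id
    rw [← LinearMap.comp_assoc, split_comp_braid, LinearMap.comp_assoc, split_comp_braid,
      addSwap_comp_addSwap, ← LinearMap.comp_assoc, LinearMap.comp_id]
    exact LinearMap.ext fun x => (TensorProduct.comm k _ _).symm_apply_apply _))

theorem dayMap_add_right {M M' N N' : FMod c k} (m : M ⟶ M') (n n' : N ⟶ N') :
    dayMap m (n + n') = dayMap m n + dayMap m n' :=
  NatTrans.ext (funext fun _ => ModuleCat.hom_ext (day_hom_ext fun d =>
    congrArg (· ∘ₗ dayProj M N d) (TensorProduct.map_add_right (m.app (part d.fst)).hom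
      (n.app (part d.snd)).hom (n'.app (part d.snd)).hom)))

/-- Universal property of the cokernel of 1 - τ. -/
theorem isSymmetric_iff {n : c → ℕ} {M : FMod c k} (μ : day M M ⟶ day M (unitMod k n)) :
    IsSymmetric μ ↔ braid M M ≫ μ = μ := by
  constructor
  · rintro ⟨ν, rfl⟩
    have h := cokernel.condition (𝟙 (day M M) - braid M M)
    rw [Preadditive.sub_comp, Category.id_comp, sub_eq_zero] at h
    rw [← Category.assoc, ← h]
  · intro h
    refine ⟨cokernel.desc _ μ ?_, cokernel.π_desc _ _ _⟩
    rw [Preadditive.sub_comp, Category.id_comp, h, sub_self]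

/-- The product of a map with the projection to the second exterior power is zero if and only if
the product with the antisymmetrisation is zero. -/
theorem comp_toExtSq_eq_zero_iff [CharZero k] {L M K : FMod c k} (φ : L ⟶ day M (day K K)) :
    φ ≫ dayMap (𝟙 M) (toExtSq K) = 0 ↔ φ ≫ dayMap (𝟙 M) (𝟙 (day K K) - braid K K) = 0 := by
  have hπ : braid K K ≫ toExtSq K = - toExtSq K := by
    have h := cokernel.condition (𝟙 (day K K) + braid K K)
    rw [Preadditive.add_comp, Category.id_comp] at h
    exact eq_neg_of_add_eq_zero_right h
  constructor
  · intro h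
    -- As τ² = 1, the map 1 - τ vanishes on the image of 1 + τ and so factors through Λ²K.
    have h' : (𝟙 (day K K) + braid K K) ≫ (𝟙 (day K K) - braid K K) = 0 := by
      rw [Preadditive.add_comp, Preadditive.comp_sub, Preadditive.comp_sub, braid_comp_braid]
      simp
    rw [← cokernel.π_desc _ _ h', ← Category.id_comp (𝟙 M), dayMap_comp_comp, ← Category.assoc,
      h, zero_comp]
  · intro h
    -- Since τ becomes -1 in Λ²K, the map 1 - τ becomes multiplication by 2 there, which
    -- characteristic zero allows to cancel.
    have h' : (𝟙 (day K K) - braid K K) ≫ toExtSq K = toExtSq K + toExtSq K := by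
      rw [Preadditive.sub_comp, hπ, Category.id_comp, sub_neg_eq_add]
    have h₂ : φ ≫ dayMap (𝟙 M) (toExtSq K) + φ ≫ dayMap (𝟙 M) (toExtSq K) = 0 := by
      rw [← Preadditive.comp_add, ← dayMap_add_right, ← h', ← Category.id_comp (𝟙 M),
        dayMap_comp_comp, ← Category.assoc, h, zero_comp]
    ext X x
    have h₃ := LinearMap.congr_fun (congrArg (fun f => (f.app X).hom) h₂) x
    change (φ ≫ dayMap (𝟙 M) (toExtSq K)).app X x + (φ ≫ dayMap (𝟙 M) (toExtSq K)).app X x = 0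
      at h₃
    rw [← two_smul k, smul_eq_zero] at h₃
    exact h₃.resolve_left two_ne_zero

variable [Finite c]

/-- Two applications of `μ`. -/
noncomputable def twiceNat {M K : FMod c k} (μ : day M M ⟶ day M K) :
    day M (day M M) ⟶ day M (day K K) :=
  dayMap (𝟙 M) μ ≫ assocNatInv M M K ≫ dayMap μ (𝟙 K) ≫ assocNat M K K

/-- The cyclic permutation of the factors of `M ⊙ (M ⊙ M)`. -/
noncomputable def rotateNat (M : FMod c k) : day M (day M M) ⟶ day M (day M M) :=
  assocNatInv M M M ≫ braid (day M M) M

/-- In this form associativity is an equation between composites and sums of structural natural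
transformations, which an additive symmetric monoidal functor can transport. -/
theorem isAssociative_iff [CharZero k] {n : c → ℕ} {M : FMod c k}
    (μ : day M M ⟶ day M (unitMod k n)) :
    IsAssociative μ ↔ ((𝟙 _ + rotateNat M + rotateNat M ≫ rotateNat M) ≫ twiceNat μ) ≫
      dayMap (𝟙 M) (𝟙 _ - braid (unitMod k n) (unitMod k n)) = 0 := by
  rw [← comp_toExtSq_eq_zero_iff]
  constructor
  · intro h
    exact NatTrans.ext (funext fun X => ModuleCat.hom_ext (h X))
  · intro h X
    exact congrArg (fun f => (f.app X).hom) h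

end Additivity

/-! ### Transport of operations along a strong symmetric monoidal functor -/

section Transport

variable {c c' : Type} {k : Type u} [Field k] [Finite c] [Finite c']

/-- The structure of a strong symmetric monoidal functor (for Day convolution, without units). -/
structure Strong (Φ : FMod c k ⥤ FMod c' k) where
  lax (M N : FMod c k) : day (Φ.obj M) (Φ.obj N) ⟶ Φ.obj (day M N)
  oplax (M N : FMod c k) : Φ.obj (day M N) ⟶ day (Φ.obj M) (Φ.obj N)
  lax_oplax (M N : FMod c k) : lax M N ≫ oplax M N = 𝟙 _
  oplax_lax (M N : FMod c k) : oplax M N ≫ lax M N = 𝟙 _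
  lax_natural {M M' N N' : FMod c k} (m : M ⟶ M') (n : N ⟶ N') :
    dayMap (Φ.map m) (Φ.map n) ≫ lax M' N' = lax M N ≫ Φ.map (dayMap m n)
  lax_braid (M N : FMod c k) : braid _ _ ≫ lax N M = lax M N ≫ Φ.map (braid M N)
  lax_assoc (M N P : FMod c k) :
    dayMap (lax M N) (𝟙 _) ≫ lax (day M N) P ≫ Φ.map (assocNat M N P) =
      assocNat _ _ _ ≫ dayMap (𝟙 _) (lax N P) ≫ lax M (day N P)

/-- The compatibility conditions can be checked on the inverses of the structure maps. -/
noncomputable def Strong.ofOplax {Φ : FMod c k ⥤ FMod c' k}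
    (lax : ∀ M N : FMod c k, day (Φ.obj M) (Φ.obj N) ⟶ Φ.obj (day M N))
    (oplax : ∀ M N : FMod c k, Φ.obj (day M N) ⟶ day (Φ.obj M) (Φ.obj N))
    (lax_oplax : ∀ M N, lax M N ≫ oplax M N = 𝟙 _)
    (oplax_lax : ∀ M N, oplax M N ≫ lax M N = 𝟙 _)
    (natural : ∀ {M M' N N' : FMod c k} (m : M ⟶ M') (n : N ⟶ N'),
      Φ.map (dayMap m n) ≫ oplax M' N' = oplax M N ≫ dayMap (Φ.map m) (Φ.map n))
    (braided : ∀ M N, Φ.map (braid M N) ≫ oplax N M = oplax M N ≫ braid _ _)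
    (assoc : ∀ M N P, Φ.map (assocNat M N P) ≫ oplax M (day N P) ≫ dayMap (𝟙 _) (oplax N P) =
      oplax (day M N) P ≫ dayMap (oplax M N) (𝟙 _) ≫ assocNat _ _ _) : Strong Φ where
  lax := lax
  oplax := oplax
  lax_oplax := lax_oplax
  oplax_lax := oplax_lax
  lax_natural m n := by
    rw [← Category.id_comp (dayMap (Φ.map m) _), ← lax_oplax, Category.assoc, Category.assoc,
      ← reassoc_of% natural m n, oplax_lax, Category.comp_id]
  lax_braid M N := by
    rw [← Category.id_comp (braid (Φ.obj M) _), ← lax_oplax, Category.assoc, Category.assoc,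
      ← reassoc_of% braided M N, oplax_lax, Category.comp_id]
  lax_assoc M N P := by
    have h₁ : dayMap (lax M N) (𝟙 (Φ.obj P)) ≫ dayMap (oplax M N) (𝟙 _) = 𝟙 _ := by
      rw [← dayMap_comp_comp, lax_oplax, Category.comp_id, dayMap_id_id]
    have h₂ : dayMap (𝟙 (Φ.obj M)) (oplax N P) ≫ dayMap (𝟙 _) (lax N P) = 𝟙 _ := by
      rw [← dayMap_comp_comp, oplax_lax, Category.comp_id, dayMap_id_id]
    have h₃ := assoc M N P
    rw [← Category.id_comp (assocNat (Φ.obj M) _ _), ← h₁,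
      ← Category.id_comp (dayMap (oplax M N) (𝟙 (Φ.obj P))), ← lax_oplax]
    simp only [Category.assoc]
    rw [← reassoc_of% h₃, reassoc_of% h₂, oplax_lax, Category.comp_id]

namespace Strong

variable {Φ : FMod c k ⥤ FMod c' k} (S : Strong Φ)

theorem oplax_natural {M M' N N' : FMod c k} (m : M ⟶ M') (n : N ⟶ N') :
    Φ.map (dayMap m n) ≫ S.oplax M' N' = S.oplax M N ≫ dayMap (Φ.map m) (Φ.map n) := by
  rw [← Category.comp_id (dayMap (Φ.map m) (Φ.map n)), ← S.lax_oplax,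
    reassoc_of% S.lax_natural m n, ← Category.assoc (S.oplax M N), S.oplax_lax, Category.id_comp]

theorem oplax_braid (M N : FMod c k) :
    Φ.map (braid M N) ≫ S.oplax N M = S.oplax M N ≫ braid _ _ := by
  rw [← Category.comp_id (braid (Φ.obj M) _), ← S.lax_oplax,
    reassoc_of% S.lax_braid M N, ← Category.assoc (S.oplax M N), S.oplax_lax, Category.id_comp]

theorem dayMap_oplax_lax_left {M N : FMod c k} (P : FMod c' k) :
    dayMap (S.oplax M N) (𝟙 P) ≫ dayMap (S.lax M N) (𝟙 P) = 𝟙 _ := by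
  rw [← dayMap_comp_comp, S.oplax_lax, Category.comp_id, dayMap_id_id]

theorem dayMap_lax_oplax_right {M N : FMod c k} (P : FMod c' k) :
    dayMap (𝟙 P) (S.lax M N) ≫ dayMap (𝟙 P) (S.oplax M N) = 𝟙 _ := by
  rw [← dayMap_comp_comp, S.lax_oplax, Category.comp_id, dayMap_id_id]

theorem oplax_assoc (M N P : FMod c k) :
    Φ.map (assocNat M N P) ≫ S.oplax M (day N P) ≫ dayMap (𝟙 _) (S.oplax N P) =
      S.oplax (day M N) P ≫ dayMap (S.oplax M N) (𝟙 _) ≫ assocNat _ _ _ := by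
  have h := S.lax_assoc M N P
  rw [← Category.comp_id (assocNat (Φ.obj M) _ _), ← S.dayMap_lax_oplax_right,
    ← Category.id_comp (dayMap (𝟙 (Φ.obj M)) (S.oplax N P)), ← S.lax_oplax M (day N P)]
  simp only [Category.assoc]
  rw [← reassoc_of% h, reassoc_of% S.dayMap_oplax_lax_left]
  simp only [reassoc_of% S.oplax_lax]

theorem assocNat_comp_inv (M N P : FMod c k) : assocNat M N P ≫ assocNatInv M N P = 𝟙 _ :=
  (assocIso M N P).hom_inv_id

theorem assocNatInv_comp (M N P : FMod c k) : assocNatInv M N P ≫ assocNat M N P = 𝟙 _ :=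
  (assocIso M N P).inv_hom_id

theorem oplax_assocInv (M N P : FMod c k) :
    S.oplax M (day N P) ≫ dayMap (𝟙 _) (S.oplax N P) ≫ assocNatInv _ _ _ =
      Φ.map (assocNatInv M N P) ≫ S.oplax (day M N) P ≫ dayMap (S.oplax M N) (𝟙 _) := by
  have h := S.oplax_assoc M N P
  rw [← Category.comp_id (dayMap (S.oplax M N) _), ← assocNat_comp_inv, ← reassoc_of% h,
    ← Category.assoc (Φ.map _), ← Φ.map_comp, assocNatInv_comp, Φ.map_id, Category.id_comp]

theorem lax_assocInv (M N P : FMod c k) :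
    assocNatInv _ _ _ ≫ dayMap (S.lax M N) (𝟙 _) ≫ S.lax (day M N) P =
      dayMap (𝟙 _) (S.lax N P) ≫ S.lax M (day N P) ≫ Φ.map (assocNatInv M N P) := by
  have h := S.lax_assoc M N P
  rw [← Category.comp_id (S.lax (day M N) P), ← Φ.map_id (day (day M N) P),
    ← assocNat_comp_inv M N P, Φ.map_comp, reassoc_of% h, reassoc_of% assocNatInv_comp]

theorem assocNatInv_naturality {M N P M' N' P' : FMod c k} (m : M ⟶ M') (n : N ⟶ N')
    (p : P ⟶ P') :
    dayMap m (dayMap n p) ≫ assocNatInv M' N' P' = assocNatInv M N P ≫ dayMap (dayMap m n) p := by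
  rw [← Category.comp_id (dayMap (dayMap m n) p), ← assocNat_comp_inv,
    reassoc_of% assocNat_naturality m n p, reassoc_of% assocNatInv_comp]

/-- The operation on `Φ(M)` induced by `μ : M ⊙ M → M ⊙ K` and `π : Φ(K) → K'`. -/
noncomputable def mu {M K : FMod c k} {K' : FMod c' k} (μ : day M M ⟶ day M K)
    (π : Φ.obj K ⟶ K') : day (Φ.obj M) (Φ.obj M) ⟶ day (Φ.obj M) K' :=
  S.lax M M ≫ Φ.map μ ≫ S.oplax M K ≫ dayMap (𝟙 _) π

variable {M K : FMod c k} {K' : FMod c' k} {μ : day M M ⟶ day M K} (π : Φ.obj K ⟶ K')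

theorem braid_comp_mu (h : braid M M ≫ μ = μ) : braid _ _ ≫ S.mu μ π = S.mu μ π := by
  rw [mu, reassoc_of% S.lax_braid M M, ← Category.assoc (Φ.map (braid M M)), ← Φ.map_comp, h]

/-- Naturality of the structure maps in the module; this makes the construction functorial on
operads. -/
theorem mu_comp {M₁ M₂ : FMod c k} {μ₁ : day M₁ M₁ ⟶ day M₁ K} {μ₂ : day M₂ M₂ ⟶ day M₂ K}
    (f : M₁ ⟶ M₂) (h : μ₁ ≫ dayMap f (𝟙 K) = dayMap f f ≫ μ₂) :
    S.mu μ₁ π ≫ dayMap (Φ.map f) (𝟙 _) = dayMap (Φ.map f) (Φ.map f) ≫ S.mu μ₂ π := by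
  have h' := S.oplax_natural f (𝟙 K)
  have h'' : dayMap (𝟙 _) π ≫ dayMap (Φ.map f) (𝟙 K') =
      dayMap (Φ.map f) (Φ.map (𝟙 K)) ≫ dayMap (𝟙 _) π := by
    rw [← dayMap_comp_comp, ← dayMap_comp_comp, Φ.map_id]
    simp
  simp only [mu, Category.assoc]
  rw [h'', ← reassoc_of% h', reassoc_of% S.lax_natural f f, ← Category.assoc (Φ.map (dayMap f f)),
    ← Φ.map_comp, ← h, Φ.map_comp, Category.assoc]

/-- The first application of μ ends with the inverse structure map and the second one begins with
the structure map. Once the associativity isomorphism has been moved past them, these two cancel,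
and only the structure maps at the two ends remain. -/
theorem twiceNat_mu :
    twiceNat (S.mu μ π) = dayMap (𝟙 _) (S.lax M M) ≫ S.lax M (day M M) ≫ Φ.map (twiceNat μ) ≫
      S.oplax M (day K K) ≫ dayMap (𝟙 _) (S.oplax K K) ≫ dayMap (𝟙 _) (dayMap π π) := by
  -- The application of μ to the last two factors is rewritten as the image under Φ of an operation
  -- on the triple product.
  have h₁ : dayMap (𝟙 (Φ.obj M)) (S.mu μ π) = dayMap (𝟙 _) (S.lax M M) ≫ S.lax M (day M M) ≫
      Φ.map (dayMap (𝟙 _) μ) ≫ S.oplax M (day M K) ≫ dayMap (𝟙 _) (S.oplax M K) ≫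
        dayMap (𝟙 _) (dayMap (𝟙 _) π) := by
    rw [reassoc_of% S.oplax_natural (𝟙 M) μ, reassoc_of% S.lax_oplax, Φ.map_id,
      ← dayMap_comp_comp, ← dayMap_comp_comp, ← dayMap_comp_comp, mu]
    simp
  have h₂ : dayMap (𝟙 _) π ≫ dayMap (S.mu μ π) (𝟙 K') =
      dayMap (S.lax M M) (𝟙 _) ≫ dayMap (Φ.map μ) (Φ.map (𝟙 K)) ≫
        dayMap (S.oplax M K) (𝟙 _) ≫ dayMap (dayMap (𝟙 _) π) π := by
    rw [← dayMap_comp_comp, ← dayMap_comp_comp, ← dayMap_comp_comp, ← dayMap_comp_comp, mu,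
      Φ.map_id]
    simp
  have h₃ := S.oplax_natural μ (𝟙 K)
  rw [twiceNat, h₁, twiceNat]
  simp only [Category.assoc, Φ.map_comp]
  rw [reassoc_of% assocNatInv_naturality, dayMap_id_id, reassoc_of% h₂, assocNat_naturality,
    reassoc_of% S.oplax_assocInv, reassoc_of% S.dayMap_oplax_lax_left, ← reassoc_of% h₃,
    ← reassoc_of% S.oplax_assoc]

theorem rotateNat_comp_lax :
    rotateNat (Φ.obj M) ≫ dayMap (𝟙 _) (S.lax M M) ≫ S.lax M (day M M) =
      dayMap (𝟙 _) (S.lax M M) ≫ S.lax M (day M M) ≫ Φ.map (rotateNat M) := by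
  rw [rotateNat, rotateNat, Φ.map_comp, Category.assoc, ← reassoc_of% braid_naturality,
    S.lax_braid, reassoc_of% S.lax_assocInv]

/-- The symmetry commutes with π ⊙ π by naturality and with the structure maps because Φ is
symmetric; additivity gives the same for 1 - τ. No property of π is involved. -/
theorem oplax_comp_antisymm [Φ.Additive] :
    (S.oplax M (day K K) ≫ dayMap (𝟙 _) (S.oplax K K) ≫ dayMap (𝟙 _) (dayMap π π)) ≫
      dayMap (𝟙 _) (𝟙 _ - braid K' K') = Φ.map (dayMap (𝟙 M) (𝟙 _ - braid K K)) ≫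
    S.oplax M (day K K) ≫ dayMap (𝟙 _) (S.oplax K K) ≫ dayMap (𝟙 _) (dayMap π π) := by
  have h₁ : dayMap π π ≫ (𝟙 _ - braid K' K') = (𝟙 _ - braid _ _) ≫ dayMap π π := by
    rw [Preadditive.comp_sub, Preadditive.sub_comp, braid_naturality, Category.comp_id,
      Category.id_comp]
  have h₂ : S.oplax K K ≫ (𝟙 _ - braid _ _) = Φ.map (𝟙 _ - braid K K) ≫ S.oplax K K := by
    rw [Preadditive.comp_sub, Φ.map_sub, Preadditive.sub_comp, S.oplax_braid, Category.comp_id,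
      Φ.map_id, Category.id_comp]
  have h₃ := S.oplax_natural (𝟙 M) (𝟙 _ - braid K K)
  have comp_right : ∀ {A B C : FMod c' k} (a : A ⟶ B) (b : B ⟶ C),
      dayMap (𝟙 (Φ.obj M)) a ≫ dayMap (𝟙 (Φ.obj M)) b = dayMap (𝟙 (Φ.obj M)) (a ≫ b) :=
    fun a b => by rw [← dayMap_comp_comp, Category.comp_id]
  rw [Φ.map_id] at h₃
  rw [reassoc_of% h₃]
  simp only [Category.assoc, comp_right]
  rw [h₁, ← Category.assoc (S.oplax K K), h₂, Category.assoc]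

/-- The cyclic sum enters Φ through the structure maps on the left and 1 - τ through those on the
right. What stands in the middle is Φ applied to the associativity relation of μ. -/
theorem associative_mu [Φ.Additive]
    (h : ((𝟙 _ + rotateNat M + rotateNat M ≫ rotateNat M) ≫ twiceNat μ) ≫
      dayMap (𝟙 M) (𝟙 _ - braid K K) = 0) :
    ((𝟙 _ + rotateNat _ + rotateNat _ ≫ rotateNat _) ≫ twiceNat (S.mu μ π)) ≫
      dayMap (𝟙 (Φ.obj M)) (𝟙 _ - braid K' K') = 0 := by
  have h₁ : (𝟙 _ + rotateNat (Φ.obj M) + rotateNat _ ≫ rotateNat _) ≫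
      dayMap (𝟙 _) (S.lax M M) ≫ S.lax M (day M M) = dayMap (𝟙 _) (S.lax M M) ≫
        S.lax M (day M M) ≫ Φ.map (𝟙 _ + rotateNat M + rotateNat M ≫ rotateNat M) := by
    simp only [Preadditive.add_comp, Category.id_comp, Category.assoc, Φ.map_add, Φ.map_id,
      Φ.map_comp, Preadditive.comp_add, Category.comp_id]
    rw [S.rotateNat_comp_lax, reassoc_of% S.rotateNat_comp_lax]
  have h₂ := congrArg Φ.map h
  rw [Φ.map_zero] at h₂
  rw [twiceNat_mu, Category.assoc]
  simp only [Category.assoc]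
  have h₃ := S.oplax_comp_antisymm (M := M) π
  simp only [Category.assoc] at h₃
  rw [h₃, reassoc_of% h₁, ← Category.assoc (Φ.map (twiceNat μ)), ← Φ.map_comp,
    ← Category.assoc (Φ.map (_ + _)), ← Φ.map_comp, ← Category.assoc (_ + _), h₂]
  simp

/-- The unit composite of the transported structure depends on μ and η only through the unit
composite of the original one, to which the relabelling hypothesis applies. -/
theorem dayMap_comp_mu {ι : K' ⟶ Φ.obj K} (η : K ⟶ M) :
    dayMap (𝟙 _) (ι ≫ Φ.map η) ≫ S.mu μ π =
      dayMap (𝟙 _) ι ≫ S.lax M K ≫ Φ.map (dayMap (𝟙 M) η ≫ μ) ≫ S.oplax M K ≫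
        dayMap (𝟙 _) π := by
  have h := S.lax_natural (𝟙 M) η
  rw [Φ.map_comp, mu, Category.assoc, ← reassoc_of% h, Φ.map_id, ← Category.assoc (dayMap _ ι),
    ← dayMap_comp_comp, Category.comp_id]

end Strong

end Transport
-- Restriction along the disjoint union is strong symmetric monoidal
section StarStrong

variable {k : Type u} [Field k]

/-- The disjoint union functor preserves binary sums. -/
def distr (A B : FB2) : add (amalg.obj A) (amalg.obj B) ⟶ amalg.obj (add A B) :=
  fun _ => (Equiv.sigmaSumDistrib A.carrier B.carrier).symm

theorem addSwap_comp_distr (A B : FB2) :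
    addSwap (amalg.obj A) (amalg.obj B) ≫ distr B A = distr A B ≫ amalg.map (addSwap A B) :=
  hom_ext fun i x => by rcases x with ⟨s, x⟩ | ⟨s, x⟩ <;> rfl

theorem addAssoc_comp_distr (A B C : FB2) :
    addAssoc (amalg.obj A) (amalg.obj B) (amalg.obj C) ≫ addMap (𝟙 _) (distr B C) ≫
        distr A (add B C) =
      addMap (distr A B) (𝟙 _) ≫ distr (add A B) C ≫ amalg.map (addAssoc A B C) :=
  hom_ext fun i x => by rcases x with (⟨s, x⟩ | ⟨s, x⟩) | ⟨s, x⟩ <;> rfl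

/-- This reduces the symmetric monoidal axioms of `starOplax` to the coherence of `distr`, that is,
of the disjoint union functor itself. The inverse structure map is used since it is the one whose
projections are indexed by bijections of pairs. -/
theorem split_comp_starOplax (M N : FMod Unit k) {A B X : FB2} (f : add A B ⟶ X) :
    split (amalgStar.obj M) (amalgStar.obj N) f ∘ₗ ((starOplax M N).app X).hom =
      split M N (distr A B ≫ amalg.map f) := by
  let d := Dec.ofSum f
  rw [← map_comp_dayProj M N (distr A B ≫ amalg.map f) d.sum
    (inv (sumPart d.fst d.sum.fst fun _ _ => Iff.rfl) ≫ amalg.map (leftIso f))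
    (inv (sumPart d.snd d.sum.snd fun _ _ => Iff.rfl) ≫ amalg.map (rightIso f))
    (fun i x => congrArg (Sigma.mk x.1.1) (apply_leftIso f x.1.1 ⟨x.1.2, x.2⟩))
    (fun i x => congrArg (Sigma.mk x.1.1) (apply_rightIso f x.1.1 ⟨x.1.2, x.2⟩)),
    M.map_comp, N.map_comp, ModuleCat.hom_comp, ModuleCat.hom_comp, TensorProduct.map_comp]
  rfl

theorem starLax_comp_starOplax_app (M N : FMod Unit k) (X : FB2) :
    ((starOplax M N).app X).hom ∘ₗ ((starLax M N).app X).hom = LinearMap.id := by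
  refine day_hom_ext fun d => ?_
  change (TensorProduct.map (M.map (inv (sumPart d.fst d.sum.fst fun _ _ => Iff.rfl))).hom
      (N.map (inv (sumPart d.snd d.sum.snd fun _ _ => Iff.rfl))).hom ∘ₗ
    TensorProduct.map (M.map (sumPart d.fst d.sum.fst fun _ _ => Iff.rfl)).hom
      (N.map (sumPart d.snd d.sum.snd fun _ _ => Iff.rfl)).hom) ∘ₗ
    dayProj (amalgStar.obj M) (amalgStar.obj N) d = dayProj _ _ d
  rw [← TensorProduct.map_comp, map_map_inv, map_map_inv, TensorProduct.map_id]
  rfl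

theorem starOplax_comp_starLax_app (M N : FMod Unit k) (X : FB2) :
    ((starLax M N).app X).hom ∘ₗ ((starOplax M N).app X).hom = LinearMap.id := by
  refine day_hom_ext (M := M) (N := N) fun d => ?_
  change (TensorProduct.map (M.map (sumPart d.split.fst d.fst fun _ _ => Iff.rfl)).hom
      (N.map (sumPart d.split.snd d.snd fun _ _ => Iff.rfl)).hom ∘ₗ
    TensorProduct.map (M.map (inv (sumPart d.split.fst d.fst fun _ _ => Iff.rfl))).hom
      (N.map (inv (sumPart d.split.snd d.snd fun _ _ => Iff.rfl))).hom) ∘ₗ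
    dayProj M N d = dayProj M N d
  rw [← TensorProduct.map_comp, map_inv_map, map_inv_map, TensorProduct.map_id]
  rfl

theorem starOplax_naturality {M M' N N' : FMod Unit k} (m : M ⟶ M') (n : N ⟶ N') :
    amalgStar.map (dayMap m n) ≫ starOplax M' N' =
      starOplax M N ≫ dayMap (amalgStar.map m) (amalgStar.map n) :=
  NatTrans.ext (funext fun X => ModuleCat.hom_ext (split_hom_ext fun A B f =>
    ((congrArg (· ∘ₗ ((dayMap m n).app (amalg.obj X)).hom) (split_comp_starOplax M' N' f)).trans
      (split_comp_dayMap m n (distr A B ≫ amalg.map f))).trans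
    ((congrArg (· ∘ₗ ((starOplax M N).app X).hom)
      (split_comp_dayMap (amalgStar.map m) (amalgStar.map n) f)).trans
      (congrArg (TensorProduct.map (m.app (amalg.obj A)).hom (n.app (amalg.obj B)).hom ∘ₗ ·)
        (split_comp_starOplax M N f))).symm))

theorem starOplax_braid (M N : FMod Unit k) :
    amalgStar.map (braid M N) ≫ starOplax N M = starOplax M N ≫ braid _ _ :=
  NatTrans.ext (funext fun X => ModuleCat.hom_ext (split_hom_ext fun A B f => by
    have h : split M N (addSwap _ _ ≫ distr A B ≫ amalg.map f) =
        split M N (distr B A ≫ amalg.map (addSwap B A ≫ f)) := by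
      rw [amalg.map_comp, ← Category.assoc, ← Category.assoc, addSwap_comp_distr]
    exact ((congrArg (· ∘ₗ ((braid M N).app (amalg.obj X)).hom)
        (split_comp_starOplax N M f)).trans
      (split_comp_braid M N (distr A B ≫ amalg.map f))).trans
      ((congrArg ((TensorProduct.comm k _ _).toLinearMap ∘ₗ ·) h).trans
      ((congrArg (· ∘ₗ ((starOplax M N).app X).hom)
        (split_comp_braid (amalgStar.obj M) (amalgStar.obj N) f)).trans
        (congrArg ((TensorProduct.comm k _ _).toLinearMap ∘ₗ ·)
          (split_comp_starOplax M N (addSwap B A ≫ f)))).symm)))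

theorem splitR_comp_dayMap_snd {c : Type} {M N P Z : FMod c k} (φ : Z ⟶ day N P)
    {A B C X : FinFam c} (f : add A (add B C) ⟶ X) :
    splitR M N P f ∘ₗ ((dayMap (𝟙 M) φ).app X).hom =
      TensorProduct.map LinearMap.id (split N P (𝟙 (add B C)) ∘ₗ (φ.app (add B C)).hom) ∘ₗ
        split M Z f := by
  rw [splitR, LinearMap.comp_assoc, split_comp_dayMap, tmap_comp]
  rfl

theorem splitL_comp_dayMap_fst {c : Type} {M N P Z : FMod c k} (φ : Z ⟶ day M N)
    {A B C X : FinFam c} (f : add (add A B) C ⟶ X) :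
    splitL M N P f ∘ₗ ((dayMap φ (𝟙 P)).app X).hom =
      (TensorProduct.assoc k _ _ _).toLinearMap ∘ₗ
        TensorProduct.map (split M N (𝟙 (add A B)) ∘ₗ (φ.app (add A B)).hom) LinearMap.id ∘ₗ
          split Z P f := by
  rw [splitL, LinearMap.comp_assoc, LinearMap.comp_assoc, split_comp_dayMap, tmap_comp]
  rfl

theorem splitR_comp_starOplax (M N P : FMod Unit k) {A B C X : FB2}
    (f : add A (add B C) ⟶ X) :
    splitR (amalgStar.obj M) (amalgStar.obj N) (amalgStar.obj P) f ∘ₗ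
      ((dayMap (𝟙 (amalgStar.obj M)) (starOplax N P)).app X).hom ∘ₗ
        ((starOplax M (day N P)).app X).hom =
      splitR M N P (addMap (𝟙 _) (distr B C) ≫ distr A (add B C) ≫ amalg.map f) := by
  rw [← LinearMap.comp_assoc, splitR_comp_dayMap_snd, split_comp_starOplax, amalg.map_id,
    Category.comp_id, LinearMap.comp_assoc, split_comp_starOplax]
  exact split_id_comp_split_snd _ _

theorem splitL_comp_starOplax (M N P : FMod Unit k) {A B C X : FB2}
    (f : add (add A B) C ⟶ X) :
    splitL (amalgStar.obj M) (amalgStar.obj N) (amalgStar.obj P) f ∘ₗ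
      ((dayMap (starOplax M N) (𝟙 (amalgStar.obj P))).app X).hom ∘ₗ
        ((starOplax (day M N) P).app X).hom =
      splitL M N P (addMap (distr A B) (𝟙 _) ≫ distr (add A B) C ≫ amalg.map f) := by
  rw [← LinearMap.comp_assoc, splitL_comp_dayMap_fst, split_comp_starOplax, amalg.map_id,
    Category.comp_id, LinearMap.comp_assoc, LinearMap.comp_assoc, split_comp_starOplax]
  exact split_id_comp_split_fst _ _

/-- After projecting to a triple summand, both sides are a `splitL`, and the two bijections agree by
`addAssoc_comp_distr`. -/
theorem starOplax_assoc (M N P : FMod Unit k) :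
    amalgStar.map (assocNat M N P) ≫ starOplax M (day N P) ≫ dayMap (𝟙 _) (starOplax N P) =
      starOplax (day M N) P ≫ dayMap (starOplax M N) (𝟙 _) ≫ assocNat _ _ _ :=
  NatTrans.ext (funext fun X => ModuleCat.hom_ext (splitR_hom_ext fun A B C f => by
    have h : splitL M N P (addAssoc _ _ _ ≫ addMap (𝟙 _) (distr B C) ≫ distr A (add B C) ≫
        amalg.map f) = splitL M N P (addMap (distr A B) (𝟙 _) ≫ distr (add A B) C ≫
          amalg.map (addAssoc A B C ≫ f)) := by
      have h' := congrArg (· ≫ amalg.map f) (addAssoc_comp_distr A B C)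
      simp only [Category.assoc] at h'
      rw [amalg.map_comp, h']
    exact ((congrArg (· ∘ₗ assocHom M N P (amalg.obj X))
      (splitR_comp_starOplax M N P f)).trans (splitR_comp_assocHom _)).trans (h.trans
      ((congrArg (· ∘ₗ ((dayMap (starOplax M N) (𝟙 (amalgStar.obj P))).app X).hom ∘ₗ
        ((starOplax (day M N) P).app X).hom) (splitR_comp_assocHom f)).trans
        (splitL_comp_starOplax M N P (addAssoc A B C ≫ f))).symm)))

/-- Restriction along the disjoint union is strong symmetric monoidal. -/
noncomputable def starStrong : Strong (amalgStar (k := k)) :=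
  Strong.ofOplax starLax starOplax
    (fun M N => NatTrans.ext (funext fun X =>
      ModuleCat.hom_ext (starLax_comp_starOplax_app M N X)))
    (fun M N => NatTrans.ext (funext fun X =>
      ModuleCat.hom_ext (starOplax_comp_starLax_app M N X)))
    starOplax_naturality starOplax_braid starOplax_assoc

instance amalgStar_additive : (amalgStar (k := k)).Additive where
  map_add := rfl

end StarStrong
-- Projections of `amalgPush` along bijections
section SideSplits

variable {k : Type u} [Field k]

/-- A bijection `A₁ ⨿ A₂ → X` determines a decomposition of `X`. -/
abbrev Dec.ofSide {A : FB2} {X : FB} (g : amalg.obj A ⟶ X) : Dec X where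
  fst _ := {x | ((g ()).symm x).1 = Side.input}
  snd _ := {x | ((g ()).symm x).1 = Side.output}
  compl _ x := by
    simp only [Set.mem_ofPred_eq]
    cases ((g ()).symm x).1 <;> simp

theorem Dec.mem_ofSide {A : FB2} {X : FB} (g : amalg.obj A ⟶ X) (s : Side) (x : X.carrier ()) :
    x ∈ (Dec.ofSide g).side s ↔ ((g ()).symm x).1 = s := by
  cases s <;> exact Iff.rfl

/-- The bijection from the pair given by `Dec.ofSide g` to `A`. -/
def sideIso {A : FB2} {X : FB} (g : amalg.obj A ⟶ X) : pair (Dec.ofSide g) ⟶ A :=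
  fun s => ((g ()).symm.subtypeEquiv (q := fun y => y.1 = s) (Dec.mem_ofSide g s)).trans
    (Equiv.sigmaSubtype s)

theorem apply_sideIso {A : FB2} {X : FB} (g : amalg.obj A ⟶ X) (s : Side)
    (x : (pair (Dec.ofSide g)).carrier s) : g () ⟨s, sideIso g s x⟩ = x.1 := by
  have h := congrArg Subtype.val ((sideIso g s).symm_apply_apply x)
  exact h

/-- The bijection `X₁ ⨿ X₂ → X` given by a decomposition. -/
noncomputable def Dec.sideGlue {X : FB} (e : Dec X) : amalg.obj (pair e) ⟶ X :=
  fun _ => Equiv.ofBijective (fun p => p.2.1) ⟨by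
    rintro ⟨s, x⟩ ⟨s', x'⟩ h
    change x.1 = x'.1 at h
    obtain rfl := e.side_unique x.2 (h ▸ x'.2)
    exact congrArg (Sigma.mk s) (Subtype.ext h), fun x => by
    obtain ⟨s, h⟩ := e.exists_side x
    exact ⟨⟨s, x, h⟩, rfl⟩⟩

theorem Dec.eq_ofSide {A : FB2} {X : FB} (g : amalg.obj A ⟶ X) (e : Dec X) (a : pair e ⟶ A)
    (h : ∀ s x, g () ⟨s, a s x⟩ = x.1) : e = Dec.ofSide g := by
  have h' : ∀ s x, x ∈ e.side s → x ∈ (Dec.ofSide g).side s := fun s x hx => by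
    rw [Dec.mem_ofSide, (Equiv.symm_apply_eq (g ())).2 (h s ⟨x, hx⟩).symm]
  refine Dec.ext ?_ ?_ <;> funext _ <;> ext x
  · refine ⟨h' .input x, fun hx => ?_⟩
    obtain ⟨s, hs⟩ := e.exists_side x
    obtain rfl := (Dec.ofSide g).side_unique (s := .input) hx (h' s x hs)
    exact hs
  · refine ⟨h' .output x, fun hx => ?_⟩
    obtain ⟨s, hs⟩ := e.exists_side x
    obtain rfl := (Dec.ofSide g).side_unique (s := .output) hx (h' s x hs)
    exact hs

/-- The projection `(amalgPush M)(X) → M(A)` given by a bijection `A₁ ⨿ A₂ → X`. -/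
noncomputable def sideSplit (M : FMod Side k) {A : FB2} {X : FB} (g : amalg.obj A ⟶ X) :
    (amalgPush.obj M).obj X →ₗ[k] M.obj A :=
  (M.map (sideIso g)).hom ∘ₗ sideProj M (Dec.ofSide g)

/-- The analogue of `map_comp_dayProj`: the colouring `e` and the bijection `a` are both determined
by `g`. -/
theorem map_comp_sideProj (M : FMod Side k) {A : FB2} {X : FB} (g : amalg.obj A ⟶ X) (e : Dec X)
    (a : pair e ⟶ A) (h : ∀ s x, g () ⟨s, a s x⟩ = x.1) :
    (M.map a).hom ∘ₗ sideProj M e = sideSplit M g := by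
  obtain rfl := Dec.eq_ofSide g e a h
  have h' : a = sideIso g := hom_ext fun s x => by
    have := (g ()).injective ((h s x).trans (apply_sideIso g s x).symm)
    exact eq_of_heq (Sigma.mk.inj this).2
  rw [h', sideSplit]
  rfl

theorem sideProj_eq_sideSplit (M : FMod Side k) {X : FB} (e : Dec X) :
    sideProj M e = sideSplit M e.sideGlue := by
  rw [← map_comp_sideProj M e.sideGlue e (𝟙 _) (fun _ _ => rfl), map_id_hom]
  rfl

theorem sideSplit_comp_map (M : FMod Side k) {A : FB2} {X Y : FB} (g : amalg.obj A ⟶ Y)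
    (h : X ⟶ Y) :
    sideSplit M g ∘ₗ ((amalgPush.obj M).map h).hom = sideSplit M (g ≫ inv h) := by
  rw [← map_comp_sideProj M (g ≫ inv h) ((Dec.ofSide g).pull h)
    (pairRestr h (Dec.ofSide g) ≫ sideIso g), M.map_comp]
  · rfl
  · intro s x
    exact (congrArg (inv h ()) (apply_sideIso g s _)).trans ((h ()).symm_apply_apply _)

theorem map_comp_sideSplit (M : FMod Side k) {A B : FB2} {X : FB} (g : amalg.obj A ⟶ X)
    (a : A ⟶ B) :
    (M.map a).hom ∘ₗ sideSplit M g = sideSplit M (amalg.map (inv a) ≫ g) := by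
  rw [← map_comp_sideProj M (amalg.map (inv a) ≫ g) (Dec.ofSide g) (sideIso g ≫ a), M.map_comp]
  · rfl
  · intro s x
    refine Eq.trans ?_ (apply_sideIso g s x)
    exact congrArg (fun y => g () ⟨s, y⟩) ((a s).symm_apply_apply _)

theorem sideSplit_comp_app {M N : FMod Side k} (φ : M ⟶ N) {A : FB2} {X : FB}
    (g : amalg.obj A ⟶ X) :
    sideSplit N g ∘ₗ ((amalgPush.map φ).app X).hom = (φ.app A).hom ∘ₗ sideSplit M g :=
  congrArg (· ∘ₗ sideProj M (Dec.ofSide g))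
    (congrArg ModuleCat.Hom.hom (φ.naturality (sideIso g))).symm

theorem sideSplit_hom_ext {M : FMod Side k} {X : FB} {V : Type u} [AddCommGroup V] [Module k V]
    {a b : V →ₗ[k] (amalgPush.obj M).obj X}
    (h : ∀ (A : FB2) (g : amalg.obj A ⟶ X), sideSplit M g ∘ₗ a = sideSplit M g ∘ₗ b) : a = b :=
  side_hom_ext (D := M) fun e => by
    rw [sideProj_eq_sideSplit]
    exact h _ e.sideGlue

theorem sideProj_comp_sideIncl (M : FMod Side k) {X : FB} (e : Dec X) :
    sideProj M e ∘ₗ sideIncl M e = LinearMap.id :=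
  LinearMap.proj_comp_single_same _ _ _

theorem sideProj_comp_sideIncl_ne (M : FMod Side k) {X : FB} {d e : Dec X} (h : d ≠ e) :
    sideProj M d ∘ₗ sideIncl M e = 0 :=
  LinearMap.proj_comp_single_ne _ _ _ _ h

theorem sum_sideIncl_comp_sideProj (M : FMod Side k) (X : FB) :
    ∑ e : Dec X, sideIncl M e ∘ₗ sideProj M e = LinearMap.id := by
  refine side_hom_ext fun d => ?_
  rw [comp_sum_linear]
  refine (Finset.sum_eq_single d (fun e _ h => ?_) (by simp)).trans ?_
  · rw [← LinearMap.comp_assoc, sideProj_comp_sideIncl_ne M h.symm, LinearMap.zero_comp]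
  · rw [← LinearMap.comp_assoc, sideProj_comp_sideIncl, LinearMap.id_comp, LinearMap.comp_id]

/-- Tensoring the two finite decompositions of the identity gives one of the tensor product. -/
theorem tmap_sideProj_hom_ext {M N : FMod Side k} {X Y : FB} {V : Type u} [AddCommGroup V]
    [Module k V] {a b : V →ₗ[k] (amalgPush.obj M).obj X ⊗[k] (amalgPush.obj N).obj Y}
    (h : ∀ (p : Dec X) (q : Dec Y),
      TensorProduct.map (sideProj M p) (sideProj N q) ∘ₗ a =
        TensorProduct.map (sideProj M p) (sideProj N q) ∘ₗ b) : a = b := by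
  have h₁ : ∀ u : V →ₗ[k] (pushObj M).obj X ⊗[k] (pushObj N).obj Y, u =
      ∑ p : Dec X, ∑ q : Dec Y, TensorProduct.map (sideIncl M p) (sideIncl N q) ∘ₗ
        TensorProduct.map (sideProj M p) (sideProj N q) ∘ₗ u := fun u => by
    simp only [tmap_comp, ← sum_comp_linear]
    have h₂ := congrArg₂ (TensorProduct.map (R := k)) (sum_sideIncl_comp_sideProj M X)
      (sum_sideIncl_comp_sideProj N Y)
    rw [TensorProduct.map_id] at h₂
    simp only [← TensorProduct.mapBilinear_apply, map_sum, LinearMap.sum_apply] at h₂ ⊢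
    rw [Finset.sum_comm, h₂, LinearMap.id_comp]
  refine (h₁ a).trans ((Finset.sum_congr rfl fun p _ => Finset.sum_congr rfl fun q _ =>
    congrArg (TensorProduct.map (sideIncl M p) (sideIncl N q) ∘ₗ ·) (h p q)).trans (h₁ b).symm)

/-- The projection `(amalgPush M ⊙ amalgPush N)(X) → M(A) ⊗ N(B)` given by a bijection
`(A₁ ⨿ A₂) ⨿ (B₁ ⨿ B₂) → X`. -/
noncomputable def pushSplit (M N : FMod Side k) {A B : FB2} {X : FB}
    (g : add (amalg.obj A) (amalg.obj B) ⟶ X) :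
    (day (amalgPush.obj M) (amalgPush.obj N)).obj X →ₗ[k] M.obj A ⊗[k] N.obj B :=
  TensorProduct.map (sideSplit M (𝟙 (amalg.obj A))) (sideSplit N (𝟙 (amalg.obj B))) ∘ₗ
    split (amalgPush.obj M) (amalgPush.obj N) g

theorem tmap_sideSplit_comp_split (M N : FMod Side k) {A B : FB2} {S T X : FB}
    (f : add S T ⟶ X) (g : amalg.obj A ⟶ S) (g' : amalg.obj B ⟶ T) :
    TensorProduct.map (sideSplit M g) (sideSplit N g') ∘ₗ
      split (amalgPush.obj M) (amalgPush.obj N) f = pushSplit M N (addMap g g' ≫ f) := by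
  have h := map_comp_split (amalgPush.obj M) (amalgPush.obj N) f (inv g) (inv g')
  rw [inv_inv, inv_inv] at h
  rw [pushSplit, ← h, tmap_comp, sideSplit_comp_map, sideSplit_comp_map, Category.id_comp,
    Category.id_comp, inv_inv, inv_inv]

theorem pushSplit_hom_ext {M N : FMod Side k} {X : FB} {V : Type u} [AddCommGroup V] [Module k V]
    {a b : V →ₗ[k] (day (amalgPush.obj M) (amalgPush.obj N)).obj X}
    (h : ∀ (A B : FB2) (g : add (amalg.obj A) (amalg.obj B) ⟶ X),
      pushSplit M N g ∘ₗ a = pushSplit M N g ∘ₗ b) : a = b := by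
  refine day_hom_ext fun d => tmap_sideProj_hom_ext fun p q => ?_
  have h' := h _ _ (addMap p.sideGlue q.sideGlue ≫ d.glue)
  rw [← tmap_sideSplit_comp_split, ← sideProj_eq_sideSplit, ← sideProj_eq_sideSplit,
    ← dayProj_eq_split] at h'
  exact h'

/-- A colouring `e` and a splitting of its colour classes give a splitting `e.join d` of `X` whose
pieces are coloured by `e`. The structure map matches these two descriptions of a summand. -/
theorem split_sideProj_pushLax (M N : FMod Side k) {A B : FB2} {X : FB} (e : Dec X)
    (f : add A B ⟶ pair e) :
    split M N f ∘ₗ sideProj (day M N) e ∘ₗ ((pushLax M N).app X).hom =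
      pushSplit M N (distr A B ≫ amalg.map f ≫ e.sideGlue) := by
  let d := Dec.ofSum f
  let J := e.join d
  let a := crossPart e J.fst d.fst (e.mem_join_fst d) ≫ leftIso f
  let b := crossPart e J.snd d.snd (e.mem_join_snd d) ≫ rightIso f
  -- Gluing the splittings of the colour classes, or the colour classes of the pieces, gives the
  -- same bijection to `X`.
  have h : distr A B ≫ amalg.map f ≫ e.sideGlue =
      addMap (amalg.map (inv a) ≫ (e.inside J.fst).sideGlue)
        (amalg.map (inv b) ≫ (e.inside J.snd).sideGlue) ≫ J.glue :=
    hom_ext fun i x => by rcases x with ⟨s, x⟩ | ⟨s, x⟩ <;> rfl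
  rw [h, ← tmap_sideSplit_comp_split, ← map_comp_sideSplit, ← map_comp_sideSplit,
    ← sideProj_eq_sideSplit, ← sideProj_eq_sideSplit, ← dayProj_eq_split, M.map_comp, N.map_comp,
    ModuleCat.hom_comp, ModuleCat.hom_comp]
  exact congrArg (· ∘ₗ dayProj (amalgPush.obj M) (amalgPush.obj N) J)
    (TensorProduct.map_comp (M.map (leftIso f)).hom (N.map (rightIso f)).hom
      ((M.map (crossPart e J.fst d.fst (e.mem_join_fst d))).hom ∘ₗ sideProj M (e.inside J.fst))
      ((N.map (crossPart e J.snd d.snd (e.mem_join_snd d))).hom ∘ₗ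
        sideProj N (e.inside J.snd))).symm

/-- By definition, `sideSplit` along `g` is a `sideProj` followed by `sideIso g`, and this bijection
can be absorbed into `f`. -/
theorem split_sideSplit_pushLax (M N : FMod Side k) {A B C : FB2} {X : FB}
    (f : add A B ⟶ C) (g : amalg.obj C ⟶ X) :
    split M N f ∘ₗ sideSplit (day M N) g ∘ₗ ((pushLax M N).app X).hom =
      pushSplit M N (distr A B ≫ amalg.map f ≫ g) := by
  have h := split_sideProj_pushLax M N (Dec.ofSide g) (f ≫ inv (sideIso g))
  rw [← split_comp_map] at h
  refine Eq.trans (Eq.trans rfl h) ?_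
  congr 1
  exact hom_ext fun i x => by rcases x with ⟨s, x⟩ | ⟨s, x⟩ <;> rfl

end SideSplits
-- Induction along the disjoint union is strong symmetric monoidal
section PushStrong

variable {k : Type u} [Field k]

/-- The colour of an element can be read off in the piece of `d` that contains it. -/
theorem Dec.eq_of_inside_eq {X : FB} (d : Dec X) {e e' : Dec X}
    (h₁ : e.inside d.fst = e'.inside d.fst) (h₂ : e.inside d.snd = e'.inside d.snd) : e = e' := by
  refine Dec.ext ?_ ?_ <;> funext i <;> ext x
  · by_cases hx : x ∈ d.fst i
    · exact iff_of_eq (congrArg (fun t => (⟨x, hx⟩ : (part d.fst).carrier i) ∈ t.fst i) h₁)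
    · exact iff_of_eq (congrArg (fun t => (⟨x, (d.compl i x).2 hx⟩ : (part d.snd).carrier i) ∈
        t.fst i) h₂)
  · by_cases hx : x ∈ d.fst i
    · exact iff_of_eq (congrArg (fun t => (⟨x, hx⟩ : (part d.fst).carrier i) ∈ t.snd i) h₁)
    · exact iff_of_eq (congrArg (fun t => (⟨x, (d.compl i x).2 hx⟩ : (part d.snd).carrier i) ∈
        t.snd i) h₂)

/-- In the sum over colourings `e'` that defines `pushOplax`, a term survives the projection only if
`e'` and `e` agree on both pieces of `e.join d`, hence only for `e' = e`. The remaining comparison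
bijections do not move elements of `X`. -/
theorem dayProj_sideProj_pushLax_pushOplax (M N : FMod Side k) {X : FB} (e : Dec X)
    (d : Dec (pair e)) :
    dayProj M N d ∘ₗ sideProj (day M N) e ∘ₗ ((pushLax M N).app X).hom ∘ₗ
      ((pushOplax M N).app X).hom = dayProj M N d ∘ₗ sideProj (day M N) e := by
  let J := e.join d
  let a := crossPart e J.fst d.fst (e.mem_join_fst d)
  let b := crossPart e J.snd d.snd (e.mem_join_snd d)
  let a' := fun e' : Dec X => crossPart e' J.fst (J.cross e').fst fun _ _ => Iff.rfl
  let b' := fun e' : Dec X => crossPart e' J.snd (J.cross e').snd fun _ _ => Iff.rfl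
  let T := fun e' : Dec X =>
      TensorProduct.map
        (sideIncl M (e'.inside J.fst) ∘ₗ (M.map (inv (a' e'))).hom)
        (sideIncl N (e'.inside J.snd) ∘ₗ (N.map (inv (b' e'))).hom) ∘ₗ
      dayProj M N (J.cross e') ∘ₗ sideProj (day M N) e'
  change TensorProduct.map ((M.map a).hom ∘ₗ sideProj M (e.inside J.fst))
    ((N.map b).hom ∘ₗ sideProj N (e.inside J.snd)) ∘ₗ (∑ e' : Dec X, T e') = _
  rw [comp_sum_linear, Finset.sum_eq_single e]
  · have h₁ : ((M.map a).hom ∘ₗ sideProj M (e.inside J.fst)) ∘ₗ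
        (sideIncl M (e.inside J.fst) ∘ₗ (M.map (inv (a' e))).hom) =
        (M.map (inv (a' e) ≫ a)).hom := by
      rw [LinearMap.comp_assoc, ← LinearMap.comp_assoc _ _ (sideProj M _), sideProj_comp_sideIncl,
        LinearMap.id_comp, M.map_comp, ModuleCat.hom_comp]
    have h₂ : ((N.map b).hom ∘ₗ sideProj N (e.inside J.snd)) ∘ₗ
        (sideIncl N (e.inside J.snd) ∘ₗ (N.map (inv (b' e))).hom) =
        (N.map (inv (b' e) ≫ b)).hom := by
      rw [LinearMap.comp_assoc, ← LinearMap.comp_assoc _ _ (sideProj N _), sideProj_comp_sideIncl,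
        LinearMap.id_comp, N.map_comp, ModuleCat.hom_comp]
    have h₃ := map_comp_dayProj M N d.glue (J.cross e) (inv (a' e) ≫ a) (inv (b' e) ≫ b)
      (fun _ _ => rfl) (fun _ _ => rfl)
    rw [← dayProj_eq_split] at h₃
    refine (tmap_comp _ _ _ _ _).trans ?_
    rw [h₁, h₂]
    exact congrArg (· ∘ₗ sideProj (day M N) e) h₃
  · intro e' _ he
    refine (tmap_comp _ _ _ _ _).trans ?_
    by_cases h : e.inside J.fst = e'.inside J.fst
    · have h' : e.inside J.snd ≠ e'.inside J.snd := fun h' => he (J.eq_of_inside_eq h h').symm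
      rw [LinearMap.comp_assoc (sideIncl N _ ∘ₗ _), ← LinearMap.comp_assoc _ _ (sideProj N _),
        sideProj_comp_sideIncl_ne N h', LinearMap.zero_comp, LinearMap.comp_zero,
        TensorProduct.map_zero_right, LinearMap.zero_comp]
    · rw [LinearMap.comp_assoc (sideIncl M _ ∘ₗ _), ← LinearMap.comp_assoc _ _ (sideProj M _),
        sideProj_comp_sideIncl_ne M h, LinearMap.zero_comp, LinearMap.comp_zero,
        TensorProduct.map_zero_left, LinearMap.zero_comp]
  · simp

theorem pushOplax_comp_pushLax (M N : FMod Side k) : pushOplax M N ≫ pushLax M N = 𝟙 _ :=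
  NatTrans.ext (funext fun _ => ModuleCat.hom_ext (side_hom_ext (D := day M N) fun e =>
    day_hom_ext fun d => dayProj_sideProj_pushLax_pushOplax M N e d))

/-- All the projections that detect elements of `amalgPush M ⊙ amalgPush N` factor through
`pushLax`, which is therefore injective. With the one-sided inverse already found, this gives the
other one in `pushLax_comp_pushOplax`. -/
theorem pushSplit_eq (M N : FMod Side k) {A B : FB2} {X : FB}
    (g : add (amalg.obj A) (amalg.obj B) ⟶ X) :
    pushSplit M N g = split M N (𝟙 _) ∘ₗ sideSplit (day M N) (inv (distr A B) ≫ g) ∘ₗ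
      ((pushLax M N).app X).hom := by
  rw [split_sideSplit_pushLax, amalg.map_id, Category.id_comp, comp_inv_assoc]

theorem pushLax_comp_pushOplax (M N : FMod Side k) : pushLax M N ≫ pushOplax M N = 𝟙 _ :=
  NatTrans.ext (funext fun X => ModuleCat.hom_ext (pushSplit_hom_ext fun A B g => by
    have h := congrArg (fun f => (f.app X).hom ∘ₗ ((pushLax M N).app X).hom)
      (pushOplax_comp_pushLax M N)
    change pushSplit M N g ∘ₗ ((pushOplax M N).app X).hom ∘ₗ ((pushLax M N).app X).hom =
      pushSplit M N g ∘ₗ LinearMap.id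
    change ((pushLax M N).app X).hom ∘ₗ ((pushOplax M N).app X).hom ∘ₗ
      ((pushLax M N).app X).hom = ((pushLax M N).app X).hom at h
    rw [pushSplit_eq, LinearMap.comp_assoc, LinearMap.comp_assoc, h]
    rfl))

theorem pushSplit_comp_dayMap {M M' N N' : FMod Side k} (m : M ⟶ M') (n : N ⟶ N') {A B : FB2}
    {X : FB} (g : add (amalg.obj A) (amalg.obj B) ⟶ X) :
    pushSplit M' N' g ∘ₗ ((dayMap (amalgPush.map m) (amalgPush.map n)).app X).hom =
      TensorProduct.map (m.app A).hom (n.app B).hom ∘ₗ pushSplit M N g := by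
  rw [pushSplit, LinearMap.comp_assoc, split_comp_dayMap, tmap_comp, sideSplit_comp_app,
    sideSplit_comp_app, pushSplit, tmap_comp]

theorem pushSplit_comp_braid (M N : FMod Side k) {A B : FB2} {X : FB}
    (g : add (amalg.obj A) (amalg.obj B) ⟶ X) :
    pushSplit N M g ∘ₗ ((braid (amalgPush.obj M) (amalgPush.obj N)).app X).hom =
      (TensorProduct.comm k _ _).toLinearMap ∘ₗ pushSplit M N (addSwap _ _ ≫ g) := by
  rw [pushSplit, LinearMap.comp_assoc, split_comp_braid, pushSplit, ← LinearMap.comp_assoc,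
    ← LinearMap.comp_assoc, TensorProduct.map_comp_comm_eq]

theorem pushLax_naturality {M M' N N' : FMod Side k} (m : M ⟶ M') (n : N ⟶ N') :
    dayMap (amalgPush.map m) (amalgPush.map n) ≫ pushLax M' N' =
      pushLax M N ≫ amalgPush.map (dayMap m n) :=
  NatTrans.ext (funext fun X => ModuleCat.hom_ext (sideSplit_hom_ext fun C g =>
    split_hom_ext fun A B f => by
      change split M' N' f ∘ₗ sideSplit _ g ∘ₗ ((pushLax M' N').app X).hom ∘ₗ
          ((dayMap (amalgPush.map m) (amalgPush.map n)).app X).hom =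
        split M' N' f ∘ₗ sideSplit _ g ∘ₗ ((amalgPush.map (dayMap m n)).app X).hom ∘ₗ
          ((pushLax M N).app X).hom
      rw [← LinearMap.comp_assoc _ _ (sideSplit _ g), ← LinearMap.comp_assoc,
        split_sideSplit_pushLax, pushSplit_comp_dayMap, ← split_sideSplit_pushLax,
        ← LinearMap.comp_assoc _ _ (sideSplit _ g), sideSplit_comp_app,
        LinearMap.comp_assoc ((pushLax M N).app X).hom,
        ← LinearMap.comp_assoc _ _ (split M' N' f), split_comp_dayMap, LinearMap.comp_assoc]))

theorem pushLax_braid (M N : FMod Side k) :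
    braid _ _ ≫ pushLax N M = pushLax M N ≫ amalgPush.map (braid M N) :=
  NatTrans.ext (funext fun X => ModuleCat.hom_ext (sideSplit_hom_ext fun C g =>
    split_hom_ext fun A B f => by
      change split N M f ∘ₗ sideSplit _ g ∘ₗ ((pushLax N M).app X).hom ∘ₗ
          ((braid (amalgPush.obj M) (amalgPush.obj N)).app X).hom =
        split N M f ∘ₗ sideSplit _ g ∘ₗ ((amalgPush.map (braid M N)).app X).hom ∘ₗ
          ((pushLax M N).app X).hom
      rw [← LinearMap.comp_assoc _ _ (sideSplit _ g), ← LinearMap.comp_assoc,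
        split_sideSplit_pushLax, pushSplit_comp_braid,
        ← LinearMap.comp_assoc _ _ (sideSplit _ g), sideSplit_comp_app, LinearMap.comp_assoc,
        ← LinearMap.comp_assoc _ _ (split _ _ f), split_comp_braid, LinearMap.comp_assoc,
        split_sideSplit_pushLax, amalg.map_comp, Category.assoc, ← Category.assoc (addSwap _ _),
        addSwap_comp_distr, Category.assoc]))

/-- The iterated projection `(amalgPush M ⊙ (amalgPush N ⊙ amalgPush P))(X) → M(A) ⊗ (N(B) ⊗ P(C))`
for the images of the three projections at `A`, `B`, `C`. -/
noncomputable abbrev sideSplit₃ (M N P : FMod Side k) (A B C : FB2) :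
    (amalgPush.obj M).obj (amalg.obj A) ⊗[k] ((amalgPush.obj N).obj (amalg.obj B) ⊗[k]
      (amalgPush.obj P).obj (amalg.obj C)) →ₗ[k] M.obj A ⊗[k] (N.obj B ⊗[k] P.obj C) :=
  TensorProduct.map (sideSplit M (𝟙 (amalg.obj A)))
    (TensorProduct.map (sideSplit N (𝟙 (amalg.obj B))) (sideSplit P (𝟙 (amalg.obj C))))

/-- Two applications of `split_sideSplit_pushLax`, one on the outer product and one on the inner
product. -/
theorem splitR_sideSplit_pushLax (M N P : FMod Side k) {A B C D : FB2} {X : FB}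
    (f : add A (add B C) ⟶ D) (g : amalg.obj D ⟶ X) :
    splitR M N P f ∘ₗ sideSplit _ g ∘ₗ ((pushLax M (day N P)).app X).hom ∘ₗ
      ((dayMap (𝟙 (amalgPush.obj M)) (pushLax N P)).app X).hom =
    sideSplit₃ M N P A B C ∘ₗ splitR (amalgPush.obj M) (amalgPush.obj N) (amalgPush.obj P)
      (addMap (𝟙 _) (distr B C) ≫ distr A (add B C) ≫ amalg.map f ≫ g) := by
  rw [splitR, LinearMap.comp_assoc, ← LinearMap.comp_assoc _ _ (sideSplit _ g),
    ← LinearMap.comp_assoc _ _ (split _ _ f), split_sideSplit_pushLax, pushSplit,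
    LinearMap.comp_assoc, split_comp_dayMap, tmap_comp, tmap_comp, LinearMap.id_comp,
    LinearMap.comp_assoc, split_sideSplit_pushLax, amalg.map_id, Category.id_comp,
    Category.comp_id, pushSplit, ← split_id_comp_split_snd, tmap_comp, LinearMap.comp_id]
  rfl

theorem splitL_sideSplit_pushLax (M N P : FMod Side k) {A B C D : FB2} {X : FB}
    (f : add (add A B) C ⟶ D) (g : amalg.obj D ⟶ X) :
    splitL M N P f ∘ₗ sideSplit _ g ∘ₗ ((pushLax (day M N) P).app X).hom ∘ₗ
      ((dayMap (pushLax M N) (𝟙 (amalgPush.obj P))).app X).hom =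
    sideSplit₃ M N P A B C ∘ₗ splitL (amalgPush.obj M) (amalgPush.obj N) (amalgPush.obj P)
      (addMap (distr A B) (𝟙 _) ≫ distr (add A B) C ≫ amalg.map f ≫ g) := by
  rw [splitL, LinearMap.comp_assoc, LinearMap.comp_assoc,
    ← LinearMap.comp_assoc _ _ (sideSplit _ g),
    ← LinearMap.comp_assoc _ _ (split _ _ f), split_sideSplit_pushLax, pushSplit,
    LinearMap.comp_assoc, split_comp_dayMap, tmap_comp, tmap_comp, LinearMap.id_comp,
    LinearMap.comp_assoc, split_sideSplit_pushLax, amalg.map_id, Category.id_comp,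
    Category.comp_id, pushSplit, ← split_id_comp_split_fst, ← assoc_tmap_comp, tmap_comp,
    LinearMap.comp_id]
  rfl

/-- As for `amalgStar`, projecting to triple summands leaves the identity `addAssoc_comp_distr`
between bijections. -/
theorem pushLax_assoc (M N P : FMod Side k) :
    dayMap (pushLax M N) (𝟙 _) ≫ pushLax (day M N) P ≫ amalgPush.map (assocNat M N P) =
      assocNat _ _ _ ≫ dayMap (𝟙 _) (pushLax N P) ≫ pushLax M (day N P) :=
  NatTrans.ext (funext fun X => ModuleCat.hom_ext (sideSplit_hom_ext fun D g =>
    splitR_hom_ext fun A B C f => by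
      change splitR M N P f ∘ₗ sideSplit _ g ∘ₗ ((amalgPush.map (assocNat M N P)).app X).hom ∘ₗ
          ((pushLax (day M N) P).app X).hom ∘ₗ
            ((dayMap (pushLax M N) (𝟙 (amalgPush.obj P))).app X).hom =
        splitR M N P f ∘ₗ sideSplit _ g ∘ₗ ((pushLax M (day N P)).app X).hom ∘ₗ
          ((dayMap (𝟙 (amalgPush.obj M)) (pushLax N P)).app X).hom ∘ₗ
            assocHom (amalgPush.obj M) (amalgPush.obj N) (amalgPush.obj P) X
      have h₁ := congrArg (· ∘ₗ assocHom (amalgPush.obj M) (amalgPush.obj N) (amalgPush.obj P) X)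
        (splitR_sideSplit_pushLax M N P f g)
      simp only [LinearMap.comp_assoc] at h₁
      have h₂ : splitR M N P f ∘ₗ ((assocNat M N P).app D).hom =
        splitL M N P (addAssoc A B C ≫ f) := splitR_comp_assocHom f
      have h₃ := congrArg (· ≫ amalg.map f ≫ g) (addAssoc_comp_distr A B C)
      simp only [Category.assoc] at h₃
      rw [h₁, ← LinearMap.comp_assoc _ _ (sideSplit _ g), sideSplit_comp_app,
        LinearMap.comp_assoc, ← LinearMap.comp_assoc _ _ (splitR _ _ _ f), h₂,
        splitL_sideSplit_pushLax, splitR_comp_assocHom, h₃, amalg.map_comp, Category.assoc]))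

/-- Induction along the disjoint union is strong symmetric monoidal. -/
noncomputable def pushStrong : Strong (amalgPush (k := k)) where
  lax := pushLax
  oplax := pushOplax
  lax_oplax := pushLax_comp_pushOplax
  oplax_lax := pushOplax_comp_pushLax
  lax_natural := pushLax_naturality
  lax_braid := pushLax_braid
  lax_assoc := pushLax_assoc

instance amalgPush_additive : (amalgPush (k := k)).Additive where
  map_add := rfl

end PushStrong
-- Transport of the diagonal axiom
section Diagonal

variable {c : Type} {k : Type u} [Field k]

/-- The value of a diagonal map only depends on the components for which the support of `unitMod`
meets both pieces. -/
theorem isDiagonal_iff [Finite c] {n : c → ℕ} {M : FMod c k}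
    (μ : day M M ⟶ day M (unitMod k n)) :
    IsDiagonal μ ↔ ∀ (X : FinFam c) (e : Dec X) (x : (day M M).obj X),
      (∀ d : Dec X, ¬((∀ i, e.snd i ⊆ d.fst i) ∨ (∀ i, e.snd i ⊆ d.snd i)) →
        dayProj M M d x = 0) → dayProj M (unitMod k n) e ((μ.app X).hom x) = 0 := by
  constructor
  · intro h X e x hx
    have h₁ := LinearMap.congr_fun (sum_dayIncl_comp_dayProj M M X) x
    rw [LinearMap.sum_apply, LinearMap.id_apply] at h₁
    rw [← h₁, map_sum, map_sum]
    refine Finset.sum_eq_zero fun d _ => ?_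
    by_cases hd : (∀ i, e.snd i ⊆ d.fst i) ∨ (∀ i, e.snd i ⊆ d.snd i)
    · exact LinearMap.congr_fun (h X d e hd) (dayProj M M d x)
    · rw [LinearMap.comp_apply, hx d hd, map_zero, map_zero, map_zero]
  · intro h X d e hd
    refine LinearMap.ext fun v => h X e _ fun d' hd' => ?_
    have hne : d' ≠ d := fun h' => hd' (h' ▸ hd)
    exact LinearMap.congr_fun (dayProj_comp_dayIncl_ne M M hne) v

theorem dayProj_starStrong {M N K : FMod Unit k} {K' : FMod Side k} (φ : day M N ⟶ day M K)
    (π : amalgStar.obj K ⟶ K') {X : FB2} (e : Dec X)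
    (x : (day (amalgStar.obj M) (amalgStar.obj N)).obj X) :
    dayProj (amalgStar.obj M) K' e
      (((starLax M N ≫ amalgStar.map φ ≫ starOplax M K ≫ dayMap (𝟙 _) π).app X).hom x) =
    TensorProduct.map (M.map (inv (sumPart e.fst e.sum.fst fun _ _ => Iff.rfl))).hom
      ((π.app (part e.snd)).hom ∘ₗ
        (K.map (inv (sumPart e.snd e.sum.snd fun _ _ => Iff.rfl))).hom)
      (dayProj M K e.sum ((φ.app (amalg.obj X)).hom (((starLax M N).app X).hom x))) :=
  LinearMap.congr_fun (TensorProduct.map_comp LinearMap.id (π.app (part e.snd)).hom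
    (M.map (inv (sumPart e.fst e.sum.fst fun _ _ => Iff.rfl))).hom
    (K.map (inv (sumPart e.snd e.sum.snd fun _ _ => Iff.rfl))).hom).symm _

/-- A piece of `d.split` contains the support of the unit in both colours exactly when the
corresponding piece of `d` contains the disjoint union of the two supports. -/
theorem starStrong_mu_diagonal {M : FMod Unit k} {μ : day M M ⟶ day M (unitMod k two)}
    (h : IsDiagonal μ) : IsDiagonal (starStrong.mu μ (starProj k)) := by
  rw [isDiagonal_iff] at h ⊢
  intro X e x hx
  have key := h (amalg.obj X) e.sum (((starLax M M).app X).hom x) fun d hd => by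
    have hd' := hx d.split fun h' => hd (h'.imp (fun h i p hp => h p.1 hp) fun h i p hp => h p.1 hp)
    let T := TensorProduct.map (M.map (sumPart d.split.fst d.fst fun _ _ => Iff.rfl)).hom
      (M.map (sumPart d.split.snd d.snd fun _ _ => Iff.rfl)).hom
    exact (congrArg T hd').trans (map_zero T)
  exact (dayProj_starStrong μ (starProj k) e x).trans ((congrArg _ key).trans (map_zero _))

/-- The sum over colourings comes from `pushOplax`; for each colouring `a` of `X`, the original map
is evaluated on the pair of colour classes of `a`. -/
theorem dayProj_pushStrong {M N K : FMod Side k} {K' : FMod Unit k} (φ : day M N ⟶ day M K)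
    (π : amalgPush.obj K ⟶ K') {X : FB} (e : Dec X)
    (x : (day (amalgPush.obj M) (amalgPush.obj N)).obj X) :
    dayProj (amalgPush.obj M) K' e
      (((pushLax M N ≫ amalgPush.map φ ≫ pushOplax M K ≫ dayMap (𝟙 _) π).app X).hom x) =
    ∑ a : Dec X, TensorProduct.map
      (sideIncl M (a.inside e.fst) ∘ₗ
        (M.map (inv (crossPart a e.fst (e.cross a).fst fun _ _ => Iff.rfl))).hom)
      ((π.app (part e.snd)).hom ∘ₗ sideIncl K (a.inside e.snd) ∘ₗ
        (K.map (inv (crossPart a e.snd (e.cross a).snd fun _ _ => Iff.rfl))).hom)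
      (dayProj M K (e.cross a) ((φ.app (pair a)).hom
        (sideProj (day M N) a (((pushLax M N).app X).hom x)))) := by
  let T := fun a : Dec X => TensorProduct.map
      (sideIncl M (a.inside e.fst) ∘ₗ
        (M.map (inv (crossPart a e.fst (e.cross a).fst fun _ _ => Iff.rfl))).hom)
      (sideIncl K (a.inside e.snd) ∘ₗ
        (K.map (inv (crossPart a e.snd (e.cross a).snd fun _ _ => Iff.rfl))).hom) ∘ₗ
      dayProj M K (e.cross a) ∘ₗ sideProj (day M K) a
  let y : (pushObj (day M K)).obj X :=
    ((amalgPush.map φ).app X).hom (((pushLax M N).app X).hom x)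
  let Q := TensorProduct.map (LinearMap.id : (amalgPush.obj M).obj (part e.fst) →ₗ[k] _)
    (π.app (part e.snd)).hom
  refine (congrArg Q (LinearMap.sum_apply Finset.univ T y)).trans
    ((map_sum Q (fun a => T a y) Finset.univ).trans ?_)
  refine Finset.sum_congr rfl fun a _ => ?_
  exact LinearMap.congr_fun (TensorProduct.map_comp LinearMap.id (π.app (part e.snd)).hom
    (sideIncl M (a.inside e.fst) ∘ₗ
      (M.map (inv (crossPart a e.fst (e.cross a).fst fun _ _ => Iff.rfl))).hom)
    (sideIncl K (a.inside e.snd) ∘ₗ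
      (K.map (inv (crossPart a e.snd (e.cross a).snd fun _ _ => Iff.rfl))).hom)).symm _

/-- Keeping `J` as a variable with an equation allows the use of `Dec.join_cross`, where `J` is only
propositionally a join. -/
theorem dayProj_sideProj_pushLax (M N : FMod Side k) {X : FB} (a J : Dec X) (d : Dec (pair a))
    (h : a.join d = J) (x : (day (amalgPush.obj M) (amalgPush.obj N)).obj X) :
    dayProj M N d (sideProj (day M N) a (((pushLax M N).app X).hom x)) =
      TensorProduct.map
        ((M.map (crossPart a J.fst d.fst (h ▸ a.mem_join_fst d))).hom ∘ₗ
          sideProj M (a.inside J.fst))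
        ((N.map (crossPart a J.snd d.snd (h ▸ a.mem_join_snd d))).hom ∘ₗ
          sideProj N (a.inside J.snd))
        (dayProj (amalgPush.obj M) (amalgPush.obj N) J x) := by
  subst h
  rfl

theorem Dec.join_cross {X : FB} (a d : Dec X) : a.join (d.cross a) = d := by
  have h₁ : ∀ x, x ∈ (a.join (d.cross a)).fst () ↔ x ∈ d.fst () := fun x => by
    obtain ⟨s, hs⟩ := a.exists_side x
    exact (a.mem_join_fst (d.cross a) s ⟨x, hs⟩).symm
  refine Dec.ext ?_ ?_ <;> funext i <;> ext x
  · exact h₁ x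
  · exact ((a.join (d.cross a)).compl () x).trans ((not_congr (h₁ x)).trans (d.compl () x).symm)

theorem Dec.cross_join {X : FB} (a : Dec X) (d : Dec (pair a)) : (a.join d).cross a = d :=
  Dec.ext (funext fun s => Set.ext fun x => (a.mem_join_fst d s x).symm)
    (funext fun s => Set.ext fun x => (a.mem_join_snd d s x).symm)

/-- Each colouring contributes zero separately: if a piece of `a.join d` contains the support of the
unit, then so does the corresponding piece of `d` within each colour class of `a`. -/
theorem pushStrong_mu_diagonal {M : FMod Side k} {μ : day M M ⟶ day M (unitMod k oneOne)}
    (h : IsDiagonal μ) : IsDiagonal (pushStrong.mu μ (pushProj k)) := by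
  rw [isDiagonal_iff] at h ⊢
  intro X e x hx
  refine (dayProj_pushStrong μ (pushProj k) e x).trans (Finset.sum_eq_zero fun a _ => ?_)
  have hz := h (pair a) (e.cross a) (sideProj (day M M) a (((pushLax M M).app X).hom x))
    fun d hd => by
      have hd' := hx (a.join d) ?_
      · exact (dayProj_sideProj_pushLax M M a _ d rfl x).trans
          ((congrArg _ hd').trans (map_zero _))
      refine fun h' => hd (h'.imp (fun h' s x hx => ?_) fun h' s x hx => ?_)
      · exact (a.mem_join_fst d s x).2 (h' () hx)
      · exact (a.mem_join_snd d s x).2 (h' () hx)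
  exact (congrArg _ hz).trans (map_zero _)

end Diagonal

/-! ### The unit axiom for restriction -/

section StarUnit

variable {k : Type u} [Field k]

theorem overlap_sum {X : FB2} (d e : Dec X) : overlap d.sum e.sum = overlap d e :=
  Nat.card_congr
    { toFun := fun p => ⟨p.2.1.1, p.2.1.2, p.2.2⟩
      invFun := fun p => ⟨(), ⟨p.1, p.2.1⟩, p.2.2⟩
      left_inv := fun _ => rfl
      right_inv := fun _ => rfl }

theorem scalar_gen {X : FB2} (h : HasCard oneOne X) : scalar k X (gen k oneOne X) = 1 := by
  rw [scalar, dif_pos h]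
  rfl

/-- `Dec.split` and `Dec.sum` are inverse to each other, so the summand indexed by `d` is carried to
the one indexed by `d.sum` and meets no other. -/
theorem starLax_dayIncl (M N : FMod Unit k) {X : FB2} (d : Dec X)
    (v : (amalgStar.obj M).obj (part d.fst) ⊗[k] (amalgStar.obj N).obj (part d.snd)) :
    ((starLax M N).app X).hom (dayIncl (amalgStar.obj M) (amalgStar.obj N) d v) =
      dayIncl M N d.sum
        (TensorProduct.map (M.map (sumPart d.fst d.sum.fst fun _ _ => Iff.rfl)).hom
          (N.map (sumPart d.snd d.sum.snd fun _ _ => Iff.rfl)).hom v) := by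
  funext d'
  change TensorProduct.map (M.map (sumPart d'.split.fst d'.fst fun _ _ => Iff.rfl)).hom
    (N.map (sumPart d'.split.snd d'.snd fun _ _ => Iff.rfl)).hom
      ((dayProj (amalgStar.obj M) (amalgStar.obj N) d'.split ∘ₗ
        dayIncl (amalgStar.obj M) (amalgStar.obj N) d) v) =
    (dayProj M N d' ∘ₗ dayIncl M N d.sum)
      (TensorProduct.map (M.map (sumPart d.fst d.sum.fst fun _ _ => Iff.rfl)).hom
          (N.map (sumPart d.snd d.sum.snd fun _ _ => Iff.rfl)).hom v)
  by_cases h : d' = d.sum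
  · subst h
    rw [dayProj_comp_dayIncl]
    exact congrArg _ (LinearMap.congr_fun
      (dayProj_comp_dayIncl (amalgStar.obj M) (amalgStar.obj N) d) v)
  · have h' : d'.split ≠ d := fun h' => h (congrArg Dec.sum h')
    rw [dayProj_comp_dayIncl_ne _ _ h', dayProj_comp_dayIncl_ne _ _ h]
    exact map_zero _

theorem dayMap_dayIncl {c : Type} {M M' N N' : FMod c k} (m : M ⟶ M') (n : N ⟶ N')
    {X : FinFam c} (d : Dec X) (v : M.obj (part d.fst) ⊗[k] N.obj (part d.snd)) :
    ((dayMap m n).app X).hom (dayIncl M N d v) = dayIncl M' N' d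
      (TensorProduct.map (m.app (part d.fst)).hom (n.app (part d.snd)).hom v) := by
  funext d'
  change TensorProduct.map (m.app (part d'.fst)).hom (n.app (part d'.snd)).hom
    ((dayProj M N d' ∘ₗ dayIncl M N d) v) = (dayProj M' N' d' ∘ₗ dayIncl M' N' d) _
  by_cases h : d' = d
  · subst h
    rw [dayProj_comp_dayIncl, dayProj_comp_dayIncl]
    rfl
  · rw [dayProj_comp_dayIncl_ne _ _ h, dayProj_comp_dayIncl_ne _ _ h]
    exact map_zero _

theorem starStrong_relabelling {M : FMod Unit k}
    {ψ : day M (unitMod k two) ⟶ day M (unitMod k two)} (h : IsRelabelling ψ) :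
    IsRelabelling (dayMap (𝟙 (amalgStar.obj M)) (starIncl k) ≫ starLax M (unitMod k two) ≫
      amalgStar.map ψ ≫ starOplax M (unitMod k two) ≫ dayMap (𝟙 _) (starProj k)) := by
  intro X d e
  -- The component from `d` to `e` is the component of ψ from `d.sum` to `e.sum`, up to comparison
  -- bijections and the two maps between the units.
  have key : ∀ v, component (dayMap (𝟙 (amalgStar.obj M)) (starIncl k) ≫
      starLax M (unitMod k two) ≫
      amalgStar.map ψ ≫ starOplax M (unitMod k two) ≫ dayMap (𝟙 _) (starProj k)) d e v =
    TensorProduct.map (M.map (inv (sumPart e.fst e.sum.fst fun _ _ => Iff.rfl))).hom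
      (((starProj k).app (part e.snd)).hom ∘ₗ
        ((unitMod k two).map (inv (sumPart e.snd e.sum.snd fun _ _ => Iff.rfl))).hom)
      (component ψ d.sum e.sum
        (TensorProduct.map (M.map (sumPart d.fst d.sum.fst fun _ _ => Iff.rfl)).hom
          ((unitMod k two).map (sumPart d.snd d.sum.snd fun _ _ => Iff.rfl)).hom
          (TensorProduct.map LinearMap.id ((starIncl k).app (part d.snd)).hom v))) := fun v => by
    refine (dayProj_starStrong ψ (starProj k) e _).trans (congrArg _ (congrArg _ (congrArg _ ?_)))
    exact (congrArg ((starLax M (unitMod k two)).app X).hom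
      (dayMap_dayIncl (𝟙 (amalgStar.obj M)) (starIncl k) d v)).trans
      (starLax_dayIncl M (unitMod k two) d _)
  constructor
  · intro ho hd he g hg m
    rw [key]
    let g' : part d.sum.fst ⟶ part e.sum.fst :=
      inv (sumPart d.fst d.sum.fst fun _ _ => Iff.rfl) ≫ amalg.map g ≫
        sumPart e.fst e.sum.fst fun _ _ => Iff.rfl
    -- `starIncl` preserves the generators on the support of `k_(1,1)`, where `scalar` is evaluation
    -- and not its default value zero.
    have h₁ : ((unitMod k two).map (sumPart d.snd d.sum.snd fun _ _ => Iff.rfl)).hom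
        (((starIncl k).app (part d.snd)).hom (gen k oneOne (part d.snd))) =
          gen k two (part d.sum.snd) := funext fun _ => scalar_gen hd
    have h₂ := (h (amalg.obj X) d.sum e.sum).1 ((overlap_sum d e).trans ho)
      ((hasCard_two_amalg hd).of_hom (inv (sumPart d.snd d.sum.snd fun _ _ => Iff.rfl)))
      ((hasCard_two_amalg he).of_hom (inv (sumPart e.snd e.sum.snd fun _ _ => Iff.rfl)))
      g' (fun i x hx => congrArg (Sigma.mk x.1.1) (hg x.1.1 ⟨x.1.2, x.2⟩ hx))
      ((M.map (sumPart d.fst d.sum.fst fun _ _ => Iff.rfl)).hom m)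
    have h₃ : (M.map (inv (sumPart e.fst e.sum.fst fun _ _ => Iff.rfl))).hom ∘ₗ
        (M.map g').hom ∘ₗ (M.map (sumPart d.fst d.sum.fst fun _ _ => Iff.rfl)).hom =
          (M.map (amalg.map g)).hom := by
      rw [← ModuleCat.hom_comp, ← ModuleCat.hom_comp, ← M.map_comp, ← M.map_comp]
      rfl
    refine (congrArg _ (congrArg _ (congrArg _ h₁))).trans ((congrArg _ h₂).trans ?_)
    exact congrArg (· ⊗ₜ gen k oneOne (part e.snd)) (LinearMap.congr_fun h₃ m)
  · intro ho
    have h' := (h (amalg.obj X) d.sum e.sum).2 (fun h' => ho ((overlap_sum d e).symm.trans h'))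
    refine LinearMap.ext fun v => (key v).trans ?_
    rw [h', LinearMap.zero_apply, map_zero]
    rfl

end StarUnit
-- Colourings of a set and relabelling
section Colourings

/-- A set with two elements and a colouring: each colour occurs once if and only if the two
elements have different colours. -/
theorem card_pair_eq_one_iff {α : Type} {p q : α → Prop} {a b : α} (hab : a ≠ b)
    (hq : ∀ x, q x ↔ x = a ∨ x = b) :
    Nat.card {x : {x // p x} // q x.1} = 1 ↔ (p a ↔ ¬ p b) := by
  rw [Nat.card_eq_one_iff_exists]
  constructor
  · rintro ⟨z, hz⟩
    have ha : p a → z.1.1 = a := fun h =>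
      (congrArg (fun y => y.1.1) (hz ⟨⟨a, h⟩, (hq a).2 (.inl rfl)⟩)).symm
    have hb : p b → z.1.1 = b := fun h =>
      (congrArg (fun y => y.1.1) (hz ⟨⟨b, h⟩, (hq b).2 (.inr rfl)⟩)).symm
    refine ⟨fun h h' => hab ((ha h).symm.trans (hb h')), fun h => ?_⟩
    rcases (hq _).1 z.2 with h' | h'
    · exact h' ▸ z.1.2
    · exact absurd (h' ▸ z.1.2) h
  · intro h
    by_cases ha : p a
    · refine ⟨⟨⟨a, ha⟩, (hq a).2 (.inl rfl)⟩, fun y => ?_⟩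
      rcases (hq _).1 y.2 with h' | h'
      · exact Subtype.ext (Subtype.ext h')
      · exact absurd (h' ▸ y.1.2) (h.1 ha)
    · have hb : p b := by tauto
      refine ⟨⟨⟨b, hb⟩, (hq b).2 (.inr rfl)⟩, fun y => ?_⟩
      rcases (hq _).1 y.2 with h' | h'
      · exact absurd (h' ▸ y.1.2) ha
      · exact Subtype.ext (Subtype.ext h')

/-- This decides which colourings contribute to the unit composite: the support of `k_2` becomes one
of `k_(1,1)` exactly when its two elements have different colours. -/
theorem hasCard_cross_iff {X : FB} (a d : Dec X) {x y : X.carrier ()} (hxy : x ≠ y)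
    (hd : ∀ z, z ∈ d.snd () ↔ z = x ∨ z = y) :
    HasCard oneOne (part (d.cross a).snd) ↔ (x ∈ a.fst () ↔ y ∉ a.fst ()) := by
  have h₁ : Nat.card ((part (d.cross a).snd).carrier .input) = 1 ↔
      (x ∈ a.fst () ↔ y ∉ a.fst ()) :=
    card_pair_eq_one_iff (p := fun z => z ∈ a.fst ()) (q := fun z => z ∈ d.snd ()) hxy hd
  have h₂ : Nat.card ((part (d.cross a).snd).carrier .output) = 1 ↔
      (x ∈ a.snd () ↔ y ∉ a.snd ()) :=
    card_pair_eq_one_iff (p := fun z => z ∈ a.snd ()) (q := fun z => z ∈ d.snd ()) hxy hd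
  rw [a.compl, a.compl] at h₂
  constructor
  · exact fun h => h₁.1 (h .input)
  · intro h s
    cases s
    · exact h₁.2 h
    · exact h₂.2 (by tauto)

/-- Each common element has exactly one colour under `a`. -/
theorem overlap_cross {X : FB} (a d e : Dec X) : overlap (d.cross a) (e.cross a) = overlap d e :=
  Nat.card_congr (Equiv.ofBijective
    (fun p => (⟨(), p.2.1.1, p.2.2⟩ : Σ i, ↥(d.snd i ∩ e.snd i))) ⟨by
      rintro ⟨s, x, h⟩ ⟨s', x', h'⟩ hp
      have hx : x.1 = x'.1 := congrArg
        (fun p : Σ i, ↥(d.snd i ∩ e.snd i) => (show X.carrier () from p.2.1)) hp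
      obtain rfl := a.side_unique x.2 (hx ▸ x'.2)
      obtain rfl : x = x' := Subtype.ext hx
      rfl, by
      rintro ⟨_, x, h⟩
      obtain ⟨s, hs⟩ := a.exists_side x
      exact ⟨⟨s, ⟨x, hs⟩, h⟩, rfl⟩⟩)

/-- Two subsets with two elements and one common element. -/
theorem exists_of_overlap {X : FB} {d e : Dec X} (ho : overlap d e = 1)
    (hd : HasCard two (part d.snd)) (he : HasCard two (part e.snd)) :
    ∃ x y v : X.carrier (), x ≠ y ∧ y ≠ v ∧ x ≠ v ∧ (∀ z, z ∈ d.snd () ↔ z = y ∨ z = v) ∧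
      ∀ z, z ∈ e.snd () ↔ z = x ∨ z = y := by
  have ho' : (d.snd () ∩ e.snd ()).ncard = 1 :=
    (Nat.card_congr (Equiv.uniqueSigma fun i => ↥(d.snd i ∩ e.snd i))).symm.trans ho
  have hd' : (d.snd ()).ncard = 2 := hd ()
  have he' : (e.snd ()).ncard = 2 := he ()
  obtain ⟨y, hy⟩ := Set.ncard_eq_one.1 ho'
  have hy' : y ∈ d.snd () ∧ y ∈ e.snd () := by
    change y ∈ d.snd () ∩ e.snd ()
    rw [hy]
    rfl
  have hu : ∀ z, z ∈ d.snd () → z ∈ e.snd () → z = y := fun z h h' => by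
    have : z ∈ d.snd () ∩ e.snd () := ⟨h, h'⟩
    rwa [hy] at this
  obtain ⟨v, hv, hdv⟩ : ∃ v, y ≠ v ∧ d.snd () = {y, v} := by
    obtain ⟨p, q, hpq, h⟩ := Set.ncard_eq_two.1 hd'
    rw [h] at hy'
    rcases hy'.1 with rfl | rfl
    · exact ⟨q, hpq, h⟩
    · exact ⟨p, hpq.symm, by rw [h, Set.pair_comm]⟩
  obtain ⟨x, hx, hex⟩ : ∃ x, x ≠ y ∧ e.snd () = {x, y} := by
    obtain ⟨p, q, hpq, h⟩ := Set.ncard_eq_two.1 he'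
    rw [h] at hy'
    rcases hy'.2 with rfl | rfl
    · exact ⟨q, hpq.symm, by rw [h, Set.pair_comm]⟩
    · exact ⟨p, hpq, h⟩
  refine ⟨x, y, v, hx, hv, ?_, fun z => by rw [hdv]; rfl, fun z => by rw [hex]; rfl⟩
  rintro rfl
  exact hx (hu x (by rw [hdv]; exact .inr rfl) (by rw [hex]; exact .inl rfl))

/-- A bijection between the complements of two sets `{y, v}` and `{x, y}` that fixes the common
elements sends `x` to `v`. -/
theorem relabel_apply {X : FB} {d e : Dec X} {x y v : X.carrier ()} (hyv : y ≠ v) (hxv : x ≠ v)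
    (hd : ∀ z, z ∈ d.snd () ↔ z = y ∨ z = v)
    (he : ∀ z, z ∈ e.snd () ↔ z = x ∨ z = y) (g : part d.fst ⟶ part e.fst)
    (hg : ∀ i (z : (part d.fst).carrier i), z.1 ∈ e.fst i → (g i z).1 = z.1)
    (hx : x ∈ d.fst ()) : (g () ⟨x, hx⟩).1 = v := by
  have hv : v ∈ e.fst () := by
    by_contra h
    rcases (he v).1 ((e.compl () v).2 h) with h | h
    · exact hxv h.symm
    · exact hyv h.symm
  have h₁ : g () ((g ()).symm ⟨v, hv⟩) = ⟨v, hv⟩ := Equiv.apply_symm_apply _ _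
  -- If the preimage of `v` were in the target set, it would be fixed and equal to `v`, which is not
  -- in the source. Hence it is `x` or `y`, and `y` is not in the source either.
  have h₂ : ((g ()).symm ⟨v, hv⟩).1 = x := by
    set z := (g ()).symm ⟨v, hv⟩ with hz
    have hzd : z.1 ∉ d.snd () := fun h => (d.compl () z.1).1 h z.2
    have hze : z.1 ∉ e.fst () := fun h => by
      have := (hg () z h).symm.trans (congrArg Subtype.val h₁)
      exact hzd ((hd _).2 (.inr this))
    rcases (he _).1 ((e.compl () z.1).2 hze) with h | h
    · exact h
    · exact absurd ((hd _).2 (.inl h)) hzd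
  have h₃ : (g ()).symm ⟨v, hv⟩ = ⟨x, hx⟩ := Subtype.ext h₂
  rw [← h₃, h₁]

/-- The bijection `g` moves only `x`, which it sends to `v`, so it respects every colouring for
which `x` and `v` have the same colour. -/
theorem inside_eq_pull {X : FB} {d e : Dec X} {x y v : X.carrier ()} (hyv : y ≠ v) (hxv : x ≠ v) (hd : ∀ z, z ∈ d.snd () ↔ z = y ∨ z = v)
    (he : ∀ z, z ∈ e.snd () ↔ z = x ∨ z = y) (g : part d.fst ⟶ part e.fst)
    (hg : ∀ i (z : (part d.fst).carrier i), z.1 ∈ e.fst i → (g i z).1 = z.1) (a : Dec X)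
    (h : x ∈ a.fst () ↔ v ∈ a.fst ()) : a.inside d.fst = (a.inside e.fst).pull g := by
  have key : ∀ z : (part d.fst).carrier (), z.1 ∈ a.fst () ↔ (g () z).1 ∈ a.fst () := fun z => by
    by_cases hz : z.1 ∈ e.fst ()
    · rw [hg () z hz]
    · have hz' : z.1 = x := by
        rcases (he _).1 ((e.compl () z.1).2 hz) with h | h
        · exact h
        · exact absurd z.2 ((d.compl () z.1).1 ((hd _).2 (.inl h)))
      obtain ⟨z, hzd⟩ := z
      obtain rfl : z = x := hz'
      rw [relabel_apply hyv hxv hd he g hg hzd]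
      exact h
  refine Dec.ext ?_ ?_ <;> funext i <;> ext z
  · exact key z
  · exact (a.compl () _).trans ((not_congr (key z)).trans (a.compl () _).symm)

/-- A colouring of `X \ {y, v}` extends in a unique way to a colouring of `X` for which the colour
of `y` is different from that of `x` and from that of `v`. -/
theorem existsUnique_inside {X : FB} {d : Dec X} {x y v : X.carrier ()} (hxy : x ≠ y)
    (hyv : y ≠ v) (hxv : x ≠ v) (hd : ∀ z, z ∈ d.snd () ↔ z = y ∨ z = v) (p : Dec (part d.fst)) :
    ∃! a : Dec X, ((y ∈ a.fst () ↔ v ∉ a.fst ()) ∧ (x ∈ a.fst () ↔ y ∉ a.fst ())) ∧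
      a.inside d.fst = p := by
  have hx : x ∈ d.fst () := by
    by_contra h
    rcases (hd x).1 ((d.compl () x).2 h) with h | h
    · exact hxy h
    · exact hxv h
  have hy : y ∉ d.fst () := (d.compl () y).1 ((hd y).2 (.inl rfl))
  have hv : v ∉ d.fst () := (d.compl () v).1 ((hd v).2 (.inr rfl))
  -- The inputs of the extension: `p` on its domain, the colour opposite to that of `x` at `y`, and
  -- the colour of `x` at `v`.
  let F : Set (X.carrier ()) := {z | (∃ h : z ∈ d.fst (), (⟨z, h⟩ : (part d.fst).carrier ()) ∈
    p.fst ()) ∨ (z = y ∧ (⟨x, hx⟩ : (part d.fst).carrier ()) ∉ p.fst ()) ∨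
      (z = v ∧ (⟨x, hx⟩ : (part d.fst).carrier ()) ∈ p.fst ())}
  have hF : ∀ z (h : z ∈ d.fst ()), z ∈ F ↔ (⟨z, h⟩ : (part d.fst).carrier ()) ∈ p.fst () :=
    fun z h => by
      refine ⟨?_, fun h' => .inl ⟨h, h'⟩⟩
      rintro (⟨_, h'⟩ | ⟨rfl, _⟩ | ⟨rfl, _⟩)
      · exact h'
      · exact absurd h hy
      · exact absurd h hv
  have hFy : y ∈ F ↔ (⟨x, hx⟩ : (part d.fst).carrier ()) ∉ p.fst () := by
    refine ⟨?_, fun h => .inr (.inl ⟨rfl, h⟩)⟩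
    rintro (⟨h, _⟩ | ⟨_, h⟩ | ⟨h, _⟩)
    · exact absurd h hy
    · exact h
    · exact absurd h hyv
  have hFv : v ∈ F ↔ (⟨x, hx⟩ : (part d.fst).carrier ()) ∈ p.fst () := by
    refine ⟨?_, fun h => .inr (.inr ⟨rfl, h⟩)⟩
    rintro (⟨h, _⟩ | ⟨h, _⟩ | ⟨_, h⟩)
    · exact absurd h hv
    · exact absurd h hyv.symm
    · exact h
  have hFx := hF x hx
  refine ⟨⟨fun _ => F, fun _ => Fᶜ, fun _ _ => Iff.rfl⟩, ⟨⟨?_, ?_⟩, ?_⟩, ?_⟩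
  · change y ∈ F ↔ v ∉ F
    tauto
  · change x ∈ F ↔ y ∉ F
    tauto
  · refine Dec.ext ?_ ?_ <;> funext i <;> ext z
    · exact hF z.1 z.2
    · exact (not_congr (hF z.1 z.2)).trans (p.compl () z).symm
  · rintro a ⟨⟨h₁, h₂⟩, rfl⟩
    -- Outside {y, v} the colouring is prescribed, and at `y` and `v` the conditions force it from
    -- the colour of `x`.
    have key : ∀ z, z ∈ a.fst () ↔ z ∈ F := fun z => by
      by_cases hz : z ∈ d.fst ()
      · exact (hF z hz).symm
      · have hFx' : (⟨x, hx⟩ : (part d.fst).carrier ()) ∈ (a.inside d.fst).fst () ↔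
          x ∈ a.fst () := Iff.rfl
        rcases (hd z).1 ((d.compl () z).2 hz) with rfl | rfl <;> tauto
    refine Dec.ext ?_ ?_ <;> funext i <;> ext z
    · exact key z
    · exact (a.compl () z).trans (not_congr (key z))

end Colourings
-- The unit axiom for induction
section PushUnit

variable {k : Type u} [Field k]

theorem sideProj_pushLax_dayIncl (M N : FMod Side k) {X : FB} (a d : Dec X)
    (u : (amalgPush.obj M).obj (part d.fst) ⊗[k] (amalgPush.obj N).obj (part d.snd)) :
    sideProj (day M N) a
        (((pushLax M N).app X).hom (dayIncl (amalgPush.obj M) (amalgPush.obj N) d u)) =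
      dayIncl M N (d.cross a) (TensorProduct.map
        ((M.map (crossPart a d.fst (d.cross a).fst fun _ _ => Iff.rfl)).hom ∘ₗ
          sideProj M (a.inside d.fst))
        ((N.map (crossPart a d.snd (d.cross a).snd fun _ _ => Iff.rfl)).hom ∘ₗ
          sideProj N (a.inside d.snd)) u) := by
  funext d'
  by_cases h : d' = d.cross a
  · subst h
    refine (dayProj_sideProj_pushLax M N a d _ (a.join_cross d) _).trans ?_
    refine (congrArg _ (LinearMap.congr_fun
      (dayProj_comp_dayIncl (amalgPush.obj M) (amalgPush.obj N) d) u)).trans ?_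
    exact (LinearMap.congr_fun (dayProj_comp_dayIncl M N (d.cross a)) _).symm
  · have h' : a.join d' ≠ d := fun h' => h ((a.cross_join d').symm.trans (congrArg (·.cross a) h'))
    refine (dayProj_sideProj_pushLax M N a _ d' rfl _).trans ?_
    refine (congrArg _ (LinearMap.congr_fun
      (dayProj_comp_dayIncl_ne (amalgPush.obj M) (amalgPush.obj N) h') u)).trans ?_
    exact (map_zero _).trans (LinearMap.congr_fun (dayProj_comp_dayIncl_ne M N h) _).symm

/-- A form of `map_comp_sideIncl` for a colouring that is only propositionally a pullback, with the
induced bijection described by its values. -/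
theorem exists_map_comp_sideIncl (M : FMod Side k) {X Y : FB} (g : X ⟶ Y) {p : Dec X} (q : Dec Y)
    (h : p = q.pull g) :
    ∃ f : pair p ⟶ pair q, (∀ s x, (f s x).1 = g () x.1) ∧
      ((pushObj M).map g).hom ∘ₗ sideIncl M p = sideIncl M q ∘ₗ (M.map f).hom := by
  subst h
  exact ⟨pairRestr g q, fun _ _ => rfl, map_comp_sideIncl M g q⟩

theorem pushProj_gen {X : FB} (q : Dec X) (h : HasCard oneOne (pair q)) :
    ((pushProj k).app X).hom (sideIncl (unitMod k oneOne) q (gen k oneOne (pair q))) =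
      gen k two X := by
  funext _
  refine (LinearMap.sum_apply Finset.univ
    (fun b : Dec X => scalar k (pair b) ∘ₗ sideProj (unitMod k oneOne) b) _).trans ?_
  refine (Finset.sum_eq_single q (fun b _ hb => ?_) (by simp)).trans ?_
  · exact (congrArg (scalar k (pair b)) (LinearMap.congr_fun
      (sideProj_comp_sideIncl_ne (unitMod k oneOne) hb) (gen k oneOne (pair q)))).trans
        (map_zero _)
  · exact (congrArg (scalar k (pair q)) (LinearMap.congr_fun
      (sideProj_comp_sideIncl (unitMod k oneOne) q) (gen k oneOne (pair q)))).trans (scalar_gen h)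

/-- The hypothesis says that `φ` is a bijection from the indices satisfying `P` to `κ`. -/
theorem sum_ite_of_existsUnique {ι κ A : Type*} [Fintype ι] [Fintype κ] [AddCommMonoid A]
    (P : ι → Prop) [DecidablePred P] (φ : ι → κ) (h : ∀ p, ∃! a, P a ∧ φ a = p) (G : κ → A) :
    ∑ a, (if P a then G (φ a) else 0) = ∑ p, G p := by
  rw [← Finset.sum_filter]
  refine Finset.sum_nbij φ (fun _ _ => Finset.mem_univ _) (fun a ha b hb hab => ?_)
    (fun p _ => ?_) fun _ _ => rfl
  · simp only [Finset.coe_filter, Finset.mem_univ, true_and, Set.mem_ofPred_eq] at ha hb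
    exact (h (φ b)).unique ⟨ha, hab⟩ ⟨hb, rfl⟩
  · obtain ⟨a, ⟨ha, hp⟩, _⟩ := h p
    exact ⟨a, by simpa using ha, hp⟩

theorem subsingleton_unitMod {c : Type} {n : c → ℕ} {X : FinFam c} (h : ¬ HasCard n X) :
    Subsingleton ((unitMod k n).obj X) :=
  ⟨fun _ _ => funext fun h' => absurd h'.down h⟩

theorem component_pushStrong {M : FMod Side k}
    (ψ : day M (unitMod k oneOne) ⟶ day M (unitMod k oneOne)) {X : FB} (d e : Dec X)
    (v : (amalgPush.obj M).obj (part d.fst) ⊗[k] (unitMod k two).obj (part d.snd)) :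
    component (dayMap (𝟙 (amalgPush.obj M)) (pushIncl k) ≫ pushLax M (unitMod k oneOne) ≫
      amalgPush.map ψ ≫ pushOplax M (unitMod k oneOne) ≫ dayMap (𝟙 _) (pushProj k)) d e v =
    ∑ a : Dec X, TensorProduct.map
      (sideIncl M (a.inside e.fst) ∘ₗ
        (M.map (inv (crossPart a e.fst (e.cross a).fst fun _ _ => Iff.rfl))).hom)
      (((pushProj k).app (part e.snd)).hom ∘ₗ sideIncl (unitMod k oneOne) (a.inside e.snd) ∘ₗ
        ((unitMod k oneOne).map (inv (crossPart a e.snd (e.cross a).snd fun _ _ => Iff.rfl))).hom)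
      (component ψ (d.cross a) (e.cross a) (TensorProduct.map
        ((M.map (crossPart a d.fst (d.cross a).fst fun _ _ => Iff.rfl)).hom ∘ₗ
          sideProj M (a.inside d.fst))
        (((unitMod k oneOne).map (crossPart a d.snd (d.cross a).snd fun _ _ => Iff.rfl)).hom ∘ₗ
          sideProj (unitMod k oneOne) (a.inside d.snd))
        (TensorProduct.map LinearMap.id ((pushIncl k).app (part d.snd)).hom v))) := by
  refine (dayProj_pushStrong ψ (pushProj k) e _).trans (Finset.sum_congr rfl fun a _ => ?_)
  refine congrArg _ (congrArg (fun y => dayProj M (unitMod k oneOne) (e.cross a)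
    ((ψ.app (pair a)).hom y)) ?_)
  exact (congrArg (fun y => sideProj (day M (unitMod k oneOne)) a
      (((pushLax M (unitMod k oneOne)).app X).hom y))
    (dayMap_dayIncl (𝟙 (amalgPush.obj M)) (pushIncl k) d v)).trans
    (sideProj_pushLax_dayIncl M (unitMod k oneOne) a d _)

-- For each colouring that contributes, the original relabelling axiom moves the value of `m` at the
-- restricted colouring. By `existsUnique_inside`, each colouring of `d.fst` arises exactly once, so
-- every component of `m` is relabelled once, with coefficient one.
open Classical in
theorem pushStrong_relabelling {M : FMod Side k}
    {ψ : day M (unitMod k oneOne) ⟶ day M (unitMod k oneOne)} (h : IsRelabelling ψ) :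
    IsRelabelling (dayMap (𝟙 (amalgPush.obj M)) (pushIncl k) ≫ pushLax M (unitMod k oneOne) ≫
      amalgPush.map ψ ≫ pushOplax M (unitMod k oneOne) ≫ dayMap (𝟙 _) (pushProj k)) := by
  intro X d e
  constructor
  · intro ho hd he g hg m
    obtain ⟨x, y, v, hxy, hyv, hxv, hd', he'⟩ := exists_of_overlap ho hd he
    -- `L m` is the value that the axiom requires, and `G p` is the part of it due to the component
    -- of `m` at the colouring `p`.
    let L : (pushObj M).obj (part d.fst) →ₗ[k]
        (pushObj M).obj (part e.fst) ⊗[k] (unitMod k two).obj (part e.snd) :=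
      (TensorProduct.mk k ((pushObj M).obj (part e.fst)) ((unitMod k two).obj (part e.snd))).flip
        (gen k two (part e.snd)) ∘ₗ ((pushObj M).map g).hom
    let G : Dec (part d.fst) → (pushObj M).obj (part e.fst) ⊗[k] (unitMod k two).obj (part e.snd) :=
      fun p => L (sideIncl M p (sideProj M p m))
    have hsum : ∑ p, G p = L m := (map_sum L _ _).symm.trans (congrArg L
      ((LinearMap.sum_apply _ _ _).symm.trans
        (LinearMap.congr_fun (sum_sideIncl_comp_sideProj M (part d.fst)) m)))
    refine (component_pushStrong ψ d e _).trans (Eq.trans ?_ hsum)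
    -- The sum over colourings of `d.fst` becomes a sum over the colourings of `X` in which `y`
    -- differs from both `v` and `x`, to be compared term by term.
    refine Eq.trans ?_ (sum_ite_of_existsUnique _ (fun a : Dec X => a.inside d.fst)
      (fun p => existsUnique_inside hxy hyv hxv hd' p) G)
    refine Finset.sum_congr rfl fun a _ => ?_
    have hda := hasCard_cross_iff a d hyv hd'
    have hea := hasCard_cross_iff a e hxy he'
    split_ifs with ha
    -- With only two colours, `x` and `v` both have the colour opposite to that of `y`, so `g`
    -- respects `a`.
    · obtain ⟨f, hf, hf'⟩ := exists_map_comp_sideIncl M g (a.inside e.fst)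
        (inside_eq_pull hyv hxv hd' he' g hg a (by tauto))
      let cd := crossPart a d.fst (d.cross a).fst fun _ _ => Iff.rfl
      let ce := crossPart a e.fst (e.cross a).fst fun _ _ => Iff.rfl
      have h₁ := (h (pair a) (d.cross a) (e.cross a)).1 ((overlap_cross a d e).trans ho)
        (hda.2 ha.1) (hea.2 ha.2) (inv cd ≫ f ≫ ce)
        (fun s z hz => Subtype.ext ((congrArg Subtype.val (hf s _)).trans
          (hg () ⟨z.1.1, z.2⟩ hz)))
        ((M.map cd).hom (sideProj M (a.inside d.fst) m))
      have h₂ : (M.map (inv ce)).hom ∘ₗ (M.map (inv cd ≫ f ≫ ce)).hom ∘ₗ (M.map cd).hom =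
          (M.map f).hom := by
        rw [← ModuleCat.hom_comp, ← ModuleCat.hom_comp, ← M.map_comp, ← M.map_comp]
        rfl
      have h₃ := pushProj_gen (k := k) (a.inside e.snd) ((hea.2 ha.2).of_hom
        (crossPart a e.snd (e.cross a).snd fun _ _ => Iff.rfl))
      refine (congrArg _ h₁).trans (congrArg₂ (· ⊗ₜ[k] ·) ?_ h₃)
      exact (congrArg (sideIncl M (a.inside e.fst)) (LinearMap.congr_fun h₂ _)).trans
        (LinearMap.congr_fun hf' _).symm
    -- If `y` and `v` have the same colour, the unit inserted at `d` vanishes; if `x` and `y` do,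
    -- the unit remaining at `e` lies in a zero space.
    · rw [not_and_or, ← hda, ← hea] at ha
      rcases ha with ha | ha
      · have h₁ : gen k oneOne (part (d.cross a).snd) = 0 :=
          (subsingleton_unitMod ha).elim _ _
        refine (congrArg _ (congrArg _ ((congrArg (_ ⊗ₜ[k] ·) h₁).trans
          (TensorProduct.tmul_zero _ _)))).trans ?_
        exact (congrArg _ (map_zero _)).trans (map_zero _)
      · have h₁ : ((pushProj k).app (part e.snd)).hom ∘ₗ
            sideIncl (unitMod k oneOne) (a.inside e.snd) ∘ₗ ((unitMod k oneOne).map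
              (inv (crossPart a e.snd (e.cross a).snd fun _ _ => Iff.rfl))).hom = 0 :=
          LinearMap.ext fun z => by
            rw [(subsingleton_unitMod ha).elim z 0, map_zero, map_zero]
        refine (congrArg (fun T => TensorProduct.map _ T _) h₁).trans ?_
        exact LinearMap.congr_fun (TensorProduct.map_zero_right _) _
  · intro ho
    refine LinearMap.ext fun v => (component_pushStrong ψ d e v).trans
      (Finset.sum_eq_zero fun a _ => ?_)
    rw [(h (pair a) (d.cross a) (e.cross a)).2 fun h' => ho ((overlap_cross a d e).symm.trans h')]
    exact map_zero _

end PushUnit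
-- The functors between categories of operads
section Functors

variable {k : Type u} [Field k]

/-- For symmetric μ, the left and right unit composites coincide after exchanging the factors, so
the left unit axiom is a consequence of the right one. -/
theorem braid_comp_dayMap_comp {c : Type} {M K L : FMod c k} {μ : day M M ⟶ L}
    (h : braid M M ≫ μ = μ) (η : K ⟶ M) :
    braid M K ≫ dayMap η (𝟙 M) ≫ μ = dayMap (𝟙 M) η ≫ μ := by
  rw [← reassoc_of% braid_naturality, h]

namespace Strong

variable {c c' : Type} [Finite c] [Finite c'] {n : c → ℕ} {n' : c' → ℕ}
  {Φ : FMod c k ⥤ FMod c' k} (S : Strong Φ)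

theorem isSymmetric_mu {M : FMod c k} {μ : day M M ⟶ day M (unitMod k n)} (h : IsSymmetric μ)
    (π : Φ.obj (unitMod k n) ⟶ unitMod k n') : IsSymmetric (S.mu μ π) :=
  (isSymmetric_iff _).2 (S.braid_comp_mu π ((isSymmetric_iff μ).1 h))

theorem isAssociative_mu [CharZero k] [Φ.Additive] {M : FMod c k}
    {μ : day M M ⟶ day M (unitMod k n)} (h : IsAssociative μ)
    (π : Φ.obj (unitMod k n) ⟶ unitMod k n') : IsAssociative (S.mu μ π) :=
  (isAssociative_iff _).2 (S.associative_mu π ((isAssociative_iff μ).1 h))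

end Strong

theorem starStrong_mu_right_unit (C : CyclOpd k) :
    IsRelabelling (dayMap (𝟙 (amalgStar.obj C.mod)) (starIncl k ≫ amalgStar.map C.eta) ≫
      starStrong.mu C.mu (starProj k)) := by
  rw [Strong.dayMap_comp_mu]
  exact starStrong_relabelling C.right_unit

theorem pushStrong_mu_right_unit (D : DiOpd k) :
    IsRelabelling (dayMap (𝟙 (amalgPush.obj D.mod)) (pushIncl k ≫ amalgPush.map D.eta) ≫
      pushStrong.mu D.mu (pushProj k)) := by
  rw [Strong.dayMap_comp_mu]
  exact pushStrong_relabelling D.right_unit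

variable [CharZero k]

/-- The dioperad without unit `amalgStar C`. -/
noncomputable def starOperadNU (C : CyclOpdNU k) : DiOpdNU k where
  toGrafting := starGrafting C.toGrafting
  zero X h := C.zero (amalg.obj X) fun _ => ⟨fun p => (h p.1).elim p.2⟩
  diagonal := starStrong_mu_diagonal C.diagonal
  symmetric := starStrong.isSymmetric_mu C.symmetric (starProj k)
  associative := starStrong.isAssociative_mu C.associative (starProj k)

/-- The dioperad `amalgStar C`. -/
noncomputable def starOperadU (C : CyclOpd k) : DiOpd k where
  toOperadNU := starOperadNU C.toOperadNU
  eta := starIncl k ≫ amalgStar.map C.eta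
  right_unit := starStrong_mu_right_unit C
  left_unit := (congrArg IsRelabelling (braid_comp_dayMap_comp
    (starStrong.braid_comp_mu (starProj k) ((isSymmetric_iff _).1 C.symmetric)) _)).mpr
      (starStrong_mu_right_unit C)

/-- The functor `amalgStar` from cyclic operads without unit to dioperads without unit. -/
noncomputable def starFunctorNU : CyclOpdNU k ⥤ DiOpdNU k where
  obj := starOperadNU
  map f := ⟨amalgStar.map (OperadNU.Hom.hom f),
    starStrong.mu_comp (starProj k) (OperadNU.Hom.hom f) (OperadNU.Hom.mu_comp f)⟩
  map_id _ := OperadNU.Hom.ext (amalgStar.map_id _)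
  map_comp _ _ := OperadNU.Hom.ext (amalgStar.map_comp _ _)

/-- The functor `amalgStar` from cyclic operads to dioperads. -/
noncomputable def starFunctorU : CyclOpd k ⥤ DiOpd k where
  obj := starOperadU
  map f :=
    { toHom := starFunctorNU.map (OperadU.forgetUnit.map f)
      eta_comp := (Category.assoc _ _ _).trans (congrArg (starIncl k ≫ ·)
        ((amalgStar.map_comp _ _).symm.trans
          (congrArg amalgStar.map (OperadU.Hom.eta_comp f)))) }
  map_id _ := OperadU.Hom.ext (amalgStar.map_id _)
  map_comp _ _ := OperadU.Hom.ext (amalgStar.map_comp _ _)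

/-- The cyclic operad without unit `amalgPush D`. -/
noncomputable def pushOperadNU (D : DiOpdNU k) : CyclOpdNU k where
  toGrafting := pushGrafting D.toGrafting
  zero _ h := ⟨fun x y => funext fun e =>
    (D.zero (pair e) fun _ => ⟨fun p => (h ()).elim p.1⟩).elim (x e) (y e)⟩
  diagonal := pushStrong_mu_diagonal D.diagonal
  symmetric := pushStrong.isSymmetric_mu D.symmetric (pushProj k)
  associative := pushStrong.isAssociative_mu D.associative (pushProj k)

/-- The cyclic operad `amalgPush D`. -/
noncomputable def pushOperadU (D : DiOpd k) : CyclOpd k where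
  toOperadNU := pushOperadNU D.toOperadNU
  eta := pushIncl k ≫ amalgPush.map D.eta
  right_unit := pushStrong_mu_right_unit D
  left_unit := (congrArg IsRelabelling (braid_comp_dayMap_comp
    (pushStrong.braid_comp_mu (pushProj k) ((isSymmetric_iff _).1 D.symmetric)) _)).mpr
      (pushStrong_mu_right_unit D)

/-- The functor `amalgPush` from dioperads without unit to cyclic operads without unit. -/
noncomputable def pushFunctorNU : DiOpdNU k ⥤ CyclOpdNU k where
  obj := pushOperadNU
  map f := ⟨amalgPush.map (OperadNU.Hom.hom f),
    pushStrong.mu_comp (pushProj k) (OperadNU.Hom.hom f) (OperadNU.Hom.mu_comp f)⟩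
  map_id _ := OperadNU.Hom.ext (amalgPush.map_id _)
  map_comp _ _ := OperadNU.Hom.ext (amalgPush.map_comp _ _)

/-- The functor `amalgPush` from dioperads to cyclic operads. -/
noncomputable def pushFunctorU : DiOpd k ⥤ CyclOpd k where
  obj := pushOperadU
  map f :=
    { toHom := pushFunctorNU.map (OperadU.forgetUnit.map f)
      eta_comp := (Category.assoc _ _ _).trans (congrArg (pushIncl k ≫ ·)
        ((amalgPush.map_comp _ _).symm.trans
          (congrArg amalgPush.map (OperadU.Hom.eta_comp f)))) }
  map_id _ := OperadU.Hom.ext (amalgPush.map_id _)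
  map_comp _ _ := OperadU.Hom.ext (amalgPush.map_comp _ _)

end Functors
end CycDi

/-- The functors carry the prescribed modules and structure maps by construction, so all the
compatibilities hold by definition; the content is that the transported structures satisfy the
axioms. -/
theorem mainTheorem10 (k : Type u) [Field k] [CharZero k] :
    (∃ (F : CycDi.CyclOpd k ⥤ CycDi.DiOpd k) (F' : CycDi.CyclOpdNU k ⥤ CycDi.DiOpdNU k),
      F ⋙ CycDi.OperadU.forgetUnit = CycDi.OperadU.forgetUnit ⋙ F' ∧
      F' ⋙ CycDi.OperadNU.forget = CycDi.OperadNU.forget ⋙ CycDi.amalgStar ∧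
      (∀ C : CycDi.CyclOpdNU k,
        (F'.obj C).toGrafting = CycDi.starGrafting C.toGrafting) ∧
      (∀ C : CycDi.CyclOpd k,
        (F.obj C).toUnitalGrafting = CycDi.starUnitalGrafting C.toUnitalGrafting)) ∧
    (∃ (G : CycDi.DiOpd k ⥤ CycDi.CyclOpd k) (G' : CycDi.DiOpdNU k ⥤ CycDi.CyclOpdNU k),
      G ⋙ CycDi.OperadU.forgetUnit = CycDi.OperadU.forgetUnit ⋙ G' ∧
      G' ⋙ CycDi.OperadNU.forget = CycDi.OperadNU.forget ⋙ CycDi.amalgPush ∧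
      (∀ D : CycDi.DiOpdNU k,
        (G'.obj D).toGrafting = CycDi.pushGrafting D.toGrafting) ∧
      (∀ D : CycDi.DiOpd k,
        (G.obj D).toUnitalGrafting = CycDi.pushUnitalGrafting D.toUnitalGrafting)) :=
  ⟨⟨CycDi.starFunctorU, CycDi.starFunctorNU, rfl, rfl, fun _ => rfl, fun _ => rfl⟩,
    ⟨CycDi.pushFunctorU, CycDi.pushFunctorNU, rfl, rfl, fun _ => rfl, fun _ => rfl⟩⟩
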